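/- Let $k$ be a field and let $H$ be a cocommutative Hopf algebra over $k$ with comultiplication $\Delta$, counit $\varepsilon$ and antipode $S$. Let $M$ be a modular crossed module over $H$, that is, a left $H$-module and right $H$-comodule with coaction $\rho(m)=\sum m_{(0)}\otimes m_{(1)}$ such that $$\rho(hm)=\sum h_{(2)}m_{(0)}\otimes h_{(3)}m_{(1)}S(h_{(1)}),\qquad \sum m_{(1)}m_{(0)}=m\qquad(h\in H,\ m\in M).$$ Let $Z_n(H,M)=H^{\otimes(n+1)}\otimes_H M$, where $H$ acts on $H^{\otimes(n+1)}$ on the right diagonally through the iterated comultiplication, be the cyclic object with face, degeneracy and cyclic operators $$\delta_i((h^0,\dots,h^n)\otimes_H m)=\varepsilon(h^i)(h^0,\dots,\widehat{h^i},\dots,h^n)\otimes_H m,$$ $$\sigma_i((h^0,\dots,h^n)\otimes_H m)=(h^0,\dots,\Delta h^i,\dots,h^n)\otimes_H m,$$ $$\tau_n((h^0,\dots,h^n)\otimes_H m)=\sum (h^n m_{(1)},h^0,\dots,h^{n-1})\otimes_H m_{(0)},$$ and let $\mathrm{HC}_*(H,M)$ be its cyclic homology, i.e. the homology of the total complex of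 its Tsygan double complex. If the coaction on $M$ is trivial, i.e. $\rho(m)=m\otimes 1$ for all $m\in M$, then for every $n\ge 0$ there is an isomorphism of $k$-vector spaces $$\mathrm{HC}_n(H,M)\;\cong\;\bigoplus_{i\ge 0,\ 2i\le n}\mathrm{Tor}^H_{n-2i}(k,M),$$ where $k$ is a right $H$-module via $\varepsilon$. -/

import Mathlib

open CategoryTheory
open scoped TensorProduct

universe v u

namespace HopfCyclic

/-- The `n`-fold composite `f ≫ ⋯ ≫ f` of an endomorphism. -/
def iter {C : Type u} [Category.{v} C] {X : C} (f : X ⟶ X) : ℕ → (X ⟶ X)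
  | 0 => 𝟙 X
  | n + 1 => iter f n ≫ f

/-- A cyclic object in a category: a simplicial object given by its face maps `δ` and degeneracy
maps `σ`, with cyclic operators `t`. Composites are written in diagrammatic order, so that for
instance `t (n + 1) ≫ δ i.succ = δ i.castSucc ≫ t n` is the usual `δᵢ₊₁ tₙ₊₁ = tₙ δᵢ`. -/
structure CyclicObject (C : Type u) [Category.{v} C] where
  X : ℕ → C
  δ {n : ℕ} (i : Fin (n + 2)) : X (n + 1) ⟶ X n
  σ {n : ℕ} (i : Fin (n + 1)) : X n ⟶ X (n + 1)
  t (n : ℕ) : X n ⟶ X n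
  δ_comp_δ {n : ℕ} {i j : Fin (n + 2)} (h : i ≤ j) :
    δ j.succ ≫ δ i = δ i.castSucc ≫ δ j
  δ_comp_σ_of_le {n : ℕ} {i : Fin (n + 2)} {j : Fin (n + 1)} (h : i ≤ j.castSucc) :
    σ j.succ ≫ δ i.castSucc = δ i ≫ σ j
  δ_comp_σ_self {n : ℕ} (i : Fin (n + 1)) : σ i ≫ δ i.castSucc = 𝟙 (X n)
  δ_comp_σ_succ {n : ℕ} (i : Fin (n + 1)) : σ i ≫ δ i.succ = 𝟙 (X n)
  δ_comp_σ_of_gt {n : ℕ} {i : Fin (n + 2)} {j : Fin (n + 1)} (h : j.castSucc < i) :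
    σ j.castSucc ≫ δ i.succ = δ i ≫ σ j
  σ_comp_σ {n : ℕ} {i j : Fin (n + 1)} (h : i ≤ j) :
    σ i ≫ σ j.succ = σ j ≫ σ i.castSucc
  t_comp_δ_zero (n : ℕ) : t (n + 1) ≫ δ 0 = δ (Fin.last (n + 1))
  t_comp_δ_succ {n : ℕ} (i : Fin (n + 1)) :
    t (n + 1) ≫ δ i.succ = δ i.castSucc ≫ t n
  t_comp_σ_zero (n : ℕ) :
    t n ≫ σ 0 = σ (Fin.last n) ≫ t (n + 1) ≫ t (n + 1)
  t_comp_σ_succ {n : ℕ} (i : Fin n) :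
    t n ≫ σ i.succ = σ i.castSucc ≫ t (n + 1)
  iter_t (n : ℕ) : iter (t n) (n + 1) = 𝟙 (X n)

theorem alternating_sum_comp_eq_zero {C : Type u} [Category.{v} C] [Preadditive C]
    {X Y Z : C} {m : ℕ} (a : Fin (m + 1) → (X ⟶ Y)) (c : Fin m → (Y ⟶ Z))
    (h : ∀ i j : Fin m, i ≤ j → a j.succ ≫ c i = a i.castSucc ≫ c j) :
    (∑ i : Fin (m + 1), (-1 : ℤ) ^ (i : ℕ) • a i) ≫ (∑ i : Fin m, (-1 : ℤ) ^ (i : ℕ) • c i) = 0 := by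
  simp only [Preadditive.sum_comp, Preadditive.comp_sum, Preadditive.zsmul_comp,
    Preadditive.comp_zsmul, Finset.smul_sum, smul_smul]
  rw [Finset.sum_comm, ← Finset.sum_product']
  let P := Fin (m + 1) × Fin m
  let S : Finset P := {ij : P | (ij.2 : ℕ) < (ij.1 : ℕ)}
  rw [Finset.univ_product_univ, ← Finset.sum_add_sum_compl S, ← eq_neg_iff_add_eq_zero,
    ← Finset.sum_neg_distrib]
  refine Finset.sum_bij'
    (i := fun ij hij ↦ (⟨ij.2, by omega⟩, ⟨ij.1 - 1, by
      simp only [S, Finset.mem_filter] at hij; omega⟩))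
    (j := fun ij _ ↦ (ij.2.succ, ⟨ij.1, by
      rename_i hij; simp only [S, Finset.mem_compl, Finset.mem_filter, Finset.mem_univ, true_and] at hij; omega⟩))
    ?_ ?_ ?_ ?_ ?_
  · rintro ⟨i, j⟩ hij
    simp [S] at hij ⊢; omega
  · rintro ⟨i, j⟩ hij
    simp [S] at hij ⊢; omega
  · rintro ⟨i, j⟩ hij
    simp only [S, Finset.mem_filter, Finset.mem_univ, true_and] at hij
    ext
    · simp only [Fin.val_succ]; omega
    · rfl
  · rintro ⟨i, j⟩ hij
    ext <;> simp
  · rintro ⟨i, j⟩ hij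
    simp only [S, Finset.mem_filter, Finset.mem_univ, true_and] at hij
    obtain ⟨i', rfl⟩ : ∃ i' : Fin m, i = i'.succ := ⟨⟨(i : ℕ) - 1, by omega⟩, by ext; simp only [Fin.val_succ]; omega⟩
    have := h j i' (by rw [Fin.le_def]; simp only [Fin.val_succ] at hij; omega)
    rw [this]
    simp only [Fin.val_succ, Nat.add_sub_cancel, Fin.eta]
    rw [show (⟨(j : ℕ), by omega⟩ : Fin (m + 1)) = j.castSucc from rfl, ← neg_smul]
    congr 1
    ring

namespace CyclicObject
variable {C : Type u} [Category.{v} C] [Preadditive C] (Z : CyclicObject C)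

/-- The Hochschild differential `b = ∑_{i=0}^{n+1} (-1)ⁱ δᵢ : Xₙ₊₁ ⟶ Xₙ`. -/
def b (n : ℕ) : Z.X (n + 1) ⟶ Z.X n :=
  ∑ i : Fin (n + 2), (-1 : ℤ) ^ (i : ℕ) • Z.δ i

/-- The acyclic differential `∑_{i=0}^{n} (-1)ⁱ δᵢ : Xₙ₊₁ ⟶ Xₙ`, without the last face. -/
def b' (n : ℕ) : Z.X (n + 1) ⟶ Z.X n :=
  ∑ i : Fin (n + 1), (-1 : ℤ) ^ (i : ℕ) • Z.δ i.castSucc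

/-- The signed cyclic operator `(-1)ⁿ tₙ`. -/
def T (n : ℕ) : Z.X n ⟶ Z.X n := (-1 : ℤ) ^ n • Z.t n

/-- The norm operator `1 + T + ⋯ + Tⁿ`. -/
def N (n : ℕ) : Z.X n ⟶ Z.X n := ∑ i ∈ Finset.range (n + 1), iter (Z.T n) i

theorem b_comp_b (n : ℕ) : Z.b (n + 1) ≫ Z.b n = 0 :=
  alternating_sum_comp_eq_zero _ _ fun _ _ h ↦ Z.δ_comp_δ h

theorem b'_comp_b' (n : ℕ) : Z.b' (n + 1) ≫ Z.b' n = 0 :=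
  alternating_sum_comp_eq_zero (fun i ↦ Z.δ i.castSucc) (fun i ↦ Z.δ i.castSucc)
    fun i j h ↦ Z.δ_comp_δ (i := i.castSucc) (j := j.castSucc) h

theorem iter_T (n : ℕ) : iter (Z.T n) (n + 1) = 𝟙 _ := by
  have h (i : ℕ) : iter (Z.T n) i = ((-1 : ℤ) ^ n) ^ i • iter (Z.t n) i := by
    induction i with
    | zero => simp [iter]
    | succ i ih =>
      rw [iter, ih, iter, T, Preadditive.zsmul_comp, Preadditive.comp_zsmul, smul_smul, ← pow_succ]
  rw [h, iter_t, ← pow_mul, Even.neg_one_pow (Nat.even_mul_succ_self n), one_smul]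

theorem comp_iter {X : C} (f : X ⟶ X) (i : ℕ) : f ≫ iter f i = iter f (i + 1) := by
  induction i with
  | zero => simp [iter]
  | succ i ih => rw [iter, ← Category.assoc, ih, ← iter]

theorem iter_comp_iter {X : C} (f : X ⟶ X) (i j : ℕ) : iter f i ≫ iter f j = iter f (i + j) := by
  induction j with
  | zero => simp [iter]
  | succ j ih => rw [iter, ← Category.assoc, ih, ← Nat.add_assoc, iter]

theorem N_comp_T (n : ℕ) : Z.N n ≫ Z.T n = Z.N n := by
  have h : ∑ i ∈ Finset.range (n + 1), iter (Z.T n) (i + 1) = Z.N n := by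
    have h1 := Finset.sum_range_succ (iter (Z.T n)) (n + 1)
    rw [Finset.sum_range_succ', iter_T, iter] at h1
    exact add_right_cancel h1
  conv_rhs => rw [← h]
  rw [N, Preadditive.sum_comp]
  rfl

theorem T_comp_N (n : ℕ) : Z.T n ≫ Z.N n = Z.N n := by
  conv_rhs => rw [← N_comp_T]
  simp only [N, Preadditive.sum_comp, Preadditive.comp_sum, comp_iter]
  rfl

theorem N_comp_one_sub_T (n : ℕ) : Z.N n ≫ (𝟙 _ - Z.T n) = 0 := by
  rw [Preadditive.comp_sub, N_comp_T, Category.comp_id, sub_self]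

theorem one_sub_T_comp_N (n : ℕ) : (𝟙 _ - Z.T n) ≫ Z.N n = 0 := by
  rw [Preadditive.sub_comp, T_comp_N, Category.id_comp, sub_self]

theorem b_eq (n : ℕ) : Z.b n = Z.b' n + (-1 : ℤ) ^ (n + 1) • Z.δ (Fin.last (n + 1)) := by
  rw [b, b', Fin.sum_univ_castSucc]; simp

theorem T_comp_b (n : ℕ) :
    Z.T (n + 1) ≫ Z.b n = Z.b' n ≫ Z.T n + (-1 : ℤ) ^ (n + 1) • Z.δ (Fin.last (n + 1)) := by
  simp only [T, b, b', Fin.sum_univ_succ (n := n + 1), Preadditive.comp_add, Preadditive.comp_sum,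
    Preadditive.sum_comp, Preadditive.zsmul_comp, Preadditive.comp_zsmul, smul_smul,
    t_comp_δ_zero, t_comp_δ_succ, Fin.val_zero, pow_zero, one_mul, Fin.val_succ]
  rw [add_comm (_ • _), Finset.smul_sum]
  congr 1
  refine Finset.sum_congr rfl fun i _ ↦ ?_
  rw [smul_smul]
  congr 1
  ring

theorem one_sub_T_comp_b (n : ℕ) :
    (𝟙 _ - Z.T (n + 1)) ≫ Z.b n = Z.b' n ≫ (𝟙 _ - Z.T n) := by
  rw [Preadditive.sub_comp, Preadditive.comp_sub, T_comp_b, b_eq, Category.id_comp,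
    Category.comp_id]
  abel

theorem iter_T_comp_δ {n : ℕ} (i : ℕ) (hi : i < n + 2) :
    iter (Z.T (n + 1)) i ≫ ((-1 : ℤ) ^ i • Z.δ ⟨i, hi⟩) = Z.δ 0 ≫ iter (Z.T n) i := by
  induction i with
  | zero => simp [iter]
  | succ i ih =>
    have h1 : Z.T (n + 1) ≫ ((-1 : ℤ) ^ (i + 1) • Z.δ ⟨i + 1, hi⟩) =
        ((-1 : ℤ) ^ i • Z.δ ⟨i, by omega⟩) ≫ Z.T n := by
      have := Z.t_comp_δ_succ (n := n) ⟨i, by omega⟩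
      simp only [Fin.succ_mk, Fin.castSucc_mk] at this
      simp only [T, Preadditive.zsmul_comp, Preadditive.comp_zsmul, smul_smul, this]
      congr 1
      ring
    rw [iter, Category.assoc, h1, ← Category.assoc, ih (by omega), Category.assoc, iter]

theorem iter_T_comp_N (n i : ℕ) : iter (Z.T n) i ≫ Z.N n = Z.N n := by
  induction i with
  | zero => simp [iter]
  | succ i ih => rw [iter, Category.assoc, T_comp_N, ih]

theorem N_comp_iter_T (n i : ℕ) : Z.N n ≫ iter (Z.T n) i = Z.N n := by
  induction i with
  | zero => simp [iter]
  | succ i ih => rw [iter, ← Category.assoc, ih, N_comp_T]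

theorem N_comp_b' (n : ℕ) : Z.N (n + 1) ≫ Z.b' n = Z.b n ≫ Z.N n := by
  have key (i : ℕ) (hi : i < n + 2) : Z.N (n + 1) ≫ ((-1 : ℤ) ^ i • Z.δ ⟨i, hi⟩) =
      Z.N (n + 1) ≫ Z.δ 0 ≫ iter (Z.T n) i := by
    rw [← Z.iter_T_comp_δ i hi, ← Category.assoc, N_comp_iter_T]
  have key' (i : ℕ) (hi : i < n + 2) : ((-1 : ℤ) ^ i • Z.δ ⟨i, hi⟩) ≫ Z.N n =
      iter (Z.T (n + 1)) (n + 2 - i) ≫ Z.δ 0 ≫ Z.N n := by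
    have h := congrArg (fun f ↦ iter (Z.T (n + 1)) (n + 2 - i) ≫ f ≫ Z.N n)
      (Z.iter_T_comp_δ i hi)
    simp only [Category.assoc, iter_T_comp_N] at h
    rw [← h, ← Category.assoc (iter _ _) (iter _ _), iter_comp_iter,
      Nat.sub_add_cancel hi.le, iter_T, Category.id_comp]
  have h1 : Z.N (n + 1) ≫ Z.b' n = Z.N (n + 1) ≫ Z.δ 0 ≫ Z.N n := by
    rw [b', Preadditive.comp_sum, N.eq_def Z n, Preadditive.comp_sum, Preadditive.comp_sum,
      Finset.sum_range]
    exact Finset.sum_congr rfl fun i _ ↦ key i (by omega)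
  have h2 : Z.b n ≫ Z.N n = Z.N (n + 1) ≫ Z.δ 0 ≫ Z.N n := by
    rw [← Z.N_comp_T (n + 1), N.eq_def Z (n + 1), Preadditive.sum_comp, ← Finset.sum_range_reflect,
      Finset.sum_range, Preadditive.sum_comp, b, Preadditive.sum_comp]
    refine Finset.sum_congr rfl fun i _ ↦ ?_
    rw [← iter, Nat.succ_eq_add_one, show n + 1 + 1 - 1 - (i : ℕ) + 1 = n + 2 - i by omega]
    exact key' i i.2
  rw [h1, h2]

noncomputable section

/-- The columns of the Tsygan double complex: the Hochschild complex `(X, b)` in even degrees, the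
acyclic complex `(X, b')` in odd degrees. The sign that makes the squares anticommute is introduced
by the total complex. -/
def tsyganColumn : ℕ → ChainComplex C ℕ
  | 0 => ChainComplex.of Z.X Z.b Z.b_comp_b
  | 1 => ChainComplex.of Z.X Z.b' Z.b'_comp_b'
  | p + 2 => tsyganColumn p

/-- The horizontal differentials: `1 - T` from odd to even columns, `N` from even to odd ones. -/
def tsyganD : ∀ p : ℕ, Z.tsyganColumn (p + 1) ⟶ Z.tsyganColumn p
  | 0 => ChainComplex.ofHom (X := ChainComplex.of Z.X Z.b' Z.b'_comp_b')
      (Y := ChainComplex.of Z.X Z.b Z.b_comp_b) (fun n ↦ 𝟙 (Z.X n) - Z.T n) fun n ↦ by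
        simp only [ChainComplex.of, ChainComplex.of_d]; exact Z.one_sub_T_comp_b n
  | 1 => ChainComplex.ofHom (X := ChainComplex.of Z.X Z.b Z.b_comp_b)
      (Y := ChainComplex.of Z.X Z.b' Z.b'_comp_b') Z.N fun n ↦ by
        simp only [ChainComplex.of, ChainComplex.of_d]; exact Z.N_comp_b' n
  | p + 2 => tsyganD p

theorem tsyganD_comp : ∀ p : ℕ, Z.tsyganD (p + 1) ≫ Z.tsyganD p = 0
  | 0 => by
    ext n
    exact Z.N_comp_one_sub_T n
  | 1 => by
    ext n
    exact Z.one_sub_T_comp_N n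
  | p + 2 => tsyganD_comp p

/-- The Tsygan double complex of a cyclic object. -/
def tsygan : HomologicalComplex₂ C (ComplexShape.down ℕ) (ComplexShape.down ℕ) :=
  ChainComplex.of Z.tsyganColumn Z.tsyganD Z.tsyganD_comp

/-- The total complex of the Tsygan double complex, with total differential
`horizontal + (-1)ᵖ vertical` on the `p`-th column; its homology is cyclic homology. -/
def cyclicComplex [Z.tsygan.HasTotal (ComplexShape.down ℕ)] : ChainComplex C ℕ :=
  Z.tsygan.total (ComplexShape.down ℕ)

end

end CyclicObject

noncomputable section

section TensorPower

/-- The tensor power `H ⊗ ⋯ ⊗ H` over `k` with `n` factors. -/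
abbrev TPow (k H : Type u) [CommRing k] [Ring H] [Algebra k H] (n : ℕ) : Type u :=
  PiTensorProduct k fun _ : Fin n ↦ H

variable {k H : Type u} [CommRing k] [Ring H] [HopfAlgebra k H]

/-- The pure tensor `(h⁰, …, hⁿ⁻¹) = h⁰ ⊗ ⋯ ⊗ hⁿ⁻¹`. -/
def ptensor {n : ℕ} : MultilinearMap k (fun _ : Fin n ↦ H) (TPow k H n) := PiTensorProduct.tprod k

theorem ptensor_ext {n : ℕ} {P : Type*} [AddCommMonoid P] [Module k P] {f g : TPow k H n →ₗ[k] P}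
    (h : ∀ x : Fin n → H, f (ptensor x) = g (ptensor x)) : f = g :=
  PiTensorProduct.ext (MultilinearMap.ext h)

theorem ptensor_mul_ptensor {n : ℕ} (x y : Fin n → H) : ptensor (k := k) x * ptensor y = ptensor (x * y) :=
  PiTensorProduct.tprod_mul_tprod x y

/-- The linear map on the tensor power defined by a multilinear map. -/
def tpowLift {n : ℕ} {P : Type*} [AddCommMonoid P] [Module k P]
    (f : MultilinearMap k (fun _ : Fin n ↦ H) P) : TPow k H n →ₗ[k] P := PiTensorProduct.lift f

@[simp] theorem tpowLift_ptensor {n : ℕ} {P : Type*} [AddCommMonoid P] [Module k P]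
    (f : MultilinearMap k (fun _ : Fin n ↦ H) P) (x : Fin n → H) : tpowLift f (ptensor x) = f x :=
  PiTensorProduct.lift.tprod x

/-- `a, (h⁰, …, hⁿ⁻¹) ↦ (a, h⁰, …, hⁿ⁻¹)` -/
def cons {n : ℕ} : H →ₗ[k] TPow k H n →ₗ[k] TPow k H (n + 1) where
  toFun a := tpowLift ((ptensor (k := k) (H := H)).curryLeft a)
  map_add' a b := ptensor_ext fun x ↦ by simp
  map_smul' c a := ptensor_ext fun x ↦ by simp

@[simp] theorem cons_ptensor {n : ℕ} (a : H) (h : Fin n → H) :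
    cons a (ptensor (k := k) h) = ptensor (Fin.cons a h : Fin (n + 1) → H) := by
  simp [cons]

/-- `(h⁰, …, hⁿ⁻¹), a ↦ (h⁰, …, hⁿ⁻¹, a)` -/
def snoc {n : ℕ} : H →ₗ[k] TPow k H n →ₗ[k] TPow k H (n + 1) where
  toFun a := tpowLift ((ptensor (k := k) (H := H)).curryMid (Fin.last n) a)
  map_add' a b := ptensor_ext fun x ↦ by simp
  map_smul' c a := ptensor_ext fun x ↦ by simp

@[simp] theorem snoc_ptensor {n : ℕ} (a : H) (h : Fin n → H) :
    snoc a (ptensor (k := k) h) = ptensor (Fin.snoc h a : Fin (n + 1) → H) := by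
  simp [snoc, Fin.insertNth_last']

/-- `(h⁰, …, hⁿ) ↦ ε(hⁱ) (h⁰, …, hⁱ⁻¹, hⁱ⁺¹, …, hⁿ)`. -/
def face {n : ℕ} (i : Fin (n + 1)) : TPow k H (n + 1) →ₗ[k] TPow k H n :=
  tpowLift (LinearMap.uncurryMid i
    ((Coalgebra.counit : H →ₗ[k] k).smulRight (ptensor (k := k) (H := H) (n := n))))

@[simp] theorem face_ptensor {n : ℕ} (i : Fin (n + 1)) (h : Fin (n + 1) → H) :
    face i (ptensor (k := k) h) = Coalgebra.counit (R := k) (h i) • ptensor (i.removeNth h) := by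
  simp [face]

/-- `a ⊗ b, (h⁰, …, hⁿ⁻¹) ↦ (h⁰, …, hⁱ⁻¹, a, b, hⁱ, …, hⁿ⁻¹)`. -/
def insertPair {n : ℕ} (i : Fin (n + 1)) :
    H ⊗[k] H →ₗ[k] MultilinearMap k (fun _ : Fin n ↦ H) (TPow k H (n + 2)) :=
  TensorProduct.lift
    ((MultilinearMap.curryMidLinearEquiv k (fun _ ↦ H) _ i).toLinearMap ∘ₗ
      (ptensor (k := k) (H := H) (n := n + 2)).curryMid i.castSucc)

@[simp] theorem insertPair_tmul {n : ℕ} (i : Fin (n + 1)) (a b : H) (h : Fin n → H) :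
    insertPair (k := k) i (a ⊗ₜ b) h =
      ptensor (i.castSucc.insertNth a (i.insertNth b h : Fin (n + 1) → H) : Fin (n + 2) → H) := by
  simp [insertPair]

/-- `(h⁰, …, hⁿ) ↦ (h⁰, …, Δ(hⁱ), …, hⁿ)`. -/
def degen {n : ℕ} (i : Fin (n + 1)) : TPow k H (n + 1) →ₗ[k] TPow k H (n + 2) :=
  tpowLift (LinearMap.uncurryMid i (insertPair i ∘ₗ Coalgebra.comul))

theorem degen_ptensor {n : ℕ} (i : Fin (n + 1)) (h : Fin (n + 1) → H) :
    degen i (ptensor (k := k) h) = insertPair i (Coalgebra.comul (R := k) (h i)) (i.removeNth h) := by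
  simp [degen]

/-- The rotation `(h⁰, …, hⁿ⁻¹) ↦ (hⁿ⁻¹, h⁰, …, hⁿ⁻²)`. -/
def rot (n : ℕ) : TPow k H n →ₗ[k] TPow k H n :=
  (PiTensorProduct.reindex k (fun _ ↦ H) (finRotate n)).toLinearMap

theorem rot_ptensor (n : ℕ) (h : Fin n → H) :
    rot n (ptensor (k := k) h) = ptensor fun i ↦ h ((finRotate n).symm i) := by
  simp [rot, ptensor]

/-- The iterated comultiplication `h ↦ h₍₁₎ ⊗ ⋯ ⊗ h₍ₙ₎`, which is the counit for `n = 0`. -/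
def iterComul : (n : ℕ) → H →ₗ[k] TPow k H n
  | 0 => (Coalgebra.counit : H →ₗ[k] k).smulRight 1
  | n + 1 => TensorProduct.lift (cons.compl₂ (iterComul n)) ∘ₗ Coalgebra.comul

/-! ### Computation rules for the operators on tensor powers -/

theorem removeNth_succ_cons {n : ℕ} (i : Fin (n + 1)) (a : H) (x : Fin (n + 1) → H) :
    i.succ.removeNth (Fin.cons a x : Fin (n + 2) → H) = Fin.cons a (i.removeNth x) := by
  ext j
  refine Fin.cases ?_ (fun j ↦ ?_) j <;> simp [Fin.removeNth]

theorem removeNth_castSucc_snoc {n : ℕ} (i : Fin (n + 1)) (a : H) (x : Fin (n + 1) → H) :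
    i.castSucc.removeNth (Fin.snoc x a : Fin (n + 2) → H) = Fin.snoc (i.removeNth x) a := by
  ext j
  refine Fin.lastCases ?_ (fun j ↦ ?_) j
  · simp [Fin.removeNth]
  · simp only [Fin.removeNth, Fin.castSucc_succAbove_castSucc, Fin.snoc_castSucc]

theorem insertNth_castSucc_snoc {n : ℕ} (i : Fin (n + 1)) (a b : H) (x : Fin n → H) :
    (i.castSucc.insertNth a (Fin.snoc x b : Fin (n + 1) → H) : Fin (n + 2) → H) =
      Fin.snoc (i.insertNth a x : Fin (n + 1) → H) b := by
  rw [Fin.insertNth_eq_iff, removeNth_castSucc_snoc]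
  simp



theorem cons_ext {n : ℕ} {P : Type*} [AddCommMonoid P] [Module k P]
    {f g : TPow k H (n + 1) →ₗ[k] P} (h : ∀ a x, f (cons a x) = g (cons a x)) : f = g :=
  ptensor_ext fun x ↦ by
    have := h (x 0) (ptensor (Fin.tail x))
    rwa [cons_ptensor, Fin.cons_self_tail] at this

theorem snoc_ext {n : ℕ} {P : Type*} [AddCommMonoid P] [Module k P]
    {f g : TPow k H (n + 1) →ₗ[k] P} (h : ∀ a x, f (snoc a x) = g (snoc a x)) : f = g :=
  ptensor_ext fun x ↦ by
    have := h (x (Fin.last n)) (ptensor (Fin.init x))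
    rwa [snoc_ptensor, Fin.snoc_init_self] at this

theorem cons_snoc {n : ℕ} (a b : H) (x : TPow k H n) : cons a (snoc b x) = snoc b (cons a x) := by
  revert x
  refine LinearMap.congr_fun (f := cons a ∘ₗ snoc b) (g := snoc b ∘ₗ cons a) (ptensor_ext fun x ↦ ?_)
  simp [Fin.cons_snoc_eq_snoc_cons]

theorem cons_mul_cons {n : ℕ} (a b : H) (x y : TPow k H n) :
    cons a x * cons b y = cons (a * b) (x * y) := by
  have h : (LinearMap.mul k (TPow k H (n + 1))).compl₁₂ (cons a) (cons b) =
      (LinearMap.mul k (TPow k H n)).compr₂ (cons (a * b)) := by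
    refine ptensor_ext fun x ↦ ptensor_ext fun y ↦ ?_
    simp only [LinearMap.compl₁₂_apply, LinearMap.compr₂_apply, LinearMap.mul_apply', cons_ptensor,
      ptensor_mul_ptensor]
    congr 1
    ext i
    refine Fin.cases ?_ (fun i ↦ ?_) i <;> simp
  exact LinearMap.congr_fun (LinearMap.congr_fun h x) y

theorem rot_snoc {n : ℕ} (a : H) (x : TPow k H n) : rot (n + 1) (snoc a x) = cons a x := by
  revert x
  refine LinearMap.congr_fun (f := rot (n + 1) ∘ₗ snoc a) (g := cons a) (ptensor_ext fun x ↦ ?_)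
  simp only [LinearMap.comp_apply, snoc_ptensor, rot_ptensor, cons_ptensor]
  congr 1
  ext i
  refine Fin.cases ?_ (fun i ↦ ?_) i
  · rw [(Equiv.symm_apply_eq _).2 finRotate_last.symm]; simp
  · rw [(Equiv.symm_apply_eq (y := i.castSucc) _).2 (by simp)]; simp

theorem rot_mul {n : ℕ} (x y : TPow k H n) : rot n (x * y) = rot n x * rot n y := by
  have h : (LinearMap.mul k (TPow k H n)).compr₂ (rot n) =
      (LinearMap.mul k (TPow k H n)).compl₁₂ (rot n) (rot n) := by
    refine ptensor_ext fun x ↦ ptensor_ext fun y ↦ ?_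
    simp only [LinearMap.compl₁₂_apply, LinearMap.compr₂_apply, LinearMap.mul_apply', rot_ptensor,
      ptensor_mul_ptensor]
    rfl
  exact LinearMap.congr_fun (LinearMap.congr_fun h x) y

theorem rot_iterate (n : ℕ) (x : TPow k H n) : (rot n)^[n] x = x := by
  have h (j : ℕ) (x : Fin n → H) : (rot n)^[j] (ptensor (k := k) x) =
      ptensor fun i ↦ x (((finRotate n).symm ^ j) i) := by
    induction j generalizing x with
    | zero => simp
    | succ j ih => 
      rw [Function.iterate_succ_apply, rot_ptensor, ih, pow_succ']
      rfl
  have h' : (rot n) ^ n = (LinearMap.id : TPow k H n →ₗ[k] _) := by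
    refine ptensor_ext fun x ↦ ?_
    rw [Module.End.pow_apply, h]
    have : (finRotate n).symm ^ n = 1 := by
      cases n with
      | zero => exact Subsingleton.elim _ _
      | succ n =>
        have h (j : ℕ) (i : Fin (n + 1)) : ((finRotate (n + 1)).symm ^ j) i = i - j • 1 := by
          induction j with
          | zero => simp
          | succ j ih =>
            rw [pow_succ', Equiv.Perm.mul_apply, ih, finRotate_symm_apply, succ_nsmul,
              sub_sub]
        ext1 i
        have h0 := card_nsmul_eq_zero (x := (1 : Fin (n + 1)))
        rw [Fintype.card_fin] at h0
        rw [h, h0]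
        simp
    simp [this]
  rw [← Module.End.pow_apply, h']
  rfl

theorem face_zero_cons {n : ℕ} (a : H) (x : TPow k H n) :
    face 0 (cons a x) = Coalgebra.counit (R := k) a • x := by
  revert x
  refine LinearMap.congr_fun (f := face (k := k) 0 ∘ₗ cons a) (g := Coalgebra.counit (R := k) a • (LinearMap.id : TPow k H n →ₗ[k] _))
    (ptensor_ext fun x ↦ ?_)
  simp 

theorem face_succ_cons {n : ℕ} (i : Fin (n + 1)) (a : H) (x : TPow k H (n + 1)) :
    face i.succ (cons a x) = cons a (face i x) := by
  revert x
  refine LinearMap.congr_fun (f := face i.succ ∘ₗ cons a) (g := cons a ∘ₗ face i)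
    (ptensor_ext fun x ↦ ?_)
  simp [removeNth_succ_cons]

theorem face_last_snoc {n : ℕ} (a : H) (x : TPow k H n) :
    face (Fin.last n) (snoc a x) = Coalgebra.counit (R := k) a • x := by
  revert x
  refine LinearMap.congr_fun (f := face (k := k) (Fin.last n) ∘ₗ snoc a)
    (g := Coalgebra.counit (R := k) a • (LinearMap.id : TPow k H n →ₗ[k] _)) (ptensor_ext fun x ↦ ?_)
  simp 

theorem face_castSucc_snoc {n : ℕ} (i : Fin (n + 1)) (a : H) (x : TPow k H (n + 1)) :
    face i.castSucc (snoc a x) = snoc a (face i x) := by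
  revert x
  refine LinearMap.congr_fun (f := face i.castSucc ∘ₗ snoc a) (g := snoc a ∘ₗ face i)
    (ptensor_ext fun x ↦ ?_)
  simp [removeNth_castSucc_snoc]

theorem face_mul {n : ℕ} (i : Fin (n + 1)) (x y : TPow k H (n + 1)) :
    face i (x * y) = face i x * face i y := by
  have h : (LinearMap.mul k (TPow k H (n + 1))).compr₂ (face i) =
      (LinearMap.mul k (TPow k H n)).compl₁₂ (face i) (face i) := by
    refine ptensor_ext fun x ↦ ptensor_ext fun y ↦ ?_
    simp only [LinearMap.compl₁₂_apply, LinearMap.compr₂_apply, LinearMap.mul_apply', face_ptensor,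
      ptensor_mul_ptensor, Pi.mul_apply, Bialgebra.counit_mul, smul_mul_smul_comm]
    rfl
  exact LinearMap.congr_fun (LinearMap.congr_fun h x) y

/-- `a ⊗ b, (h⁰, …, hⁿ⁻¹) ↦ (a, b, h⁰, …, hⁿ⁻¹)`. -/
def consPair {n : ℕ} : H ⊗[k] H →ₗ[k] TPow k H n →ₗ[k] TPow k H (n + 2) :=
  TensorProduct.lift ((LinearMap.llcomp k _ _ _).compl₁₂ cons cons)

@[simp] theorem consPair_tmul {n : ℕ} (a b : H) (x : TPow k H n) :
    consPair (a ⊗ₜ b) x = cons a (cons b x) := rfl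

/-- `a ⊗ b, (h⁰, …, hⁿ⁻¹) ↦ (h⁰, …, hⁿ⁻¹, a, b)`. -/
def snocPair {n : ℕ} : H ⊗[k] H →ₗ[k] TPow k H n →ₗ[k] TPow k H (n + 2) :=
  TensorProduct.lift ((LinearMap.llcomp k _ _ _).flip.compl₁₂ snoc snoc)

@[simp] theorem snocPair_tmul {n : ℕ} (a b : H) (x : TPow k H n) :
    snocPair (a ⊗ₜ b) x = snoc b (snoc a x) := rfl

theorem insertPair_zero {n : ℕ} (w : H ⊗[k] H) (x : Fin n → H) :
    insertPair 0 w x = consPair w (ptensor x) := by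
  induction w with
  | zero => simp
  | add u v hu hv => simp [hu, hv]
  | tmul a b => simp

theorem insertPair_succ {n : ℕ} (i : Fin (n + 1)) (w : H ⊗[k] H) (a : H) (x : Fin n → H) :
    insertPair i.succ w (Fin.cons a x : Fin (n + 1) → H) = cons a (insertPair i w x) := by
  induction w with
  | zero => simp
  | add u v hu hv => simp [hu, hv]
  | tmul b c => simp

theorem insertPair_last {n : ℕ} (w : H ⊗[k] H) (x : Fin n → H) :
    insertPair (Fin.last n) w x = snocPair w (ptensor x) := by
  induction w with
  | zero => simp
  | add u v hu hv => simp [hu, hv]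
  | tmul a b => simp [insertNth_castSucc_snoc]

theorem insertPair_castSucc {n : ℕ} (i : Fin (n + 1)) (w : H ⊗[k] H) (a : H) (x : Fin n → H) :
    insertPair i.castSucc w (Fin.snoc x a : Fin (n + 1) → H) = snoc a (insertPair i w x) := by
  induction w with
  | zero => simp
  | add u v hu hv => simp [hu, hv]
  | tmul b c => simp [insertNth_castSucc_snoc]

theorem degen_zero_cons {n : ℕ} (a : H) (x : TPow k H n) :
    degen 0 (cons a x) = consPair (Coalgebra.comul (R := k) a) x := by
  revert x
  refine LinearMap.congr_fun (f := degen 0 ∘ₗ cons a) (ptensor_ext fun x ↦ ?_)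
  simp [degen_ptensor, insertPair_zero]

theorem degen_succ_cons {n : ℕ} (i : Fin (n + 1)) (a : H) (x : TPow k H (n + 1)) :
    degen i.succ (cons a x) = cons a (degen i x) := by
  revert x
  refine LinearMap.congr_fun (f := degen i.succ ∘ₗ cons a) (g := cons a ∘ₗ degen i)
    (ptensor_ext fun x ↦ ?_)
  simp [degen_ptensor, removeNth_succ_cons, insertPair_succ]

theorem degen_last_snoc {n : ℕ} (a : H) (x : TPow k H n) :
    degen (Fin.last n) (snoc a x) = snocPair (Coalgebra.comul (R := k) a) x := by
  revert x
  refine LinearMap.congr_fun (f := degen (Fin.last n) ∘ₗ snoc a) (ptensor_ext fun x ↦ ?_)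
  simp [degen_ptensor, insertPair_last]

theorem degen_castSucc_snoc {n : ℕ} (i : Fin (n + 1)) (a : H) (x : TPow k H (n + 1)) :
    degen i.castSucc (snoc a x) = snoc a (degen i x) := by
  revert x
  refine LinearMap.congr_fun (f := degen i.castSucc ∘ₗ snoc a) (g := snoc a ∘ₗ degen i)
    (ptensor_ext fun x ↦ ?_)
  simp [degen_ptensor, removeNth_castSucc_snoc, insertPair_castSucc]

theorem consPair_mul {n : ℕ} (u v : H ⊗[k] H) (x y : TPow k H n) :
    consPair u x * consPair v y = consPair (u * v) (x * y) := by
  induction u with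
  | zero => simp
  | add u u' hu hu' => simp only [map_add, LinearMap.add_apply, add_mul, hu, hu']
  | tmul a b =>
    induction v with
    | zero => simp
    | add v v' hv hv' => simp only [map_add, LinearMap.add_apply, mul_add, hv, hv']
    | tmul c d => simp [cons_mul_cons]

theorem degen_mul {n : ℕ} (i : Fin (n + 1)) (x y : TPow k H (n + 1)) :
    degen i (x * y) = degen i x * degen i y := by
  have h : (LinearMap.mul k (TPow k H (n + 1))).compr₂ (degen i) =
      (LinearMap.mul k (TPow k H (n + 2))).compl₁₂ (degen i) (degen i) := by
    induction n with
    | zero =>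
      refine cons_ext fun a x ↦ cons_ext fun b y ↦ ?_
      obtain rfl : i = 0 := Fin.fin_one_eq_zero i
      simp [cons_mul_cons, degen_zero_cons, consPair_mul]
    | succ n ih =>
      refine cons_ext fun a x ↦ cons_ext fun b y ↦ ?_
      refine Fin.cases ?_ (fun i ↦ ?_) i
      · simp [cons_mul_cons, degen_zero_cons, consPair_mul]
      · have := LinearMap.congr_fun (LinearMap.congr_fun (ih i x y) x) y
        simp at this
        simp [cons_mul_cons, degen_succ_cons, this]
  exact LinearMap.congr_fun (LinearMap.congr_fun h x) y

/-- `a ⊗ b ↦ (a, b₍₁₎, …, b₍ₙ₎)`. -/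
def iterAux (n : ℕ) : H ⊗[k] H →ₗ[k] TPow k H (n + 1) :=
  TensorProduct.lift (cons.compl₂ (iterComul n))

@[simp] theorem iterAux_tmul (n : ℕ) (a b : H) :
    iterAux (k := k) n (a ⊗ₜ b) = cons a (iterComul n b) := rfl

theorem iterComul_zero (h : H) : iterComul (k := k) 0 h = Coalgebra.counit (R := k) h • 1 := rfl

theorem iterComul_succ (n : ℕ) (h : H) :
    iterComul (k := k) (n + 1) h = iterAux n (Coalgebra.comul h) := rfl

theorem cons_one_one (n : ℕ) : cons (k := k) (1 : H) (1 : TPow k H n) = 1 := by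
  rw [PiTensorProduct.one_def]
  change cons 1 (ptensor 1) = ptensor 1
  rw [cons_ptensor]
  congr 1
  ext i
  refine Fin.cases ?_ (fun i ↦ ?_) i <;> simp

theorem iterComul_one (n : ℕ) : iterComul (k := k) n (1 : H) = 1 := by
  induction n with
  | zero => simp [iterComul_zero]
  | succ n ih => simp [iterComul_succ, ih, cons_one_one, Algebra.TensorProduct.one_def]

theorem iterComul_mul (n : ℕ) (a b : H) :
    iterComul (k := k) n (a * b) = iterComul n a * iterComul n b := by
  induction n generalizing a b with
  | zero => simp [iterComul_zero, smul_smul, mul_comm]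
  | succ n ih =>
    have h (u v : H ⊗[k] H) : iterAux n (u * v) = iterAux n u * iterAux n v := by
      induction u with
      | zero => simp
      | add u u' hu hu' => simp only [map_add, add_mul, hu, hu']
      | tmul a b =>
        induction v with
        | zero => simp
        | add v v' hv hv' => simp only [map_add, mul_add, hv, hv']
        | tmul c d => simp [cons_mul_cons, ih]
    rw [iterComul_succ, Bialgebra.comul_mul, h]
    rfl

theorem face_iterComul {n : ℕ} (i : Fin (n + 1)) (h : H) :
    face i (iterComul (k := k) (n + 1) h) = iterComul n h := by
  have h0 (n : ℕ) (w : H ⊗[k] H) : face 0 (iterAux n w) =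
      iterComul n (TensorProduct.lid k H ((Coalgebra.counit (R := k)).rTensor H w)) := by
    induction w with
    | zero => simp
    | add u v hu hv => simp only [map_add, hu, hv]
    | tmul a b => simp [face_zero_cons]
  have h0' (n : ℕ) (h : H) : face 0 (iterComul (k := k) (n + 1) h) = iterComul n h := by
    rw [iterComul_succ, h0, Coalgebra.rTensor_counit_comul]
    simp
  induction n generalizing h with
  | zero =>
    obtain rfl : i = 0 := Fin.fin_one_eq_zero i
    exact h0' _ _
  | succ n ih =>
    refine Fin.cases (h0' _ _) (fun i ↦ ?_) i
    have (w : H ⊗[k] H) : face i.succ (iterAux (n + 1) w) = iterAux n w := by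
      induction w with
      | zero => simp
      | add u v hu hv => simp only [map_add, hu, hv]
      | tmul a b => simp [face_succ_cons, ih]
    exact this _

theorem degen_iterComul {n : ℕ} (i : Fin (n + 1)) (h : H) :
    degen i (iterComul (k := k) (n + 1) h) = iterComul (n + 2) h := by
  have h0' (n : ℕ) (h : H) : degen 0 (iterComul (k := k) (n + 1) h) = iterComul (n + 2) h := by
    let L : H ⊗[k] (H ⊗[k] H) →ₗ[k] TPow k H (n + 2) :=
      TensorProduct.lift (cons.compl₂ (iterAux n))
    have h1 (w : H ⊗[k] H) : degen 0 (iterAux n w) =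
        L (TensorProduct.assoc k H H H ((Coalgebra.comul (R := k)).rTensor H w)) := by
      induction w with
      | zero => simp
      | add u v hu hv => simp only [map_add, hu, hv]
      | tmul a b =>
        simp only [iterAux_tmul, degen_zero_cons, LinearMap.rTensor_tmul]
        induction (Coalgebra.comul (R := k) a) with
        | zero => simp
        | add u v hu hv => simp only [map_add, LinearMap.add_apply, TensorProduct.add_tmul, hu, hv]
        | tmul c d => simp [L]
    have h2 (w : H ⊗[k] H) : iterAux (n + 1) w =
        L ((Coalgebra.comul (R := k)).lTensor H w) := by
      induction w with
      | zero => simp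
      | add u v hu hv => simp only [map_add, hu, hv]
      | tmul a b => rfl
    rw [iterComul_succ, h1, Coalgebra.coassoc_apply, ← h2, iterComul_succ]
  induction n generalizing h with
  | zero =>
    obtain rfl : i = 0 := Fin.fin_one_eq_zero i
    exact h0' _ _
  | succ n ih =>
    refine Fin.cases (h0' _ _) (fun i ↦ ?_) i
    have (w : H ⊗[k] H) : degen i.succ (iterAux (n + 1) w) = iterAux (n + 2) w := by
      induction w with
      | zero => simp
      | add u v hu hv => simp only [map_add, hu, hv]
      | tmul a b => simp [degen_succ_cons, ih]
    exact this _

/-! ### Sweedler calculus -/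

theorem coassoc_sum {P : Type*} [AddCommGroup P] [Module k P] (F : H → H → H → P)
    (h1 : ∀ b c, IsLinearMap k fun a ↦ F a b c) (h2 : ∀ a c, IsLinearMap k fun b ↦ F a b c)
    (h3 : ∀ a b, IsLinearMap k fun c ↦ F a b c) {ι : Type*} {κ κ' : ι → Type*} {h : H}
    (r : Coalgebra.Repr k h ι)
    (r₁ : ∀ i, Coalgebra.Repr k (r.left i) (κ i)) (r₂ : ∀ i, Coalgebra.Repr k (r.right i) (κ' i)) :
    ∑ i ∈ r.index, ∑ j ∈ (r₁ i).index, F ((r₁ i).left j) ((r₁ i).right j) (r.right i) =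
      ∑ i ∈ r.index, ∑ j ∈ (r₂ i).index, F (r.left i) ((r₂ i).left j) ((r₂ i).right j) := by
  let G : H ⊗[k] (H ⊗[k] H) →ₗ[k] P := TensorProduct.lift
    { toFun := fun a ↦ TensorProduct.lift (LinearMap.mk₂ k (F a)
        (fun x y c ↦ (h2 a c).map_add x y) (fun t x c ↦ (h2 a c).map_smul t x)
        (fun b x y ↦ (h3 a b).map_add x y) (fun t b x ↦ (h3 a b).map_smul t x))
      map_add' := fun x y ↦ TensorProduct.ext' fun b c ↦ (h1 b c).map_add x y
      map_smul' := fun t x ↦ TensorProduct.ext' fun b c ↦ (h1 b c).map_smul t x }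
  simpa only [map_sum, G, TensorProduct.lift.tmul, LinearMap.coe_mk, AddHom.coe_mk, LinearMap.mk₂_apply] using congrArg G (Coalgebra.sum_tmul_tmul_eq r r₁ r₂)

theorem iterComul_succ_repr (n : ℕ) {h : H} {ι : Type u} (r : Coalgebra.Repr k h ι) :
    iterComul (k := k) (n + 1) h = ∑ i ∈ r.index, cons (r.left i) (iterComul n (r.right i)) := by
  rw [iterComul_succ, ← r.eq, map_sum]
  rfl

theorem iterComul_succ_repr' (n : ℕ) {h : H} {ι : Type u} (r : Coalgebra.Repr k h ι) :
    iterComul (k := k) (n + 1) h = ∑ i ∈ r.index, snoc (r.right i) (iterComul n (r.left i)) := by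
  induction n generalizing h ι with
  | zero =>
    have h1 (a : H) : cons a (1 : TPow k H 0) = snoc a 1 := by
      change cons a (ptensor 1) = snoc a (ptensor 1)
      rw [cons_ptensor, snoc_ptensor]
      congr 1
      ext i
      obtain rfl : i = 0 := Fin.fin_one_eq_zero i
      simp [Fin.snoc]
    have hl := Coalgebra.sum_counit_smul r
    have hr : ∑ i ∈ r.index, Coalgebra.counit (R := k) (r.right i) • r.left i = h := by
      have := congrArg (TensorProduct.rid k H) (Coalgebra.sum_tmul_counit_eq r)
      rw [map_sum] at this
      simpa only [TensorProduct.rid_tmul, one_smul] using this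
    rw [iterComul_succ_repr 0 r]
    trans snoc h 1
    · conv_rhs => rw [← hr]
      simp only [iterComul_zero, map_smul, map_sum, h1, LinearMap.sum_apply, LinearMap.smul_apply]
    · conv_lhs => rw [← hl]
      simp only [iterComul_zero, map_smul, map_sum, LinearMap.sum_apply, LinearMap.smul_apply]
  | succ n ih =>
    have := coassoc_sum (k := k) (fun a b c : H ↦ cons a (snoc c (iterComul (k := k) n b)))
      (fun b c ↦ ⟨by simp, by simp⟩) (fun b c ↦ ⟨by simp, by simp⟩) (fun b c ↦ ⟨by simp, by simp⟩)
      r (fun _ ↦ .arbitrary _ _) (fun _ ↦ .arbitrary _ _)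
    rw [iterComul_succ_repr _ r]
    have e (i : ι) := ih (.arbitrary k (r.right i))
    simp only [e, map_sum]
    rw [← this]
    simp only [cons_snoc]
    refine Finset.sum_congr rfl fun i _ ↦ ?_
    rw [iterComul_succ_repr _ (.arbitrary k (r.left i)), map_sum]

theorem rot_iterComul (n : ℕ) {h : H} {ι : Type u} (r : Coalgebra.Repr k h ι) :
    rot (n + 1) (iterComul (k := k) (n + 1) h) =
      ∑ i ∈ r.index, cons (r.right i) (iterComul n (r.left i)) := by
  simp [iterComul_succ_repr' n r, rot_snoc]

/-- The diagonal right action `(h⁰, …, hⁿ⁻¹) h = ∑ (h⁰ h₍₁₎, …, hⁿ⁻¹ h₍ₙ₎)` of `H`, as a module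
structure over the opposite algebra. -/
instance diagonalModule (n : ℕ) : Module Hᵐᵒᵖ (TPow k H n) where
  smul a x := x * iterComul n a.unop
  one_smul x := by
    change x * iterComul n 1 = x
    rw [iterComul_one, mul_one]
  mul_smul a b x := by
    change x * iterComul n (b.unop * a.unop) = x * iterComul n b.unop * iterComul n a.unop
    rw [iterComul_mul, mul_assoc]
  smul_zero a := zero_mul _
  smul_add a x y := add_mul _ _ _
  zero_smul x := by
    change x * iterComul n 0 = 0
    rw [map_zero, mul_zero]
  add_smul a b x := by
    change x * iterComul n (a.unop + b.unop) = _
    rw [map_add, mul_add]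
    rfl

theorem op_smul_eq {n : ℕ} (a : H) (x : TPow k H n) :
    MulOpposite.op a • x = x * iterComul n a := rfl

end TensorPower

section Balanced

variable (k A : Type u) [CommRing k] [Ring A]
  (X : Type u) [AddCommGroup X] [Module k X] [Module Aᵐᵒᵖ X]
  (N : Type u) [AddCommGroup N] [Module k N] [Module A N]

/-- The relations `x a ⊗ n = x ⊗ a n`. -/
def balancedRel : Submodule k (X ⊗[k] N) :=
  Submodule.span k {z | ∃ (x : X) (a : A) (n : N), z = (MulOpposite.op a • x) ⊗ₜ n - x ⊗ₜ (a • n)}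

/-- The tensor product `X ⊗_A N` of a right `A`-module `X` (a left module over the opposite ring)
and a left `A`-module `N`, as a quotient of `X ⊗_k N`. -/
abbrev BalancedTensor : Type u := (X ⊗[k] N) ⧸ balancedRel k A X N

variable {k A X N}

namespace BalancedTensor

variable (k A) in
/-- The class `x ⊗_A n`. -/
def tmul (x : X) (n : N) : BalancedTensor k A X N := Submodule.Quotient.mk (x ⊗ₜ n)

theorem tmul_smul (x : X) (a : A) (n : N) :
    tmul k A x (a • n) = tmul k A (MulOpposite.op a • x) n :=
  ((Submodule.Quotient.eq (balancedRel k A X N)).2 (Submodule.subset_span ⟨x, a, n, rfl⟩)).symm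

variable (k A) in
/-- `x ↦ n ↦ x ⊗_A n` as a bilinear map. -/
def mk : X →ₗ[k] N →ₗ[k] BalancedTensor k A X N :=
  (TensorProduct.mk k X N).compr₂ (balancedRel k A X N).mkQ

theorem mk_apply (x : X) (n : N) : mk k A x n = tmul k A x n := rfl

variable {P : Type u} [AddCommGroup P] [Module k P]

/-- The universal property for balanced bilinear maps. -/
def lift (f : X →ₗ[k] N →ₗ[k] P)
    (hf : ∀ (x : X) (a : A) (n : N), f (MulOpposite.op a • x) n = f x (a • n)) :
    BalancedTensor k A X N →ₗ[k] P :=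
  (balancedRel k A X N).liftQ (TensorProduct.lift f) <| by
    rw [balancedRel, Submodule.span_le]
    rintro _ ⟨x, a, n, rfl⟩
    simp [hf]

@[simp] theorem lift_tmul (f : X →ₗ[k] N →ₗ[k] P)
    (hf : ∀ (x : X) (a : A) (n : N), f (MulOpposite.op a • x) n = f x (a • n)) (x : X) (n : N) :
    lift f hf (tmul k A x n) = f x n := rfl

theorem ext {f g : BalancedTensor k A X N →ₗ[k] P}
    (h : ∀ x n, f (tmul k A x n) = g (tmul k A x n)) : f = g :=
  Submodule.linearMap_qext _ (TensorProduct.ext' h)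

variable {X' : Type u} [AddCommGroup X'] [Module k X'] [Module Aᵐᵒᵖ X']

/-- The map `f ⊗_A N` for a right `A`-linear `f`. -/
def map (f : X →ₗ[k] X') (hf : ∀ (a : A) (x : X), f (MulOpposite.op a • x) = MulOpposite.op a • f x) :
    BalancedTensor k A X N →ₗ[k] BalancedTensor k A X' N :=
  lift ((mk k A).comp f) fun x a n ↦ by
    simp only [LinearMap.comp_apply, mk_apply, hf, tmul_smul]

@[simp] theorem map_tmul (f : X →ₗ[k] X')
    (hf : ∀ (a : A) (x : X), f (MulOpposite.op a • x) = MulOpposite.op a • f x) (x : X) (n : N) :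
    map f hf (tmul k A x n) = tmul k A (f x) n := rfl

end BalancedTensor

end Balanced

section Crossed

variable (k H : Type u) [CommRing k] [Ring H] [HopfAlgebra k H]
  (M : Type u) [AddCommGroup M] [Module k M] [Module H M] [IsScalarTower k H M]

variable {H} in
/-- `m ⊗ x ↦ b m ⊗ c x S(a)`. -/
def crossedMap (a b c : H) : M ⊗[k] H →ₗ[k] M ⊗[k] H :=
  TensorProduct.map (Algebra.lsmul k k M b) (LinearMap.mulLeftRight k (c, HopfAlgebra.antipode k a))

theorem crossedMap_tmul (a b c : H) (m : M) (x : H) :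
    crossedMap k M a b c (m ⊗ₜ x) = (b • m) ⊗ₜ (c * x * HopfAlgebra.antipode k a) := by
  simp [crossedMap]

/-- `a ⊗ (b ⊗ c) ↦ (m ⊗ x ↦ b m ⊗ c x S(a))`, as a linear map. -/
def crossedTwist : H ⊗[k] (H ⊗[k] H) →ₗ[k] M ⊗[k] H →ₗ[k] M ⊗[k] H :=
  TensorProduct.lift
    { toFun := fun a ↦ TensorProduct.lift (LinearMap.mk₂ k (crossedMap k M a)
        (fun b b' c ↦ TensorProduct.ext' fun m x ↦ by
          simp [crossedMap_tmul, add_smul, TensorProduct.add_tmul])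
        (fun t b c ↦ TensorProduct.ext' fun m x ↦ by
          simp [crossedMap_tmul, TensorProduct.smul_tmul'])
        (fun b c c' ↦ TensorProduct.ext' fun m x ↦ by
          simp [crossedMap_tmul, add_mul, TensorProduct.tmul_add])
        (fun t b c ↦ TensorProduct.ext' fun m x ↦ by
          simp [crossedMap_tmul]))
      map_add' := fun a a' ↦ TensorProduct.ext' fun b c ↦ TensorProduct.ext' fun m x ↦ by
        simp [crossedMap_tmul, mul_add, TensorProduct.tmul_add]
      map_smul' := fun t a ↦ TensorProduct.ext' fun b c ↦ TensorProduct.ext' fun m x ↦ by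
        simp [crossedMap_tmul] }

@[simp] theorem crossedTwist_tmul (a b c : H) :
    crossedTwist k H M (a ⊗ₜ (b ⊗ₜ c)) = crossedMap k M a b c := by
  simp [crossedTwist]

/-- A modular crossed module structure on the left `H`-module `M`: a coassociative and counital
right coaction `ρ(m) = ∑ m₍₀₎ ⊗ m₍₁₎` such that `ρ(h m) = ∑ h₍₂₎ m₍₀₎ ⊗ h₍₃₎ m₍₁₎ S(h₍₁₎)` and
`∑ m₍₁₎ m₍₀₎ = m`. -/
structure ModularCrossedModule where
  coact : M →ₗ[k] M ⊗[k] H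
  coassoc : TensorProduct.assoc k M H H ∘ₗ coact.rTensor H ∘ₗ coact =
    (Coalgebra.comul (R := k) (A := H)).lTensor M ∘ₗ coact
  counit (m : M) : (Coalgebra.counit (R := k) (A := H)).lTensor M (coact m) = m ⊗ₜ[k] (1 : k)
  crossed (h : H) (m : M) : coact (h • m) =
    crossedTwist k H M ((Coalgebra.comul (R := k)).lTensor H (Coalgebra.comul (R := k) h)) (coact m)
  modular (m : M) : TensorProduct.lift (Algebra.lsmul k k M).toLinearMap.flip (coact m) = m

end Crossed

section CyclicObjectOfModule

variable {k H : Type u} [CommRing k] [Ring H] [HopfAlgebra k H]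

/-! ### Simplicial and cyclic identities on tensor powers -/

theorem face_zero_consPair {n : ℕ} (w : H ⊗[k] H) (x : TPow k H n) :
    face 0 (consPair w x) =
      cons (TensorProduct.lid k H ((Coalgebra.counit (R := k)).rTensor H w)) x := by
  induction w with
  | zero => simp
  | add u v hu hv => simp only [map_add, LinearMap.add_apply, hu, hv]
  | tmul a b => simp [face_zero_cons]

theorem face_one_consPair {n : ℕ} (w : H ⊗[k] H) (x : TPow k H n) :
    face (Fin.succ 0) (consPair w x) =
      cons (TensorProduct.rid k H ((Coalgebra.counit (R := k)).lTensor H w)) x := by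
  induction w with
  | zero => simp
  | add u v hu hv => simp only [map_add, LinearMap.add_apply, hu, hv]
  | tmul a b => rw [consPair_tmul, face_succ_cons, face_zero_cons]; simp

theorem face_succ_succ_consPair {n : ℕ} (i : Fin (n + 1)) (w : H ⊗[k] H) (x : TPow k H (n + 1)) :
    face i.succ.succ (consPair w x) = consPair w (face i x) := by
  induction w with
  | zero => simp
  | add u v hu hv => simp only [map_add, LinearMap.add_apply, hu, hv]
  | tmul a b => simp [face_succ_cons]

theorem degen_succ_succ_consPair {n : ℕ} (i : Fin (n + 1)) (w : H ⊗[k] H)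
    (x : TPow k H (n + 1)) :
    degen i.succ.succ (consPair w x) = consPair w (degen i x) := by
  induction w with
  | zero => simp
  | add u v hu hv => simp only [map_add, LinearMap.add_apply, hu, hv]
  | tmul a b => simp [degen_succ_cons]

theorem degen_one_consPair {n : ℕ} (a : H) (x : TPow k H n) :
    degen (Fin.succ 0) (consPair (Coalgebra.comul (R := k) a) x) =
      degen 0 (consPair (Coalgebra.comul (R := k) a) x) := by
  let L : H ⊗[k] (H ⊗[k] H) →ₗ[k] TPow k H (n + 3) :=
    TensorProduct.lift (cons.compl₂ (consPair.flip x))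
  have h1 (w : H ⊗[k] H) : degen 0 (consPair w x) =
      L (TensorProduct.assoc k H H H ((Coalgebra.comul (R := k)).rTensor H w)) := by
    induction w with
    | zero => simp
    | add u v hu hv => simp only [map_add, LinearMap.add_apply, hu, hv]
    | tmul a b =>
      simp only [consPair_tmul, degen_zero_cons, LinearMap.rTensor_tmul]
      induction (Coalgebra.comul (R := k) a) with
      | zero => simp
      | add u v hu hv => simp only [map_add, LinearMap.add_apply, TensorProduct.add_tmul, hu, hv]
      | tmul c d => simp [L]
  have h2 (w : H ⊗[k] H) : degen (Fin.succ 0) (consPair w x) =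
      L ((Coalgebra.comul (R := k)).lTensor H w) := by
    induction w with
    | zero => simp
    | add u v hu hv => simp only [map_add, LinearMap.add_apply, hu, hv]
    | tmul a b => rw [consPair_tmul, degen_succ_cons, degen_zero_cons]; rfl
  rw [h1, h2, Coalgebra.coassoc_apply]

theorem face_face {n : ℕ} {i j : Fin (n + 1)} (h : i ≤ j) :
    (face i ∘ₗ face j.succ : TPow k H (n + 2) →ₗ[k] _) = face j ∘ₗ face i.castSucc := by
  induction n with
  | zero =>
    obtain rfl := Fin.fin_one_eq_zero i
    obtain rfl := Fin.fin_one_eq_zero j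
    refine cons_ext fun a x ↦ ?_
    simp only [LinearMap.comp_apply]
    rw [face_succ_cons, Fin.castSucc_zero, face_zero_cons, face_zero_cons, map_smul]
  | succ n ih =>
    refine cons_ext fun a x ↦ ?_
    simp only [LinearMap.comp_apply]
    cases i using Fin.cases with
    | zero => rw [face_succ_cons, Fin.castSucc_zero, face_zero_cons, face_zero_cons, map_smul]
    | succ i =>
      cases j using Fin.cases with
      | zero => simp at h
      | succ j =>
        have := LinearMap.congr_fun (ih (Fin.succ_le_succ_iff.1 h)) x
        simp only [LinearMap.comp_apply] at this
        rw [← Fin.succ_castSucc, face_succ_cons, face_succ_cons, face_succ_cons, face_succ_cons,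
          this]

theorem face_degen_of_le {n : ℕ} {i : Fin (n + 2)} {j : Fin (n + 1)} (h : i ≤ j.castSucc) :
    (face i.castSucc ∘ₗ degen j.succ : TPow k H (n + 2) →ₗ[k] _) = degen j ∘ₗ face i := by
  induction n with
  | zero =>
    obtain rfl := Fin.fin_one_eq_zero j
    obtain rfl : i = 0 := by simpa using h
    refine cons_ext fun a x ↦ ?_
    simp only [LinearMap.comp_apply]
    rw [degen_succ_cons, Fin.castSucc_zero, face_zero_cons, face_zero_cons, map_smul]
  | succ n ih =>
    refine cons_ext fun a x ↦ ?_
    simp only [LinearMap.comp_apply]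
    cases i using Fin.cases with
    | zero => rw [degen_succ_cons, Fin.castSucc_zero, face_zero_cons, face_zero_cons, map_smul]
    | succ i =>
      cases j using Fin.cases with
      | zero => simp at h
      | succ j =>
        rw [← Fin.succ_castSucc] at h
        have := LinearMap.congr_fun (ih (Fin.succ_le_succ_iff.1 h)) x
        simp only [LinearMap.comp_apply] at this
        rw [← Fin.succ_castSucc, degen_succ_cons, face_succ_cons, face_succ_cons, degen_succ_cons,
          this]

theorem face_degen_self {n : ℕ} (i : Fin (n + 1)) :
    (face i.castSucc ∘ₗ degen i : TPow k H (n + 1) →ₗ[k] _) = LinearMap.id := by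
  have h0 {n : ℕ} (a : H) (x : TPow k H n) : face (Fin.castSucc 0) (degen 0 (cons a x)) =
      cons a x := by
    rw [degen_zero_cons, Fin.castSucc_zero, face_zero_consPair, Coalgebra.rTensor_counit_comul]
    simp
  induction n with
  | zero =>
    obtain rfl := Fin.fin_one_eq_zero i
    exact cons_ext fun a x ↦ h0 a x
  | succ n ih =>
    refine cons_ext fun a x ↦ ?_
    cases i using Fin.cases with
    | zero => exact h0 a x
    | succ i =>
      have := LinearMap.congr_fun (ih i) x
      simp only [LinearMap.comp_apply, LinearMap.id_apply] at this ⊢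
      rw [degen_succ_cons, ← Fin.succ_castSucc, face_succ_cons, this]

theorem face_degen_succ {n : ℕ} (i : Fin (n + 1)) :
    (face i.succ ∘ₗ degen i : TPow k H (n + 1) →ₗ[k] _) = LinearMap.id := by
  have h0 {n : ℕ} (a : H) (x : TPow k H n) : face (Fin.succ 0) (degen 0 (cons a x)) =
      cons a x := by
    rw [degen_zero_cons, face_one_consPair, Coalgebra.lTensor_counit_comul]
    simp
  induction n with
  | zero =>
    obtain rfl := Fin.fin_one_eq_zero i
    exact cons_ext fun a x ↦ h0 a x
  | succ n ih =>
    refine cons_ext fun a x ↦ ?_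
    cases i using Fin.cases with
    | zero => exact h0 a x
    | succ i =>
      have := LinearMap.congr_fun (ih i) x
      simp only [LinearMap.comp_apply, LinearMap.id_apply] at this ⊢
      rw [degen_succ_cons, face_succ_cons, this]

theorem face_degen_of_gt {n : ℕ} {i : Fin (n + 2)} {j : Fin (n + 1)} (h : j.castSucc < i) :
    (face i.succ ∘ₗ degen j.castSucc : TPow k H (n + 2) →ₗ[k] _) = degen j ∘ₗ face i := by
  have h0 {n : ℕ} (i : Fin (n + 1)) (a : H) (x : TPow k H (n + 1)) :
      face i.succ.succ (degen (Fin.castSucc 0) (cons a x)) = degen 0 (face i.succ (cons a x)) := by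
    rw [Fin.castSucc_zero, degen_zero_cons, face_succ_succ_consPair, face_succ_cons,
      degen_zero_cons]
  cases i using Fin.cases with
  | zero => simp at h
  | succ i =>
  induction n with
  | zero =>
    obtain rfl := Fin.fin_one_eq_zero j
    exact cons_ext fun a x ↦ h0 i a x
  | succ n ih =>
    refine cons_ext fun a x ↦ ?_
    cases j using Fin.cases with
    | zero => exact h0 i a x
    | succ j =>
      simp only [LinearMap.comp_apply]
      rw [← Fin.succ_castSucc, Fin.succ_lt_succ_iff] at h
      cases i using Fin.cases with
      | zero => simp at h
      | succ i =>
        have := LinearMap.congr_fun (ih i h) x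
        simp only [LinearMap.comp_apply] at this
        rw [← Fin.succ_castSucc, degen_succ_cons, face_succ_cons, face_succ_cons, degen_succ_cons,
          this]

theorem degen_degen {n : ℕ} {i j : Fin (n + 1)} (h : i ≤ j) :
    (degen j.succ ∘ₗ degen i : TPow k H (n + 1) →ₗ[k] _) = degen i.castSucc ∘ₗ degen j := by
  have h0 {n : ℕ} (a : H) (x : TPow k H n) : degen (Fin.succ 0) (degen 0 (cons a x)) =
      degen (Fin.castSucc 0) (degen 0 (cons a x)) := by
    rw [degen_zero_cons, Fin.castSucc_zero, degen_one_consPair]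
  induction n with
  | zero =>
    obtain rfl := Fin.fin_one_eq_zero i
    obtain rfl := Fin.fin_one_eq_zero j
    exact cons_ext fun a x ↦ h0 a x
  | succ n ih =>
    refine cons_ext fun a x ↦ ?_
    cases i using Fin.cases with
    | zero =>
      cases j using Fin.cases with
      | zero => exact h0 a x
      | succ j =>
        simp only [LinearMap.comp_apply]
        rw [degen_zero_cons, degen_succ_succ_consPair, Fin.castSucc_zero, degen_succ_cons,
          degen_zero_cons]
    | succ i =>
      cases j using Fin.cases with
      | zero => simp at h
      | succ j =>
        have := LinearMap.congr_fun (ih (Fin.succ_le_succ_iff.1 h)) x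
        simp only [LinearMap.comp_apply] at this ⊢
        rw [degen_succ_cons, degen_succ_cons, degen_succ_cons, ← Fin.succ_castSucc,
          degen_succ_cons, this]

theorem face_zero_rot {n : ℕ} (x : TPow k H (n + 1)) :
    face 0 (rot (n + 1) x) = face (Fin.last n) x := by
  revert x
  refine LinearMap.congr_fun (f := face 0 ∘ₗ rot (n + 1)) (snoc_ext fun a x ↦ ?_)
  simp [rot_snoc, face_zero_cons, face_last_snoc]

theorem face_succ_rot {n : ℕ} (i : Fin (n + 1)) (x : TPow k H (n + 2)) :
    face i.succ (rot (n + 2) x) = rot (n + 1) (face i.castSucc x) := by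
  revert x
  refine LinearMap.congr_fun (f := face i.succ ∘ₗ rot (n + 2))
    (g := rot (n + 1) ∘ₗ face i.castSucc) (snoc_ext fun a x ↦ ?_)
  simp only [LinearMap.comp_apply, rot_snoc, face_succ_cons, face_castSucc_snoc]

theorem degen_zero_rot {n : ℕ} (x : TPow k H (n + 1)) :
    degen 0 (rot (n + 1) x) = rot (n + 2) (rot (n + 2) (degen (Fin.last n) x)) := by
  revert x
  refine LinearMap.congr_fun (f := degen 0 ∘ₗ rot (n + 1))
    (g := rot (n + 2) ∘ₗ rot (n + 2) ∘ₗ degen (Fin.last n)) (snoc_ext fun a x ↦ ?_)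
  simp only [LinearMap.comp_apply, rot_snoc, degen_zero_cons, degen_last_snoc]
  induction (Coalgebra.comul (R := k) a) with
  | zero => simp
  | add u v hu hv => simp only [map_add, LinearMap.add_apply, hu, hv]
  | tmul a b => simp [rot_snoc, cons_snoc]

theorem degen_succ_rot {n : ℕ} (i : Fin n) (x : TPow k H (n + 1)) :
    degen i.succ (rot (n + 1) x) = rot (n + 2) (degen i.castSucc x) := by
  cases n with
  | zero => exact i.elim0
  | succ n =>
  revert x
  refine LinearMap.congr_fun (f := degen i.succ ∘ₗ rot (n + 2))
    (g := rot (n + 3) ∘ₗ degen i.castSucc) (snoc_ext fun a x ↦ ?_)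
  simp only [LinearMap.comp_apply, rot_snoc, degen_succ_cons, degen_castSucc_snoc]

theorem face_one {n : ℕ} (i : Fin (n + 1)) : face i (1 : TPow k H (n + 1)) = 1 := by
  rw [← iterComul_one, face_iterComul, iterComul_one]

theorem degen_one {n : ℕ} (i : Fin (n + 1)) : degen i (1 : TPow k H (n + 1)) = 1 := by
  rw [← iterComul_one, degen_iterComul, iterComul_one]

theorem snoc_one_one (n : ℕ) : snoc (k := k) (1 : H) (1 : TPow k H n) = 1 := by
  rw [PiTensorProduct.one_def]
  change snoc 1 (ptensor 1) = ptensor 1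
  rw [snoc_ptensor]
  congr 1
  ext i
  refine Fin.lastCases ?_ (fun i ↦ ?_) i <;> simp

theorem rot_cons_one {n : ℕ} (y : H) :
    rot (n + 2) (cons y (1 : TPow k H (n + 1))) = cons 1 (cons y 1) := by
  rw [← snoc_one_one, cons_snoc, rot_snoc]

theorem twist_identity (n : ℕ) (y h : H) {ι : Type u} {κ : ι → Type u}
    (r : Coalgebra.Repr k h ι) (s : ∀ i, Coalgebra.Repr k (r.right i) (κ i)) :
    ∑ i ∈ r.index, ∑ j ∈ (s i).index,
      cons ((s i).right j * y * HopfAlgebra.antipode k (r.left i)) 1 *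
        iterComul (k := k) (n + 1) ((s i).left j) =
    rot (n + 1) (iterComul (n + 1) h) * cons y 1 := by
  let W (z : H) : H ⊗[k] H →ₗ[k] TPow k H (n + 1) :=
    TensorProduct.lift (LinearMap.mk₂ k (fun b c ↦ cons (c * z) (iterComul n b))
      (by simp) (by simp) (by simp [add_mul]) (by simp))
  have W_tmul (z b c : H) : W z (b ⊗ₜ c) = cons (c * z) (iterComul n b) := rfl
  have W_add (z z' : H) (w : H ⊗[k] H) : W (z + z') w = W z w + W z' w := by
    induction w with
    | zero => simp
    | add u v hu hv => simp only [map_add, hu, hv]; abel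
    | tmul a b => simp [W_tmul, mul_add]
  have W_smul (t : k) (z : H) (w : H ⊗[k] H) : W (t • z) w = t • W z w := by
    induction w with
    | zero => simp
    | add u v hu hv => simp only [map_add, hu, hv, smul_add]
    | tmul a b => simp [W_tmul]
  have W_sum {ι : Type u} (S : Finset ι) (z : ι → H) (w : H ⊗[k] H) :
      W (∑ i ∈ S, z i) w = ∑ i ∈ S, W (z i) w :=
    map_sum (AddMonoidHom.mk' (fun z ↦ W z w) fun a b ↦ W_add a b w) _ _
  let r₁ (i : ι) := Coalgebra.Repr.arbitrary k (r.left i)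
  have step1 (i : ι) : ∑ j ∈ (s i).index,
      cons ((s i).right j * y * HopfAlgebra.antipode k (r.left i)) 1 *
        iterComul (k := k) (n + 1) ((s i).left j) =
      ∑ j ∈ (s i).index, W (y * HopfAlgebra.antipode k (r.left i) * (s i).left j)
        (Coalgebra.comul ((s i).right j)) := by
    have := coassoc_sum (k := k)
      (fun a b c : H ↦ cons (c * (y * HopfAlgebra.antipode k (r.left i) * a))
        (iterComul (k := k) n b))
      (fun b c ↦ ⟨by simp [mul_add], by simp⟩) (fun b c ↦ ⟨by simp, by simp⟩)
      (fun b c ↦ ⟨by simp [add_mul], by simp⟩)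
      (s i) (fun _ ↦ .arbitrary _ _) (fun _ ↦ .arbitrary _ _)
    refine (Finset.sum_congr rfl fun j _ ↦ ?_).trans (this.trans (Finset.sum_congr rfl fun j _ ↦ ?_))
    · rw [iterComul_succ_repr n (.arbitrary k ((s i).left j)), Finset.mul_sum]
      simp only [cons_mul_cons, one_mul, mul_assoc]
    · conv_rhs => rw [← (Coalgebra.Repr.arbitrary k ((s i).right j)).eq, map_sum]
      simp only [W_tmul, mul_assoc]
  have step2 := coassoc_sum (k := k)
    (fun a b c : H ↦ W (y * HopfAlgebra.antipode k a * b) (Coalgebra.comul c))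
    (fun b c ↦ ⟨by simp [mul_add, add_mul, W_add], by simp [W_smul]⟩)
    (fun b c ↦ ⟨by simp [mul_add, W_add], by simp [W_smul]⟩)
    (fun b c ↦ ⟨by simp, by simp⟩) r r₁ s
  calc _ = _ := Finset.sum_congr rfl fun i _ ↦ step1 i
    _ = _ := step2.symm
    _ = ∑ i ∈ r.index, Coalgebra.counit (R := k) (r.left i) •
          W y (Coalgebra.comul (r.right i)) := Finset.sum_congr rfl fun i _ ↦ by
        rw [← W_sum]
        simp only [mul_assoc]
        rw [← Finset.mul_sum, HopfAlgebra.sum_antipode_mul_eq_smul, mul_smul_comm, mul_one, W_smul]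
    _ = W y (Coalgebra.comul h) := by
        conv_rhs => rw [← Coalgebra.sum_counit_smul r]
        simp only [map_sum, map_smul]
    _ = _ := by
        rw [rot_iterComul n r, ← r.eq, map_sum, Finset.sum_mul]
        simp only [W_tmul, cons_mul_cons, mul_one]


variable {M : Type u} [AddCommGroup M] [Module k M] [Module H M]

/-- `m ⊗ v ↦ z f(v) ⊗_H m`. -/
def act {n : ℕ} {V : Type u} [AddCommGroup V] [Module k V] (z : TPow k H n)
    (f : V →ₗ[k] TPow k H n) : M ⊗[k] V →ₗ[k] BalancedTensor k H (TPow k H n) M :=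
  TensorProduct.lift ((BalancedTensor.mk k H).flip.compl₂ (LinearMap.mulLeft k z ∘ₗ f))

@[simp] theorem act_tmul {n : ℕ} {V : Type u} [AddCommGroup V] [Module k V] (z : TPow k H n)
    (f : V →ₗ[k] TPow k H n) (m : M) (v : V) :
    act z f (m ⊗ₜ v) = BalancedTensor.tmul k H (z * f v) m := rfl

/-- `(h⁰, …, hⁿ), m ⊗ y ↦ (hⁿ y, h⁰, …, hⁿ⁻¹) ⊗_H m`. -/
def theta (n : ℕ) : TPow k H (n + 1) →ₗ[k] M ⊗[k] H →ₗ[k]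
    BalancedTensor k H (TPow k H (n + 1)) M :=
  { toFun := fun x ↦ act (rot (n + 1) x) (cons.flip 1)
    map_add' := fun x x' ↦ TensorProduct.ext' fun m y ↦ by
      simp [add_mul, ← BalancedTensor.mk_apply]
    map_smul' := fun t x ↦ TensorProduct.ext' fun m y ↦ by simp [← BalancedTensor.mk_apply] }

@[simp] theorem theta_tmul (n : ℕ) (x : TPow k H (n + 1)) (m : M) (y : H) :
    theta n x (m ⊗ₜ y) = BalancedTensor.tmul k H (rot (n + 1) x * cons y 1) m := rfl

theorem theta_op_smul [IsScalarTower k H M] (n : ℕ) (x : TPow k H (n + 1)) (h : H)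
    (w : M ⊗[k] H) : theta n (MulOpposite.op h • x) w =
      theta n x (crossedTwist k H M
        ((Coalgebra.comul (R := k)).lTensor H (Coalgebra.comul (R := k) h)) w) := by
  induction w with
  | zero => simp
  | add u v hu hv => simp only [map_add, hu, hv]
  | tmul m y =>
    let r := Coalgebra.Repr.arbitrary k h
    let s (i) := Coalgebra.Repr.arbitrary k (r.right i)
    have e : (Coalgebra.comul (R := k)).lTensor H (Coalgebra.comul (R := k) h) =
        ∑ i ∈ r.index, ∑ j ∈ (s i).index, r.left i ⊗ₜ ((s i).left j ⊗ₜ (s i).right j) := by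
      conv_lhs => rw [← r.eq]
      simp only [map_sum, LinearMap.lTensor_tmul]
      refine Finset.sum_congr rfl fun i _ ↦ ?_
      rw [← (s i).eq, TensorProduct.tmul_sum]
    rw [e]
    simp only [map_sum, LinearMap.sum_apply, crossedTwist_tmul, crossedMap_tmul, theta_tmul,
      BalancedTensor.tmul_smul, op_smul_eq, rot_mul]
    rw [mul_assoc, ← twist_identity n y h r s]
    simp only [← BalancedTensor.mk_apply, mul_assoc, ← LinearMap.sum_apply, ← map_sum,
      ← Finset.mul_sum]

variable [IsScalarTower k H M]

namespace ModularCrossedModule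

variable (S : ModularCrossedModule k H M)

/-- The cyclic operator `(h⁰, …, hⁿ) ⊗_H m ↦ ∑ (hⁿ m₍₁₎, h⁰, …, hⁿ⁻¹) ⊗_H m₍₀₎`. -/
def cyc (n : ℕ) : BalancedTensor k H (TPow k H (n + 1)) M →ₗ[k]
    BalancedTensor k H (TPow k H (n + 1)) M :=
  BalancedTensor.lift ((theta n).compl₂ S.coact) fun x a m ↦ by
    simp only [LinearMap.compl₂_apply, S.crossed, theta_op_smul]

theorem cyc_tmul (n : ℕ) (x : TPow k H (n + 1)) (m : M) :
    S.cyc n (BalancedTensor.tmul k H x m) = theta n x (S.coact m) := rfl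

variable (k H M) in
/-- The face maps `δᵢ` of `H^{⊗(n+1)} ⊗_H M`. -/
def faceMap {n : ℕ} (i : Fin (n + 2)) : BalancedTensor k H (TPow k H (n + 2)) M →ₗ[k]
    BalancedTensor k H (TPow k H (n + 1)) M :=
  BalancedTensor.map (face i) fun a x ↦ by
    rw [op_smul_eq, op_smul_eq, face_mul, face_iterComul]

variable (k H M) in
/-- The degeneracy maps `σᵢ` of `H^{⊗(n+1)} ⊗_H M`. -/
def degenMap {n : ℕ} (i : Fin (n + 1)) : BalancedTensor k H (TPow k H (n + 1)) M →ₗ[k]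
    BalancedTensor k H (TPow k H (n + 2)) M :=
  BalancedTensor.map (degen i) fun a x ↦ by
    rw [op_smul_eq, op_smul_eq, degen_mul, degen_iterComul]

@[simp] theorem faceMap_tmul {n : ℕ} (i : Fin (n + 2)) (x : TPow k H (n + 2)) (m : M) :
    faceMap k H M i (BalancedTensor.tmul k H x m) = BalancedTensor.tmul k H (face i x) m := rfl

@[simp] theorem degenMap_tmul {n : ℕ} (i : Fin (n + 1)) (x : TPow k H (n + 1)) (m : M) :
    degenMap k H M i (BalancedTensor.tmul k H x m) = BalancedTensor.tmul k H (degen i x) m := rfl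

theorem faceMap_zero_cyc {n : ℕ} (z : BalancedTensor k H (TPow k H (n + 2)) M) :
    faceMap k H M 0 (S.cyc (n + 1) z) = faceMap k H M (Fin.last (n + 1)) z := by
  revert z
  refine LinearMap.congr_fun (f := faceMap k H M 0 ∘ₗ S.cyc (n + 1)) (BalancedTensor.ext fun x m ↦ ?_)
  have h (w : M ⊗[k] H) : faceMap k H M 0 (theta (n + 1) x w) =
      BalancedTensor.mk k H (face (Fin.last (n + 1)) x)
        (TensorProduct.rid k M ((Coalgebra.counit (R := k)).lTensor M w)) := by
    induction w with
    | zero => simp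
    | add u v hu hv => simp only [map_add, hu, hv]
    | tmul m y =>
      rw [theta_tmul, faceMap_tmul, face_mul, face_zero_rot, face_zero_cons]
      simp [← BalancedTensor.mk_apply]
  rw [LinearMap.comp_apply, cyc_tmul, h, S.counit, faceMap_tmul, ← BalancedTensor.mk_apply]
  simp

theorem faceMap_succ_cyc {n : ℕ} (i : Fin (n + 1)) (z : BalancedTensor k H (TPow k H (n + 2)) M) :
    faceMap k H M i.succ (S.cyc (n + 1) z) = S.cyc n (faceMap k H M i.castSucc z) := by
  revert z
  refine LinearMap.congr_fun (f := faceMap k H M i.succ ∘ₗ S.cyc (n + 1))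
    (g := S.cyc n ∘ₗ faceMap k H M i.castSucc) (BalancedTensor.ext fun x m ↦ ?_)
  have h (w : M ⊗[k] H) : faceMap k H M i.succ (theta (n + 1) x w) = theta n (face i.castSucc x) w := by
    induction w with
    | zero => simp
    | add u v hu hv => simp only [map_add, hu, hv]
    | tmul m y =>
      rw [theta_tmul, faceMap_tmul, face_mul, face_succ_rot, face_succ_cons, face_one, theta_tmul]
  exact h _

theorem degenMap_succ_cyc {n : ℕ} (i : Fin n) (z : BalancedTensor k H (TPow k H (n + 1)) M) :
    degenMap k H M i.succ (S.cyc n z) = S.cyc (n + 1) (degenMap k H M i.castSucc z) := by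
  revert z
  refine LinearMap.congr_fun (f := degenMap k H M i.succ ∘ₗ S.cyc n)
    (g := S.cyc (n + 1) ∘ₗ degenMap k H M i.castSucc) (BalancedTensor.ext fun x m ↦ ?_)
  have h (w : M ⊗[k] H) : degenMap k H M i.succ (theta n x w) =
      theta (n + 1) (degen i.castSucc x) w := by
    induction w with
    | zero => simp
    | add u v hu hv => simp only [map_add, hu, hv]
    | tmul m y =>
      cases n with
      | zero => exact i.elim0
      | succ n =>
      rw [theta_tmul, degenMap_tmul, degen_mul, degen_succ_rot, degen_succ_cons, degen_one,
        theta_tmul]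
  exact h _

theorem degenMap_zero_cyc {n : ℕ} (z : BalancedTensor k H (TPow k H (n + 1)) M) :
    degenMap k H M 0 (S.cyc n z) = S.cyc (n + 1) (S.cyc (n + 1) (degenMap k H M (Fin.last n) z)) := by
  revert z
  refine LinearMap.congr_fun (f := degenMap k H M 0 ∘ₗ S.cyc n)
    (g := S.cyc (n + 1) ∘ₗ S.cyc (n + 1) ∘ₗ degenMap k H M (Fin.last n))
    (BalancedTensor.ext fun x m ↦ ?_)
  let L : M ⊗[k] (H ⊗[k] H) →ₗ[k] BalancedTensor k H (TPow k H (n + 2)) M :=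
    act (rot (n + 2) (rot (n + 2) (degen (Fin.last n) x))) (consPair.flip 1)
  have h1 (w : M ⊗[k] H) : degenMap k H M 0 (theta n x w) =
      L ((Coalgebra.comul (R := k)).lTensor M w) := by
    induction w with
    | zero => simp
    | add u v hu hv => simp only [map_add, hu, hv]
    | tmul m y => rw [theta_tmul, degenMap_tmul, degen_mul, degen_zero_rot, degen_zero_cons]; rfl
  have h2 (w : M ⊗[k] H) : S.cyc (n + 1) (theta (n + 1) (degen (Fin.last n) x) w) =
      L (TensorProduct.assoc k M H H (S.coact.rTensor H w)) := by
    induction w with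
    | zero => simp
    | add u v hu hv => simp only [map_add, hu, hv]
    | tmul m y =>
      rw [theta_tmul, cyc_tmul, LinearMap.rTensor_tmul]
      induction S.coact m with
      | zero => simp
      | add u v hu hv => simp only [map_add, TensorProduct.add_tmul, hu, hv]
      | tmul m' y' =>
        rw [theta_tmul, rot_mul, rot_cons_one, mul_assoc, cons_mul_cons, one_mul, mul_one]
        rfl
  have h3 := LinearMap.congr_fun S.coassoc m
  simp only [LinearMap.comp_apply, LinearEquiv.coe_coe] at h3
  simp only [LinearMap.comp_apply, cyc_tmul, degenMap_tmul]
  rw [h1, h2, h3]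

/-- `y ↦ (y₍₁₎, …, y₍ⱼ₎, 1, …, 1)` for `j ≤ n`. -/
def padComul : (n j : ℕ) → H →ₗ[k] TPow k H n
  | _, 0 => (Coalgebra.counit : H →ₗ[k] k).smulRight 1
  | 0, _ + 1 => 0
  | n + 1, j + 1 => TensorProduct.lift (cons.compl₂ (padComul n j)) ∘ₗ Coalgebra.comul

theorem padComul_zero (n : ℕ) (y : H) :
    padComul (k := k) n 0 y = Coalgebra.counit (R := k) y • 1 := by
  cases n <;> rfl

theorem padComul_succ (n j : ℕ) (y : H) : padComul (k := k) (n + 1) (j + 1) y =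
    TensorProduct.lift (cons.compl₂ (padComul n j)) (Coalgebra.comul (R := k) y) := rfl

theorem padComul_self (n : ℕ) (y : H) : padComul (k := k) n n y = iterComul n y := by
  induction n generalizing y with
  | zero => rfl
  | succ n ih => rw [padComul_succ, LinearMap.ext ih]; rfl

theorem snoc_padComul {n j : ℕ} (hj : j ≤ n) (y : H) :
    snoc 1 (padComul (k := k) n j y) = padComul (n + 1) j y := by
  induction j generalizing n y with
  | zero => rw [padComul_zero, padComul_zero, map_smul, snoc_one_one]
  | succ j ih =>
    obtain ⟨n, rfl⟩ : ∃ m, n = m + 1 := ⟨n - 1, by omega⟩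
    rw [padComul_succ, padComul_succ]
    induction Coalgebra.comul (R := k) y with
    | zero => simp
    | add u v hu hv => simp only [map_add, hu, hv]
    | tmul a b => simp [← cons_snoc, ih (show j ≤ n by omega)]

theorem cyc_iterate_tmul (n j : ℕ) (hj : j ≤ n + 1) (x : TPow k H (n + 1)) (m : M) :
    (S.cyc n)^[j] (BalancedTensor.tmul k H x m) =
      act ((rot (n + 1))^[j] x) (padComul (n + 1) j) (S.coact m) := by
  induction j with
  | zero =>
    have h (w : M ⊗[k] H) : act x (padComul (n + 1) 0) w = BalancedTensor.mk k H x
        (TensorProduct.rid k M ((Coalgebra.counit (R := k)).lTensor M w)) := by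
      induction w with
      | zero => simp
      | add u v hu hv => simp only [map_add, hu, hv]
      | tmul m y => simp [padComul_zero, ← BalancedTensor.mk_apply]
    simp only [Function.iterate_zero, id_eq]
    rw [h, S.counit, TensorProduct.rid_tmul, one_smul]
    rfl
  | succ j ih =>
    let f : H ⊗[k] H →ₗ[k] TPow k H (n + 1) := TensorProduct.lift (cons.compl₂ (padComul n j))
    have h1 (w : M ⊗[k] H) : S.cyc n (act ((rot (n + 1))^[j] x) (padComul (n + 1) j) w) =
        act ((rot (n + 1))^[j + 1] x) f
          (TensorProduct.assoc k M H H (S.coact.rTensor H w)) := by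
      induction w with
      | zero => simp only [map_zero]
      | add u v hu hv => simp only [map_add, hu, hv]
      | tmul m y =>
        rw [act_tmul, cyc_tmul, LinearMap.rTensor_tmul]
        induction S.coact m with
        | zero => simp only [map_zero, TensorProduct.zero_tmul]
        | add u v hu hv => simp only [map_add, TensorProduct.add_tmul, hu, hv]
        | tmul m' y' =>
          rw [theta_tmul, rot_mul, ← snoc_padComul (show j ≤ n by omega), rot_snoc, mul_assoc,
            cons_mul_cons, one_mul, mul_one, ← Function.iterate_succ_apply' (rot (n + 1)) j x,
            TensorProduct.assoc_tmul, act_tmul, TensorProduct.lift.tmul, LinearMap.compl₂_apply]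
    have h2 (w : M ⊗[k] H) :
        act ((rot (n + 1))^[j + 1] x) f ((Coalgebra.comul (R := k)).lTensor M w) =
          act ((rot (n + 1))^[j + 1] x) (padComul (n + 1) (j + 1)) w := by
      induction w with
      | zero => simp only [map_zero]
      | add u v hu hv => simp only [map_add, hu, hv]
      | tmul m y => rw [LinearMap.lTensor_tmul, act_tmul, act_tmul, padComul_succ]
    have h3 := LinearMap.congr_fun S.coassoc m
    simp only [LinearMap.comp_apply, LinearEquiv.coe_coe] at h3
    rw [Function.iterate_succ_apply', ih (by omega), h1, h3, h2]

theorem cyc_iterate (n : ℕ) : (S.cyc n) ^ (n + 1) = LinearMap.id := by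
  refine BalancedTensor.ext fun x m ↦ ?_
  have h (w : M ⊗[k] H) : act x (padComul (n + 1) (n + 1)) w = BalancedTensor.mk k H x
        (TensorProduct.lift (Algebra.lsmul k k M).toLinearMap.flip w) := by
    induction w with
    | zero => simp
    | add u v hu hv => simp only [map_add, hu, hv]
    | tmul m y =>
      simp [padComul_self, BalancedTensor.mk_apply, BalancedTensor.tmul_smul, op_smul_eq]
  rw [Module.End.pow_apply, S.cyc_iterate_tmul n (n + 1) le_rfl, rot_iterate, h, S.modular]
  rfl

/-- The cyclic object `Z_*(H, M) = H^{⊗(*+1)} ⊗_H M`. -/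
def cyclicObject : CyclicObject (ModuleCat.{u} k) where
  X n := ModuleCat.of k (BalancedTensor k H (TPow k H (n + 1)) M)
  δ i := ModuleCat.ofHom (faceMap k H M i)
  σ i := ModuleCat.ofHom (degenMap k H M i)
  t n := ModuleCat.ofHom (S.cyc n)
  δ_comp_δ h := ModuleCat.hom_ext <| BalancedTensor.ext fun x m ↦
    congrArg (fun z ↦ BalancedTensor.tmul k H z m) (LinearMap.congr_fun (face_face h) x)
  δ_comp_σ_of_le h := ModuleCat.hom_ext <| BalancedTensor.ext fun x m ↦
    congrArg (fun z ↦ BalancedTensor.tmul k H z m) (LinearMap.congr_fun (face_degen_of_le h) x)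
  δ_comp_σ_self i := ModuleCat.hom_ext <| BalancedTensor.ext fun x m ↦
    congrArg (fun z ↦ BalancedTensor.tmul k H z m) (LinearMap.congr_fun (face_degen_self i) x)
  δ_comp_σ_succ i := ModuleCat.hom_ext <| BalancedTensor.ext fun x m ↦
    congrArg (fun z ↦ BalancedTensor.tmul k H z m) (LinearMap.congr_fun (face_degen_succ i) x)
  δ_comp_σ_of_gt h := ModuleCat.hom_ext <| BalancedTensor.ext fun x m ↦
    congrArg (fun z ↦ BalancedTensor.tmul k H z m) (LinearMap.congr_fun (face_degen_of_gt h) x)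
  σ_comp_σ h := ModuleCat.hom_ext <| BalancedTensor.ext fun x m ↦
    congrArg (fun z ↦ BalancedTensor.tmul k H z m) (LinearMap.congr_fun (degen_degen h) x)
  t_comp_δ_zero n := ModuleCat.hom_ext <| LinearMap.ext S.faceMap_zero_cyc
  t_comp_δ_succ i := ModuleCat.hom_ext <| LinearMap.ext (S.faceMap_succ_cyc i)
  t_comp_σ_zero n := ModuleCat.hom_ext <| LinearMap.ext S.degenMap_zero_cyc
  t_comp_σ_succ i := ModuleCat.hom_ext <| LinearMap.ext (S.degenMap_succ_cyc i)
  iter_t n := by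
    have h (j : ℕ) : iter (ModuleCat.ofHom (S.cyc n)) j = ModuleCat.ofHom ((S.cyc n) ^ j) := by
      induction j with
      | zero => rfl
      | succ j ih => rw [iter, ih, pow_succ']; rfl
    rw [h, cyc_iterate]
    rfl

/-- The cyclic homology `HC_n(H, M)`: the homology of the total Tsygan complex of `Z_*(H, M)`. -/
def HC (n : ℕ) : ModuleCat.{u} k := S.cyclicObject.cyclicComplex.homology n

end ModularCrossedModule

end CyclicObjectOfModule

section Tor

variable (k A : Type u) [CommRing k] [Ring A] [Algebra k A]

/-- The `k`-module underlying a right module over the `k`-algebra `A`. -/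
@[reducible] def baseModule (X : ModuleCat.{u} Aᵐᵒᵖ) : Module k X :=
  Module.restrictScalars k Aᵐᵒᵖ X

variable (N : Type u) [AddCommGroup N] [Module k N] [Module A N]

/-- The functor `X ↦ X ⊗_A N` from right `A`-modules to `k`-modules. -/
def tensorFunctor : ModuleCat.{u} Aᵐᵒᵖ ⥤ ModuleCat.{u} k where
  obj X := letI := baseModule k A X; ModuleCat.of k (BalancedTensor k A X N)
  map {X Y} f := letI := baseModule k A X; letI := baseModule k A Y
    ModuleCat.ofHom (BalancedTensor.map
      { toFun := f.hom
        map_add' := f.hom.map_add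
        map_smul' := fun c x ↦ f.hom.map_smul (algebraMap k Aᵐᵒᵖ c) x }
      fun a x ↦ f.hom.map_smul (MulOpposite.op a) x)
  map_id X := by
    let := baseModule k A X
    exact ModuleCat.hom_ext (BalancedTensor.ext fun _ _ ↦ rfl)
  map_comp {X Y Z} f g := by
    let := baseModule k A X; let := baseModule k A Y; let := baseModule k A Z
    exact ModuleCat.hom_ext (BalancedTensor.ext fun _ _ ↦ rfl)

instance : (tensorFunctor k A N).Additive where
  map_add {X Y f g} := by
    let := baseModule k A X; let := baseModule k A Y
    refine ModuleCat.hom_ext (BalancedTensor.ext fun x n ↦ ?_)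
    exact LinearMap.map_add₂ (BalancedTensor.mk k A) (f.hom x) (g.hom x) n

/-- `Tor^A_n(X, N)`: the `n`-th left derived functor of `- ⊗_A N`, evaluated at the right
`A`-module `X`. -/
def tor (n : ℕ) (X : ModuleCat.{u} Aᵐᵒᵖ) : ModuleCat.{u} k :=
  ((tensorFunctor k A N).leftDerived n).obj X

end Tor

/-- The base ring `k` as a right `H`-module through the counit. -/
def trivialRight (k H : Type u) [CommRing k] [Ring H] [HopfAlgebra k H] : ModuleCat.{u} Hᵐᵒᵖ :=
  letI : Module Hᵐᵒᵖ k := Module.compHom k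
    ((Bialgebra.counitAlgHom k H).fromOpposite (fun _ _ ↦ Commute.all _ _)).toRingHom
  ModuleCat.of Hᵐᵒᵖ k

end
end HopfCyclic

-- Trivial coaction and cocommutativity allow `- ⊗_H M` to be pulled out of the cyclic structure. By
-- cocommutativity the plain rotation of tensor factors commutes with the diagonal right action
-- (`rot_iterComul_of_isCocomm`), so the powers `P_n = H^{⊗(n+1)}` form a cyclic object
-- `rightCyclic` of right `H`-modules. With trivial coaction the operator `τ_n` is this rotation
-- tensored with `M` (`map_t_comp_cyclicObjectIso`), so `Z_*(H, M)` is `P ⊗_H M` degree by degree.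
--
-- The Hochschild complex of `P` is a projective resolution of `k` (`tensorResolution`): inserting
-- `1` in front contracts it `k`-linearly, and the antipode identifies `P_n` with the induced module
-- on `H^{⊗n}` (`freeEquiv`). Tensored with `M`, it computes `Tor^H(k, M)`.
--
-- The total Tsygan complex of `P` also consists of projectives, and its augmentation to `k` extends
-- that of column 0. The comparison theorem therefore gives a chain map `r` from the total complex
-- back to the Hochschild complex which is the identity on column 0 in degree 0. Restricted to
-- column 0, `r` is homotopic to the identity, because it is an endomorphism of a resolution over
-- the identity of `k`. A homotopy survives any additive functor, so after `- ⊗_H M` the inclusion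
-- of column 0 still has a left inverse up to homotopy (`mapRetraction`, `quasiIso_mapRetraction`).
--
-- Such a retraction splits Connes' periodicity sequence. The odd columns are contractible, so
-- dropping columns 0 and 1 relates `HC_{n+2}` to `HC_n` with only Hochschild homology in between.
-- The retraction kills the connecting map, which leaves `HC_{n+2} ≅ HC_n × Tor_{n+2}`
-- (`homologyEquivProd`). The argument is carried out on cycles rather than through a long exact
-- sequence (`exists_d_eq_of_shift`, `exists_cycle_of_shift`), and induction in steps of two
-- finishes it.

universe w

namespace HopfCyclic

noncomputable section

/-! ### The total differential of a first-quadrant double complex on its summands -/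

section Total

open HomologicalComplex₂

variable {C : Type u} [Category.{v} C] [Preadditive C]
  (K : HomologicalComplex₂ C (ComplexShape.down ℕ) (ComplexShape.down ℕ))
  [K.HasTotal (ComplexShape.down ℕ)]

theorem d₁_succ (p q n : ℕ) (h : p + q = n) :
    K.d₁ (ComplexShape.down ℕ) (p + 1) q n =
      (K.d (p + 1) p).f q ≫ K.ιTotal (ComplexShape.down ℕ) p q n h := by
  rw [d₁_eq K _ (i₁' := p) rfl q n h, show ComplexShape.ε₁ (ComplexShape.down ℕ)
    (ComplexShape.down ℕ) (ComplexShape.down ℕ) (p + 1, q) = 1 from rfl, one_smul]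

theorem d₂_succ (p q n : ℕ) (h : p + q = n) :
    K.d₂ (ComplexShape.down ℕ) p (q + 1) n =
      (-1 : ℤ) ^ p • ((K.X p).d (q + 1) q ≫ K.ιTotal (ComplexShape.down ℕ) p q n h) := by
  rw [d₂_eq K _ p (i₂' := q) rfl n h, show ComplexShape.ε₂ (ComplexShape.down ℕ)
    (ComplexShape.down ℕ) (ComplexShape.down ℕ) (p, q + 1) = (-1 : ℤˣ) ^ p from rfl,
    Units.smul_def]
  simp

theorem ιTotal_total_d (p q m n : ℕ) (h : p + q = m) :
    K.ιTotal (ComplexShape.down ℕ) p q m h ≫ (K.total (ComplexShape.down ℕ)).d m n =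
      K.d₁ (ComplexShape.down ℕ) p q n + K.d₂ (ComplexShape.down ℕ) p q n := by
  rw [total_d]
  erw [Preadditive.comp_add]
  rw [ι_D₁, ι_D₂]

theorem d₁_zero (q n : ℕ) : K.d₁ (ComplexShape.down ℕ) 0 q n = 0 :=
  d₁_eq_zero _ _ _ _ _ (by simp)

theorem d₂_zero (p n : ℕ) : K.d₂ (ComplexShape.down ℕ) p 0 n = 0 :=
  d₂_eq_zero _ _ _ _ _ (by simp)

end Total

/-! ### Coordinates on the total Tsygan complex -/

namespace CyclicObject

variable {C : Type u} [Category.{v} C] [Preadditive C] (Z : CyclicObject C)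

/-- The vertical differential of the `p`-th column of the Tsygan double complex. -/
def vert : ∀ _ n : ℕ, Z.X (n + 1) ⟶ Z.X n
  | 0, n => Z.b n
  | 1, n => Z.b' n
  | p + 2, n => vert p n

/-- The horizontal differential from the column `p + 1` of the Tsygan double complex to the
column `p`. -/
def hor : ∀ _ n : ℕ, Z.X n ⟶ Z.X n
  | 0, n => 𝟙 (Z.X n) - Z.T n
  | 1, n => Z.N n
  | p + 2, n => hor p n

/-- All columns of the Tsygan double complex have the same objects. -/
def columnIso : ∀ p n : ℕ, Z.X n ≅ (Z.tsygan.X p).X n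
  | 0, n => Iso.refl (Z.X n)
  | 1, n => Iso.refl (Z.X n)
  | p + 2, n => columnIso p n

/-- The columns are defined by recursion in steps of two and reduce only for concrete `p`, so for a
variable `p` their entries have to be reached through `columnIso`. Columns 0 and 1 are computed
directly; the recursive case holds by definitional two-periodicity. -/
theorem columnIso_hom_comp_d : ∀ p n : ℕ,
    (Z.columnIso p (n + 1)).hom ≫ (Z.tsygan.X p).d (n + 1) n =
      Z.vert p n ≫ (Z.columnIso p n).hom
  | 0, n => by
    have h : (Z.tsygan.X 0).d (n + 1) n = Z.b n :=
      ChainComplex.of_d (X := Z.X) (d := Z.b) (j := n)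
    rw [h]
    exact (Category.id_comp _).trans (Category.comp_id _).symm
  | 1, n => by
    have h : (Z.tsygan.X 1).d (n + 1) n = Z.b' n :=
      ChainComplex.of_d (X := Z.X) (d := Z.b') (j := n)
    rw [h]
    exact (Category.id_comp _).trans (Category.comp_id _).symm
  | p + 2, n => columnIso_hom_comp_d p n

theorem tsygan_d (p : ℕ) : Z.tsygan.d (p + 1) p = Z.tsyganD p :=
  ChainComplex.of_d (X := Z.tsyganColumn) (d := Z.tsyganD) (j := p)

theorem columnIso_hom_comp_tsyganD : ∀ p n : ℕ,
    (Z.columnIso (p + 1) n).hom ≫ (Z.tsyganD p).f n = Z.hor p n ≫ (Z.columnIso p n).hom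
  | 0, n => (Category.id_comp _).trans (Category.comp_id (𝟙 (Z.X n) - Z.T n)).symm
  | 1, n => (Category.id_comp _).trans (Category.comp_id (Z.N n)).symm
  | p + 2, n => columnIso_hom_comp_tsyganD p n

theorem columnIso_hom_comp_tsygan_d (p n : ℕ) :
    (Z.columnIso (p + 1) n).hom ≫ (Z.tsygan.d (p + 1) p).f n =
      Z.hor p n ≫ (Z.columnIso p n).hom := by
  rw [tsygan_d]
  exact Z.columnIso_hom_comp_tsyganD p n

variable [Z.tsygan.HasTotal (ComplexShape.down ℕ)]

/-- The inclusion of the entry of bidegree `(p, q)` into the total Tsygan complex. -/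
def inj (p q n : ℕ) (h : p + q = n) : Z.X q ⟶ Z.cyclicComplex.X n :=
  (Z.columnIso p q).hom ≫ Z.tsygan.ιTotal (ComplexShape.down ℕ) p q n h

/-- The morphism out of the total Tsygan complex with given components. -/
def desc {n : ℕ} {Y : C} (f : ∀ p q : ℕ, p + q = n → (Z.X q ⟶ Y)) : Z.cyclicComplex.X n ⟶ Y :=
  Z.tsygan.totalDesc fun p q h ↦ (Z.columnIso p q).inv ≫ f p q h

@[simp]
theorem inj_desc {n : ℕ} {Y : C} (f : ∀ p q : ℕ, p + q = n → (Z.X q ⟶ Y)) (p q : ℕ)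
    (h : p + q = n) : Z.inj p q n h ≫ Z.desc f = f p q h :=
  (Category.assoc _ _ _).trans ((congrArg _ (HomologicalComplex₂.ι_totalDesc _ _ p q h)).trans
    (Iso.hom_inv_id_assoc _ _))

@[simp]
theorem inj_desc_assoc {n : ℕ} {Y : C} (f : ∀ p q : ℕ, p + q = n → (Z.X q ⟶ Y)) (p q : ℕ)
    (h : p + q = n)
    {W : C} (w : Y ⟶ W) :
    Z.inj p q n h ≫ Z.desc f ≫ w =
      f p q h ≫ w := by
  rw [← Category.assoc, inj_desc]

theorem cyclicComplex_hom_ext {n : ℕ} {Y : C} {f g : Z.cyclicComplex.X n ⟶ Y}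
    (h : ∀ (p q : ℕ) (hpq : p + q = n), Z.inj p q n hpq ≫ f = Z.inj p q n hpq ≫ g) : f = g := by
  refine HomologicalComplex₂.total.hom_ext (ComplexShape.down ℕ) fun p q hpq ↦ ?_
  exact (cancel_epi (Z.columnIso p q).hom).1
    ((Category.assoc _ _ _).symm.trans ((h p q hpq).trans (Category.assoc _ _ _)))

theorem inj_comp_d (p q m n : ℕ) (h : p + q = m) :
    Z.inj p q m h ≫ Z.cyclicComplex.d m n =
      (Z.columnIso p q).hom ≫ Z.tsygan.d₁ (ComplexShape.down ℕ) p q n +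
      (Z.columnIso p q).hom ≫ Z.tsygan.d₂ (ComplexShape.down ℕ) p q n :=
  (Category.assoc _ _ _).trans ((congrArg _ (ιTotal_total_d Z.tsygan p q m n h)).trans
    (Preadditive.comp_add _ _ _ _ _ _))

theorem columnIso_hom_comp_d₁ (p q n : ℕ) (h : p + q = n) :
    (Z.columnIso (p + 1) q).hom ≫ Z.tsygan.d₁ (ComplexShape.down ℕ) (p + 1) q n =
      Z.hor p q ≫ Z.inj p q n h :=
  (congrArg _ (d₁_succ Z.tsygan p q n h)).trans ((Category.assoc _ _ _).symm.trans
    ((congrArg (· ≫ _) (Z.columnIso_hom_comp_tsygan_d p q)).trans (Category.assoc _ _ _)))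

theorem columnIso_hom_comp_d₂ (p q n : ℕ) (h : p + q = n) :
    (Z.columnIso p (q + 1)).hom ≫ Z.tsygan.d₂ (ComplexShape.down ℕ) p (q + 1) n =
      (-1 : ℤ) ^ p • (Z.vert p q ≫ Z.inj p q n h) :=
  (congrArg _ (d₂_succ Z.tsygan p q n h)).trans ((Preadditive.comp_zsmul _ _ _).trans
    (congrArg _ ((Category.assoc _ _ _).symm.trans
    ((congrArg (· ≫ _) (Z.columnIso_hom_comp_d p q)).trans (Category.assoc _ _ _)))))

/-- Generic position: both a horizontal and a vertical component leave the entry. The two edge cases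
below lack one of them: nothing leaves column 0 horizontally, and nothing leaves row 0 vertically.
Later computations with the total differential go through these three formulas. -/
theorem inj_succ_succ_d (p q n : ℕ) (h : p + 1 + (q + 1) = n + 1) (h₁ : p + (q + 1) = n)
    (h₂ : p + 1 + q = n) :
    Z.inj (p + 1) (q + 1) (n + 1) h ≫ Z.cyclicComplex.d (n + 1) n =
      Z.hor p (q + 1) ≫ Z.inj p (q + 1) n h₁ +
        (-1 : ℤ) ^ (p + 1) • (Z.vert (p + 1) q ≫ Z.inj (p + 1) q n h₂) := by
  rw [inj_comp_d, columnIso_hom_comp_d₁ Z p (q + 1) n h₁,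
    columnIso_hom_comp_d₂ Z (p + 1) q n h₂]
  rfl

theorem inj_succ_succ_d_assoc (p q n : ℕ) (h : p + 1 + (q + 1) = n + 1) (h₁ : p + (q + 1) = n)
    (h₂ : p + 1 + q = n)
    {W : C} (w : Z.cyclicComplex.X n ⟶ W) :
    Z.inj (p + 1) (q + 1) (n + 1) h ≫ Z.cyclicComplex.d (n + 1) n ≫ w =
      (Z.hor p (q + 1) ≫ Z.inj p (q + 1) n h₁ +
        (-1 : ℤ) ^ (p + 1) • (Z.vert (p + 1) q ≫ Z.inj (p + 1) q n h₂)) ≫ w := by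
  rw [← Category.assoc, inj_succ_succ_d]

theorem inj_zero_succ_d (q n : ℕ) (h : 0 + (q + 1) = n + 1) (h₁ : 0 + q = n) :
    Z.inj 0 (q + 1) (n + 1) h ≫ Z.cyclicComplex.d (n + 1) n = Z.b q ≫ Z.inj 0 q n h₁ := by
  have e := (congrArg _ (d₁_zero Z.tsygan (q + 1) n)).trans
    (Limits.comp_zero (f := (Z.columnIso 0 (q + 1)).hom))
  rw [inj_comp_d, columnIso_hom_comp_d₂ Z 0 q n h₁, e]
  exact (zero_add _).trans (one_smul _ _)

theorem inj_zero_succ_d_assoc (q n : ℕ) (h : 0 + (q + 1) = n + 1) (h₁ : 0 + q = n)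
    {W : C} (w : Z.cyclicComplex.X n ⟶ W) :
    Z.inj 0 (q + 1) (n + 1) h ≫ Z.cyclicComplex.d (n + 1) n ≫ w =
      Z.b q ≫ Z.inj 0 q n h₁ ≫ w := by
  rw [← Category.assoc, inj_zero_succ_d, Category.assoc]

theorem inj_succ_zero_d (p n : ℕ) (h : p + 1 + 0 = n + 1) (h₁ : p + 0 = n) :
    Z.inj (p + 1) 0 (n + 1) h ≫ Z.cyclicComplex.d (n + 1) n =
      Z.hor p 0 ≫ Z.inj p 0 n h₁ := by
  have e := (congrArg _ (d₂_zero Z.tsygan (p + 1) n)).trans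
    (Limits.comp_zero (f := (Z.columnIso (p + 1) 0).hom))
  rw [inj_comp_d, columnIso_hom_comp_d₁ Z p 0 n h₁, e]
  exact add_zero _

theorem inj_succ_zero_d_assoc (p n : ℕ) (h : p + 1 + 0 = n + 1) (h₁ : p + 0 = n)
    {W : C} (w : Z.cyclicComplex.X n ⟶ W) :
    Z.inj (p + 1) 0 (n + 1) h ≫ Z.cyclicComplex.d (n + 1) n ≫ w =
      Z.hor p 0 ≫ Z.inj p 0 n h₁ ≫ w := by
  rw [← Category.assoc, inj_succ_zero_d, Category.assoc]

end CyclicObject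

/-! ### Contraction of the `b'`-columns, periodicity shift and column projections -/

namespace CyclicObject

variable {C : Type u} [Category.{v} C] [Preadditive C] (Z : CyclicObject C)

/-- The extra degeneracy contracting the complex with differential `b'`. -/
def extra (n : ℕ) : Z.X n ⟶ Z.X (n + 1) := Z.σ (Fin.last n) ≫ Z.t (n + 1)

omit [Preadditive C] in
theorem extra_δ_zero (n : ℕ) : Z.extra n ≫ Z.δ 0 = 𝟙 _ := by
  rw [extra, Category.assoc, t_comp_δ_zero, ← Fin.succ_last, δ_comp_σ_succ]

omit [Preadditive C] in
-- Rotation lowers the index of a positive face by one, and the resulting face has index at most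
-- `n`, so it slides past the last degeneracy. The double coercion of `i` leaves out face 0, treated
-- just before, and the last face, which does not occur in `b'`.
theorem extra_δ_succ {n : ℕ} (i : Fin (n + 1)) :
    Z.extra (n + 1) ≫ Z.δ i.castSucc.succ = Z.δ i.castSucc ≫ Z.extra n := by
  rw [extra, Category.assoc, t_comp_δ_succ, ← Category.assoc, ← Fin.succ_last,
    Z.δ_comp_σ_of_le (i := i.castSucc) (j := Fin.last n)
      (by rw [Fin.castSucc_le_castSucc_iff]; exact Fin.le_last i), Category.assoc]
  rfl

theorem extra_b'_zero : Z.extra 0 ≫ Z.b' 0 = 𝟙 _ := by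
  simp [b', extra_δ_zero]

/-- This is the contracting homotopy for the odd columns: face 0 contributes the identity, and each
other face commutes with `extra` up to an index shift by one, which reverses its sign. -/
theorem extra_b'_succ (n : ℕ) :
    Z.extra (n + 1) ≫ Z.b' (n + 1) = 𝟙 _ - Z.b' n ≫ Z.extra n := by
  rw [b', Fin.sum_univ_succ, Preadditive.comp_add, Preadditive.comp_zsmul, Fin.castSucc_zero,
    extra_δ_zero, b', Preadditive.sum_comp, Preadditive.comp_sum, sub_eq_add_neg,
    ← Finset.sum_neg_distrib]
  congr 1
  · simp
  · refine Finset.sum_congr rfl fun i _ ↦ ?_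
    rw [Preadditive.comp_zsmul, Preadditive.zsmul_comp, ← Fin.succ_castSucc, extra_δ_succ]
    simp [pow_succ]

/-- The Hochschild complex `(X, b)`. -/
def hochschild : ChainComplex C ℕ := ChainComplex.of Z.X Z.b Z.b_comp_b

theorem hochschild_d (n : ℕ) : Z.hochschild.d (n + 1) n = Z.b n :=
  ChainComplex.of_d (X := Z.X) (d := Z.b) (j := n)

variable [Z.tsygan.HasTotal (ComplexShape.down ℕ)]

/-- The inclusion of the column `0`. -/
def ofHochschild : Z.hochschild ⟶ Z.cyclicComplex where
  f n := Z.inj 0 n n (zero_add n)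
  comm' := by
    rintro _ n rfl
    rw [hochschild_d]
    exact Z.inj_zero_succ_d n n _ _

/-- Shifting by two columns. -/
def shift (n : ℕ) : Z.cyclicComplex.X (n + 2) ⟶ Z.cyclicComplex.X n :=
  Z.desc fun
    | 0, _, _ => 0
    | 1, _, _ => 0
    | p + 2, q, h => Z.inj p q n (by omega)

@[simp]
theorem inj_zero_shift (q n : ℕ) (h : 0 + q = n + 2) : Z.inj 0 q (n + 2) h ≫ Z.shift n = 0 :=
  Z.inj_desc _ _ _ _

@[simp]
theorem inj_zero_shift_assoc (q n : ℕ) (h : 0 + q = n + 2)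
    {W : C} (w : Z.cyclicComplex.X n ⟶ W) :
    Z.inj 0 q (n + 2) h ≫ Z.shift n ≫ w =
      0 := by
  rw [← Category.assoc, inj_zero_shift, Limits.zero_comp]

@[simp]
theorem inj_one_shift (q n : ℕ) (h : 1 + q = n + 2) : Z.inj 1 q (n + 2) h ≫ Z.shift n = 0 :=
  Z.inj_desc _ _ _ _

@[simp]
theorem inj_one_shift_assoc (q n : ℕ) (h : 1 + q = n + 2)
    {W : C} (w : Z.cyclicComplex.X n ⟶ W) :
    Z.inj 1 q (n + 2) h ≫ Z.shift n ≫ w =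
      0 := by
  rw [← Category.assoc, inj_one_shift, Limits.zero_comp]

@[simp]
theorem inj_add_two_shift (p q n : ℕ) (h : p + 2 + q = n + 2) :
    Z.inj (p + 2) q (n + 2) h ≫ Z.shift n = Z.inj p q n (by omega) :=
  Z.inj_desc _ _ _ _

@[simp]
theorem inj_add_two_shift_assoc (p q n : ℕ) (h : p + 2 + q = n + 2)
    {W : C} (w : Z.cyclicComplex.X n ⟶ W) :
    Z.inj (p + 2) q (n + 2) h ≫ Z.shift n ≫ w =
      Z.inj p q n (by omega) ≫ w := by
  rw [← Category.assoc, inj_add_two_shift]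

/-- The section of `shift` inserting zeros in the columns `0` and `1`. -/
def unshift (n : ℕ) : Z.cyclicComplex.X n ⟶ Z.cyclicComplex.X (n + 2) :=
  Z.desc fun p q h ↦ Z.inj (p + 2) q (n + 2) (by omega)

theorem unshift_shift (n : ℕ) : Z.unshift n ≫ Z.shift n = 𝟙 _ :=
  Z.cyclicComplex_hom_ext fun p q h ↦ by simp [unshift]

/-- Columns `p` and `p + 2` have the same differentials, and the sign `(-1)^p` of the total complex
agrees on them. What the differential sends from column 2 or 3 into columns 0 to 2 has to be
compared with the truncation at the new column 0. -/
theorem d_shift (n : ℕ) : Z.cyclicComplex.d (n + 3) (n + 2) ≫ Z.shift n =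
    Z.shift (n + 1) ≫ Z.cyclicComplex.d (n + 1) n := by
  refine Z.cyclicComplex_hom_ext fun p q h ↦ ?_
  rcases q with _ | q
  · have hp : p = n + 3 := h
    subst hp
    rw [Z.inj_succ_zero_d_assoc (n + 2) (n + 2) h rfl, inj_add_two_shift,
      inj_add_two_shift_assoc, Z.inj_succ_zero_d n n rfl rfl]
    rfl
  · match p, h with
    | 0, h =>
      rw [Z.inj_zero_succ_d_assoc q (n + 2) h (by omega), inj_zero_shift, Limits.comp_zero,
        inj_zero_shift_assoc]
    | 1, h =>
      rw [Z.inj_succ_succ_d_assoc 0 q (n + 2) h (by omega) (by omega), Preadditive.add_comp,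
        Preadditive.zsmul_comp, Category.assoc, Category.assoc, inj_zero_shift, inj_one_shift,
        inj_one_shift_assoc]
      simp
    -- Column 2 becomes column 0: its horizontal component lands in column 1, which the shift kills,
    -- so only the vertical differential remains.
    | 2, h =>
      rw [Z.inj_succ_succ_d_assoc 1 q (n + 2) h (by omega) (by omega), Preadditive.add_comp,
        Preadditive.zsmul_comp, Category.assoc, Category.assoc, inj_one_shift,
        Z.inj_add_two_shift 0, Z.inj_add_two_shift_assoc 0, Z.inj_zero_succ_d q n (by omega) (by omega)]
      simp
      rfl
    | p + 3, h =>
      rw [Z.inj_succ_succ_d_assoc (p + 2) q (n + 2) h (by omega) (by omega), Preadditive.add_comp,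
        Preadditive.zsmul_comp, Category.assoc, Category.assoc, inj_add_two_shift,
        show Z.inj (p + 2 + 1) q (n + 2) (by omega) ≫ Z.shift n = Z.inj (p + 1) q n (by omega) from
          Z.inj_add_two_shift (p + 1) q n (by omega),
        show Z.inj (p + 3) (q + 1) (n + 3) h ≫ Z.shift (n + 1) ≫ Z.cyclicComplex.d (n + 1) n =
          Z.inj (p + 1) (q + 1) (n + 1) (by omega) ≫ Z.cyclicComplex.d (n + 1) n from
          Z.inj_add_two_shift_assoc (p + 1) (q + 1) (n + 1) (by omega) _,
        Z.inj_succ_succ_d p q n (by omega) (by omega) (by omega)]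
      simp [pow_succ]
      rfl

/-- The projection to the column `0`. -/
def projZero (n : ℕ) : Z.cyclicComplex.X n ⟶ Z.X n :=
  Z.desc fun
    | 0, _, h => eqToHom (by rw [← h, zero_add])
    | _ + 1, _, _ => 0

/-- The projection to the column `1`. -/
def projOne (n : ℕ) : Z.cyclicComplex.X (n + 1) ⟶ Z.X n :=
  Z.desc fun
    | 0, _, _ => 0
    | 1, q, h => eqToHom (by rw [show q = n by omega])
    | _ + 2, _, _ => 0

@[simp]
theorem inj_zero_projZero (n : ℕ) (h : 0 + n = n) : Z.inj 0 n n h ≫ Z.projZero n = 𝟙 _ :=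
  Z.inj_desc _ _ _ _

@[simp]
theorem inj_zero_projZero_assoc (n : ℕ) (h : 0 + n = n)
    {W : C} (w : Z.X n ⟶ W) :
    Z.inj 0 n n h ≫ Z.projZero n ≫ w =
      w := by
  rw [← Category.assoc, inj_zero_projZero, Category.id_comp]

@[simp]
theorem inj_succ_projZero (p q n : ℕ) (h : p + 1 + q = n) :
    Z.inj (p + 1) q n h ≫ Z.projZero n = 0 :=
  Z.inj_desc _ _ _ _

@[simp]
theorem inj_succ_projZero_assoc (p q n : ℕ) (h : p + 1 + q = n)
    {W : C} (w : Z.X n ⟶ W) :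
    Z.inj (p + 1) q n h ≫ Z.projZero n ≫ w =
      0 := by
  rw [← Category.assoc, inj_succ_projZero, Limits.zero_comp]

@[simp]
theorem inj_one_projOne (n : ℕ) (h : 1 + n = n + 1) : Z.inj 1 n (n + 1) h ≫ Z.projOne n = 𝟙 _ :=
  Z.inj_desc _ _ _ _

@[simp]
theorem inj_one_projOne_assoc (n : ℕ) (h : 1 + n = n + 1)
    {W : C} (w : Z.X n ⟶ W) :
    Z.inj 1 n (n + 1) h ≫ Z.projOne n ≫ w =
      w := by
  rw [← Category.assoc, inj_one_projOne, Category.id_comp]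

@[simp]
theorem inj_zero_projOne (q n : ℕ) (h : 0 + q = n + 1) : Z.inj 0 q (n + 1) h ≫ Z.projOne n = 0 :=
  Z.inj_desc _ _ _ _

@[simp]
theorem inj_zero_projOne_assoc (q n : ℕ) (h : 0 + q = n + 1)
    {W : C} (w : Z.X n ⟶ W) :
    Z.inj 0 q (n + 1) h ≫ Z.projOne n ≫ w =
      0 := by
  rw [← Category.assoc, inj_zero_projOne, Limits.zero_comp]

@[simp]
theorem inj_add_two_projOne (p q n : ℕ) (h : p + 2 + q = n + 1) :
    Z.inj (p + 2) q (n + 1) h ≫ Z.projOne n = 0 :=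
  Z.inj_desc _ _ _ _

@[simp]
theorem inj_add_two_projOne_assoc (p q n : ℕ) (h : p + 2 + q = n + 1)
    {W : C} (w : Z.X n ⟶ W) :
    Z.inj (p + 2) q (n + 1) h ≫ Z.projOne n ≫ w =
      0 := by
  rw [← Category.assoc, inj_add_two_projOne, Limits.zero_comp]

theorem id_cyclicComplex_zero :
    𝟙 (Z.cyclicComplex.X 0) = Z.projZero 0 ≫ Z.inj 0 0 0 rfl := by
  refine Z.cyclicComplex_hom_ext fun p q h ↦ ?_
  obtain rfl : p = 0 := by omega
  obtain rfl : q = 0 := by omega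
  simp

theorem id_cyclicComplex_one :
    𝟙 (Z.cyclicComplex.X 1) =
      Z.projZero 1 ≫ Z.inj 0 1 1 rfl + Z.projOne 0 ≫ Z.inj 1 0 1 rfl := by
  refine Z.cyclicComplex_hom_ext fun p q h ↦ ?_
  match p, h with
  | 0, h =>
    obtain rfl : q = 1 := by omega
    simp
  | 1, h =>
    obtain rfl : q = 0 := by omega
    simp
  | p + 2, h => omega

/-- Splitting by columns 0, 1 and at least 2. The projections are only degreewise maps, so this
decomposes objects and not the complex. -/
theorem id_cyclicComplex_add_two (n : ℕ) :
    𝟙 (Z.cyclicComplex.X (n + 2)) =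
      Z.projZero (n + 2) ≫ Z.inj 0 (n + 2) (n + 2) (by omega) +
        Z.projOne (n + 1) ≫ Z.inj 1 (n + 1) (n + 2) (by omega) + Z.shift n ≫ Z.unshift n := by
  refine Z.cyclicComplex_hom_ext fun p q h ↦ ?_
  match p, h with
  | 0, h =>
    obtain rfl : q = n + 2 := by omega
    simp
  | 1, h =>
    obtain rfl : q = n + 1 := by omega
    simp
  | p + 2, h => simp [unshift]

theorem inj_zero_d_projOne (n : ℕ) (h : 0 + (n + 2) = n + 2) :
    Z.inj 0 (n + 2) (n + 2) h ≫ Z.cyclicComplex.d (n + 2) (n + 1) ≫ Z.projOne n = 0 := by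
  rw [Z.inj_zero_succ_d_assoc (n + 1) (n + 1) h (by omega)]
  simp

theorem inj_one_d_projOne (n : ℕ) (h : 1 + (n + 1) = n + 2) :
    Z.inj 1 (n + 1) (n + 2) h ≫ Z.cyclicComplex.d (n + 2) (n + 1) ≫ Z.projOne n = -Z.b' n := by
  rw [Z.inj_succ_succ_d_assoc 0 n (n + 1) h (by omega) (by omega), Preadditive.add_comp,
    Preadditive.zsmul_comp, Category.assoc, Category.assoc, inj_zero_projOne]
  simp
  rfl

/-- A morphism of complexes out of the total Tsygan complex, given by its components. -/
def descHom (B : ChainComplex C ℕ) (f : ∀ p q n : ℕ, p + q = n → (Z.X q ⟶ B.X n))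
    (h₁ : ∀ (p q n : ℕ) (h : p + 1 + (q + 1) = n + 1) (h₁ : p + (q + 1) = n) (h₂ : p + 1 + q = n),
      f (p + 1) (q + 1) (n + 1) h ≫ B.d (n + 1) n = Z.hor p (q + 1) ≫ f p (q + 1) n h₁ +
        (-1 : ℤ) ^ (p + 1) • (Z.vert (p + 1) q ≫ f (p + 1) q n h₂))
    (h₂ : ∀ (q n : ℕ) (h : 0 + (q + 1) = n + 1) (h₁ : 0 + q = n),
      f 0 (q + 1) (n + 1) h ≫ B.d (n + 1) n = Z.b q ≫ f 0 q n h₁)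
    (h₃ : ∀ (p n : ℕ) (h : p + 1 + 0 = n + 1) (h₁ : p + 0 = n),
      f (p + 1) 0 (n + 1) h ≫ B.d (n + 1) n = Z.hor p 0 ≫ f p 0 n h₁) :
    Z.cyclicComplex ⟶ B where
  f n := Z.desc fun p q h ↦ f p q n h
  comm' := by
    rintro _ n rfl
    refine Z.cyclicComplex_hom_ext fun p q h ↦ ?_
    rw [inj_desc_assoc]
    rcases p with _ | p
    · obtain rfl : q = n + 1 := by omega
      rw [Z.inj_zero_succ_d_assoc n n h (by omega), inj_desc, h₂]
    · rcases q with _ | q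
      · rw [Z.inj_succ_zero_d_assoc p n h (by omega), inj_desc, h₃]
      · rw [Z.inj_succ_succ_d_assoc p q n h (by omega) (by omega), Preadditive.add_comp,
          Preadditive.zsmul_comp, Category.assoc, Category.assoc, inj_desc, inj_desc, h₁]

end CyclicObject

/-! ### Homology of complexes of modules in terms of elements -/

section HomologyClass

variable {k : Type u} [CommRing k] (K L : ChainComplex (ModuleCat.{u} k) ℕ)

/-- An element killed by the differential, as an element of the object of cycles. -/
def toCyclesObj (n : ℕ) : LinearMap.ker (K.d n (n - 1)).hom →ₗ[k] K.cycles n :=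
  -- Truncated subtraction gives the correct convention: for `n = 0` the map in question is `K.d 0 0
  -- = 0`, so every element of degree 0 counts as a cycle.
  (K.liftCycles (ModuleCat.ofHom (LinearMap.ker (K.d n (n - 1)).hom).subtype) (n - 1)
    (by cases n <;> simp) (ModuleCat.hom_ext (LinearMap.comp_ker_subtype _))).hom

@[simp] theorem iCycles_toCyclesObj (n : ℕ) (x : LinearMap.ker (K.d n (n - 1)).hom) :
    (K.iCycles n).hom (toCyclesObj K n x) = x :=
  LinearMap.congr_fun (congrArg ModuleCat.Hom.hom (K.liftCycles_i (ModuleCat.ofHom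
    (LinearMap.ker (K.d n (n - 1)).hom).subtype) (n - 1) (by cases n <;> simp)
    (ModuleCat.hom_ext (LinearMap.comp_ker_subtype _)))) x

/-- The homology class of a cycle. -/
def homologyClass (n : ℕ) : LinearMap.ker (K.d n (n - 1)).hom →ₗ[k] K.homology n :=
  (K.homologyπ n).hom ∘ₗ toCyclesObj K n

theorem iCycles_injective (n : ℕ) : Function.Injective (K.iCycles n).hom :=
  (ModuleCat.mono_iff_injective _).1 inferInstance

theorem homologyClass_surjective (n : ℕ) : Function.Surjective (homologyClass K n) := by
  intro h
  obtain ⟨z, rfl⟩ := (ModuleCat.epi_iff_surjective (K.homologyπ n)).1 inferInstance h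
  refine ⟨⟨(K.iCycles n).hom z, ?_⟩, ?_⟩
  · rw [LinearMap.mem_ker, ← LinearMap.comp_apply, ← ModuleCat.hom_comp,
      HomologicalComplex.iCycles_d]
    rfl
  · refine congrArg (K.homologyπ n).hom (iCycles_injective K n ?_)
    exact iCycles_toCyclesObj K n _

/-- Homology is the cokernel of the map from chains to cycles, so the kernel of `homologyπ` is the
image of that map; the injection of cycles into chains then transfers the equation. -/
theorem homologyClass_eq_zero_iff {n : ℕ} (x : LinearMap.ker (K.d n (n - 1)).hom) :
    homologyClass K n x = 0 ↔ ∃ y : K.X (n + 1), (K.d (n + 1) n).hom y = x := by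
  have hex : (ShortComplex.mk (K.toCycles (n + 1) n) (K.homologyπ n) (by simp)).Exact :=
    ShortComplex.exact_of_g_is_cokernel _ (K.homologyIsCokernel (n + 1) n (by simp))
  rw [ShortComplex.moduleCat_exact_iff] at hex
  have hd (y : K.X (n + 1)) : (K.d (n + 1) n).hom y =
      (K.iCycles n).hom ((K.toCycles (n + 1) n).hom y) := by
    rw [← LinearMap.comp_apply, ← ModuleCat.hom_comp, K.toCycles_i]
  constructor
  · intro h
    obtain ⟨y, hy⟩ := hex _ h
    exact ⟨y, (hd y).trans ((congrArg _ hy).trans (iCycles_toCyclesObj K n x))⟩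
  · rintro ⟨y, hy⟩
    have e : toCyclesObj K n x = (K.toCycles (n + 1) n).hom y :=
      iCycles_injective K n (by rw [iCycles_toCyclesObj, ← hy, hd])
    rw [homologyClass, LinearMap.comp_apply, e, ← LinearMap.comp_apply, ← ModuleCat.hom_comp,
      HomologicalComplex.toCycles_comp_homologyπ]
    rfl

variable {K L}

/-- The map on cycles induced by a morphism of complexes. -/
def cyclesHom (f : K ⟶ L) (n : ℕ) :
    LinearMap.ker (K.d n (n - 1)).hom →ₗ[k] LinearMap.ker (L.d n (n - 1)).hom :=
  (f.f n).hom.restrict fun x hx ↦ by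
    rw [LinearMap.mem_ker] at hx ⊢
    rw [← LinearMap.comp_apply, ← ModuleCat.hom_comp, f.comm, ModuleCat.hom_comp,
      LinearMap.comp_apply, hx, map_zero]

theorem homologyMap_homologyClass (f : K ⟶ L) (n : ℕ) (x : LinearMap.ker (K.d n (n - 1)).hom) :
    (HomologicalComplex.homologyMap f n).hom (homologyClass K n x) =
      homologyClass L n (cyclesHom f n x) := by
  have e : (HomologicalComplex.cyclesMap f n).hom (toCyclesObj K n x) =
      toCyclesObj L n (cyclesHom f n x) := iCycles_injective L n <| by
    rw [← LinearMap.comp_apply, ← ModuleCat.hom_comp, HomologicalComplex.cyclesMap_i,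
      ModuleCat.hom_comp, LinearMap.comp_apply, iCycles_toCyclesObj, iCycles_toCyclesObj]
    rfl
  rw [homologyClass, homologyClass, LinearMap.comp_apply, LinearMap.comp_apply, ← e,
    ← LinearMap.comp_apply, ← ModuleCat.hom_comp, HomologicalComplex.homologyπ_naturality]
  rfl

/-- Homology is computed by a surjection from the cycles that vanishes on the boundaries only. -/
def homologyEquivOfSurjective {n : ℕ} {V : Type*} [AddCommGroup V] [Module k V]
    (φ : LinearMap.ker (K.d n (n - 1)).hom →ₗ[k] V) (hφ : Function.Surjective φ)
    (h : ∀ x, φ x = 0 ↔ ∃ y : K.X (n + 1), (K.d (n + 1) n).hom y = x) :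
    K.homology n ≃ₗ[k] V :=
  ((homologyClass K n).quotKerEquivOfSurjective (homologyClass_surjective K n)).symm ≪≫ₗ
    Submodule.quotEquivOfEq _ _ (by
      ext x
      rw [LinearMap.mem_ker, LinearMap.mem_ker, homologyClass_eq_zero_iff, h]) ≪≫ₗ
    φ.quotKerEquivOfSurjective hφ

/-- Injectivity on homology in a form usable with explicit chains; the next lemma is its surjective
counterpart. -/
theorem exists_boundary_of_quasiIso (f : K ⟶ L) [QuasiIso f] {n : ℕ} (x : K.X n)
    (hx : (K.d n (n - 1)).hom x = 0) (y : L.X (n + 1))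
    (hy : (L.d (n + 1) n).hom y = (f.f n).hom x) : ∃ z : K.X (n + 1), (K.d (n + 1) n).hom z = x := by
  refine (homologyClass_eq_zero_iff K ⟨x, hx⟩).1 ?_
  refine (ModuleCat.mono_iff_injective (HomologicalComplex.homologyMap f n)).1 inferInstance ?_
  exact (homologyMap_homologyClass f n ⟨x, hx⟩).trans
    (((homologyClass_eq_zero_iff L (cyclesHom f n ⟨x, hx⟩)).2 ⟨y, hy⟩).trans (map_zero _).symm)

theorem exists_cycle_of_quasiIso (f : K ⟶ L) [QuasiIso f] {n : ℕ} (y : L.X n)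
    (hy : (L.d n (n - 1)).hom y = 0) : ∃ (x : K.X n) (w : L.X (n + 1)),
      (K.d n (n - 1)).hom x = 0 ∧ (L.d (n + 1) n).hom w = (f.f n).hom x - y := by
  obtain ⟨h, hh⟩ := (ModuleCat.epi_iff_surjective (HomologicalComplex.homologyMap f n)).1
    inferInstance (homologyClass L n ⟨y, hy⟩)
  obtain ⟨x, rfl⟩ := homologyClass_surjective K n h
  have e : homologyClass L n (cyclesHom f n x - ⟨y, hy⟩) = 0 := by
    rw [map_sub, ← homologyMap_homologyClass, sub_eq_zero]
    exact hh
  obtain ⟨w, hw⟩ := (homologyClass_eq_zero_iff L _).1 e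
  exact ⟨x, w, x.2, hw⟩

end HomologyClass

/-! ### Moving cycles from columns 0 and 1 into column 0 -/

namespace CyclicObject

variable {k : Type u} [CommRing k] (Z : CyclicObject (ModuleCat.{u} k))

theorem hom_apply_of_eq {X Y : ModuleCat.{u} k} {f g : X ⟶ Y} (h : f = g) (x : X) :
    f.hom x = g.hom x := by rw [h]

/-- Contractibility of column 1: the cycle condition makes `x₁` a `b'`-cycle, so the extra
degeneracy supplies a `b'`-primitive. Subtracting the total boundary of that primitive clears column
1 at the cost of a `1 - T` term in column 0. -/
theorem exists_eq_d_add_inj_zero (n : ℕ) (x₀ : Z.X (n + 1)) (x₁ : Z.X n)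
    (h : (Z.cyclicComplex.d (n + 1) n).hom
      ((Z.inj 0 (n + 1) (n + 1) (by omega)).hom x₀ + (Z.inj 1 n (n + 1) (by omega)).hom x₁) = 0) :
    ∃ (z : Z.X (n + 1)) (a : Z.X (n + 1)),
      (Z.inj 0 (n + 1) (n + 1) (by omega)).hom x₀ + (Z.inj 1 n (n + 1) (by omega)).hom x₁ =
        (Z.cyclicComplex.d (n + 2) (n + 1)).hom ((Z.inj 1 (n + 1) (n + 2) (by omega)).hom z) +
          (Z.inj 0 (n + 1) (n + 1) (by omega)).hom a := by
  have hx : (Z.b' n).hom ((Z.extra n).hom x₁) = x₁ := by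
    -- For `n = 0` the composite of `extra` and `b'` is already the identity, so no cycle condition
    -- is needed; in higher degrees it is read off from the column 1 component of `h`.
    rcases n with _ | n
    · exact hom_apply_of_eq Z.extra_b'_zero x₁
    · have h1 : (Z.b' n).hom x₁ = 0 := by
        have := congrArg (Z.projOne n).hom h
        rw [map_add, map_add, map_zero] at this
        have e0 := hom_apply_of_eq (Z.inj_zero_d_projOne n (by omega)) x₀
        have e1 := hom_apply_of_eq (Z.inj_one_d_projOne n (by omega)) x₁
        rw [← neg_eq_zero]
        exact e1.symm.trans ((zero_add _).symm.trans ((congrArg (· + _) e0.symm).trans this))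
      refine (hom_apply_of_eq (Z.extra_b'_succ n) x₁).trans ?_
      change x₁ - (Z.extra n).hom ((Z.b' n).hom x₁) = x₁
      rw [h1, map_zero, sub_zero]
  -- The minus sign compensates for the `-1` carried by the vertical differential of column 1 in the
  -- total complex.
  refine ⟨-(Z.extra n).hom x₁, x₀ + (Z.hor 0 (n + 1)).hom ((Z.extra n).hom x₁), ?_⟩
  have e := hom_apply_of_eq (Z.inj_succ_succ_d 0 n (n + 1) (by omega) (by omega) (by omega))
    ((Z.extra n).hom x₁)
  have e' : (Z.cyclicComplex.d (n + 2) (n + 1)).hom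
      ((Z.inj 1 (n + 1) (n + 2) (by omega)).hom ((Z.extra n).hom x₁)) =
      (Z.inj 0 (n + 1) (n + 1) (by omega)).hom ((Z.hor 0 (n + 1)).hom ((Z.extra n).hom x₁)) +
      (-1 : ℤ) ^ (0 + 1) • (Z.inj 1 n (n + 1) (by omega)).hom
        ((Z.b' n).hom ((Z.extra n).hom x₁)) := e
  rw [map_neg, map_neg, e', hx, map_add]
  simp
  abel

theorem eq_inj_zero_add_inj_one {n : ℕ} (x : Z.cyclicComplex.X (n + 2))
    (hx : (Z.shift n).hom x = 0) :
    x = (Z.inj 0 (n + 2) (n + 2) (by omega)).hom ((Z.projZero (n + 2)).hom x) +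
      (Z.inj 1 (n + 1) (n + 2) (by omega)).hom ((Z.projOne (n + 1)).hom x) := by
  refine (hom_apply_of_eq (Z.id_cyclicComplex_add_two n) x).trans ?_
  change _ + (Z.unshift n).hom ((Z.shift n).hom x) = _
  rw [hx, map_zero, add_zero]
  rfl

variable {Z} {B : ChainComplex (ModuleCat.{u} k) ℕ} (r : Z.cyclicComplex ⟶ B)
  [QuasiIso (Z.ofHochschild ≫ r)]

/-- Column 0 embeds into the total complex as a subcomplex, so `a` is a Hochschild cycle. Its image
in `B` bounds, and the restriction of `r` to column 0 is injective on homology; hence `a` bounds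
inside column 0. -/
theorem exists_b_eq {n : ℕ} (a : Z.X n)
    (ha : (Z.cyclicComplex.d n (n - 1)).hom ((Z.inj 0 n n (zero_add n)).hom a) = 0) (w : B.X (n + 1))
    (hw : (B.d (n + 1) n).hom w = (r.f n).hom ((Z.inj 0 n n (zero_add n)).hom a)) :
    ∃ v : Z.X (n + 1), (Z.cyclicComplex.d (n + 1) n).hom
      ((Z.inj 0 (n + 1) (n + 1) (zero_add _)).hom v) = (Z.inj 0 n n (zero_add n)).hom a := by
  obtain ⟨v, hv⟩ := exists_boundary_of_quasiIso (Z.ofHochschild ≫ r) (n := n) a (by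
    have e := hom_apply_of_eq (Z.ofHochschild.comm n (n - 1)) a
    have e' := congrArg (Z.projZero (n - 1)).hom (e.symm.trans ha)
    rw [map_zero] at e'
    exact (hom_apply_of_eq (Z.inj_zero_projZero (n - 1) (zero_add _)) _).symm.trans e') w hw
  refine ⟨v, (hom_apply_of_eq (Z.ofHochschild.comm (n + 1) n) v).trans ?_⟩
  exact congrArg (Z.inj 0 n n (zero_add n)).hom hv

end CyclicObject

/-! ### Splitting of the periodicity sequence by a retraction -/

namespace CyclicObject

variable {k : Type u} [CommRing k] {Z : CyclicObject (ModuleCat.{u} k)}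
  {B : ChainComplex (ModuleCat.{u} k) ℕ} (r : Z.cyclicComplex ⟶ B)

theorem d_apply_d (K : ChainComplex (ModuleCat.{u} k) ℕ) (i j l : ℕ) (x : K.X i) :
    (K.d j l).hom ((K.d i j).hom x) = 0 :=
  hom_apply_of_eq (K.d_comp_d i j l) x

theorem comm_apply {K L : ChainComplex (ModuleCat.{u} k) ℕ} (f : K ⟶ L) (i j : ℕ) (x : K.X i) :
    (L.d i j).hom ((f.f i).hom x) = (f.f j).hom ((K.d i j).hom x) :=
  hom_apply_of_eq (f.comm i j) x

/-- The shift by two columns on cycles. -/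
def cyclesShift (n : ℕ) : LinearMap.ker (Z.cyclicComplex.d (n + 2) (n + 2 - 1)).hom →ₗ[k]
    LinearMap.ker (Z.cyclicComplex.d n (n - 1)).hom :=
  (Z.shift n).hom.restrict fun x hx ↦ by
    rw [LinearMap.mem_ker] at hx ⊢
    rcases n with _ | n
    · rw [Z.cyclicComplex.shape 0 (0 - 1) (by simp)]
      rfl
    · refine (hom_apply_of_eq (Z.d_shift n) x).symm.trans ?_
      exact (congrArg (Z.shift n).hom hx).trans (map_zero _)

variable [QuasiIso (Z.ofHochschild ≫ r)]

/-- A cycle homologous to a chain in column 0 is detected by `r`, since Hochschild cycles are. This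
is the common end of the injectivity arguments in low and in high degree. -/
theorem exists_d_eq {n : ℕ} (x : Z.cyclicComplex.X n) (y : Z.cyclicComplex.X (n + 1)) (a : Z.X n)
    (hx : (Z.cyclicComplex.d n (n - 1)).hom x = 0)
    (h : x = (Z.cyclicComplex.d (n + 1) n).hom y + (Z.inj 0 n n (zero_add n)).hom a)
    (w : B.X (n + 1)) (hw : (B.d (n + 1) n).hom w = (r.f n).hom x) :
    ∃ y' : Z.cyclicComplex.X (n + 1), (Z.cyclicComplex.d (n + 1) n).hom y' = x := by
  -- The image of `a` differs from that of `x` by the boundary of the image of `y`, which is why the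
  -- primitive `w` is corrected by that image.
  obtain ⟨v, hv⟩ := exists_b_eq r a (by
    rw [h, map_add, d_apply_d, zero_add] at hx
    exact hx) (w - (r.f (n + 1)).hom y) (by
    rw [map_sub, comm_apply, hw, ← map_sub, h, add_sub_cancel_left])
  exact ⟨y + (Z.inj 0 (n + 1) (n + 1) (zero_add _)).hom v, by rw [map_add, hv, h]⟩

/-- In degrees `0` and `1` cyclic homology agrees with Hochschild homology. -/
theorem exists_eq_d_add_of_le_one {n : ℕ} (hn : n ≤ 1) (x : Z.cyclicComplex.X n)
    (hx : (Z.cyclicComplex.d n (n - 1)).hom x = 0) :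
    ∃ (y : Z.cyclicComplex.X (n + 1)) (a : Z.X n),
      x = (Z.cyclicComplex.d (n + 1) n).hom y + (Z.inj 0 n n (zero_add n)).hom a := by
  match n, hn with
  | 0, _ =>
    refine ⟨0, (Z.projZero 0).hom x, ?_⟩
    rw [map_zero, zero_add]
    exact hom_apply_of_eq Z.id_cyclicComplex_zero x
  | 1, _ =>
    have e : x = (Z.inj 0 1 1 rfl).hom ((Z.projZero 1).hom x) +
      (Z.inj 1 0 1 rfl).hom ((Z.projOne 0).hom x) := hom_apply_of_eq Z.id_cyclicComplex_one x
    obtain ⟨z, a, h⟩ := Z.exists_eq_d_add_inj_zero 0 ((Z.projZero 1).hom x)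
      ((Z.projOne 0).hom x) ((congrArg _ e.symm).trans hx)
    exact ⟨_, a, e.trans h⟩

/-- In degrees `0` and `1` the cyclic homology is the homology of `B`. -/
def homologyEquivOfLeOne {n : ℕ} (hn : n ≤ 1) : Z.cyclicComplex.homology n ≃ₗ[k] B.homology n :=
  homologyEquivOfSurjective (homologyClass B n ∘ₗ cyclesHom r n)
    (fun h ↦ by
      obtain ⟨v, rfl⟩ := homologyClass_surjective B n h
      obtain ⟨c, w, hc, hw⟩ := exists_cycle_of_quasiIso (Z.ofHochschild ≫ r) v.1 v.2
      refine ⟨cyclesHom Z.ofHochschild n ⟨c, hc⟩, ?_⟩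
      rw [← sub_eq_zero, LinearMap.comp_apply, ← map_sub, homologyClass_eq_zero_iff]
      exact ⟨w, hw⟩)
    fun x ↦ by
      rw [LinearMap.comp_apply, homologyClass_eq_zero_iff]
      constructor
      · rintro ⟨w, hw⟩
        obtain ⟨y, a, h⟩ := exists_eq_d_add_of_le_one hn x.1 x.2
        exact exists_d_eq r x.1 y a x.2 h w hw
      · rintro ⟨y, hy⟩
        refine ⟨(r.f (n + 1)).hom y, ?_⟩
        rw [comm_apply, hy]
        rfl

/-- Injectivity half of the splitting. A primitive `u` of the shifted cycle, moved back by two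
columns, yields a boundary which agrees with `x` in the columns from 2 on. The difference lies in
columns 0 and 1, can be moved into column 0, and is detected there by `r`. -/
theorem exists_d_eq_of_shift {n : ℕ} (x : Z.cyclicComplex.X (n + 2))
    (hx : (Z.cyclicComplex.d (n + 2) (n + 1)).hom x = 0) (u : Z.cyclicComplex.X (n + 1))
    (hu : (Z.cyclicComplex.d (n + 1) n).hom u = (Z.shift n).hom x)
    (w : B.X (n + 3)) (hw : (B.d (n + 3) (n + 2)).hom w = (r.f (n + 2)).hom x) :
    ∃ y : Z.cyclicComplex.X (n + 3), (Z.cyclicComplex.d (n + 3) (n + 2)).hom y = x := by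
  let y₀ := (Z.unshift (n + 1)).hom u
  have h0 : (Z.shift (n + 1)).hom y₀ = u := hom_apply_of_eq (Z.unshift_shift (n + 1)) u
  have h1 : (Z.shift n).hom (x - (Z.cyclicComplex.d (n + 3) (n + 2)).hom y₀) = 0 := by
    rw [map_sub, ← hu, sub_eq_zero, ← h0]
    exact (hom_apply_of_eq (Z.d_shift n) y₀).symm
  have e := Z.eq_inj_zero_add_inj_one _ h1
  obtain ⟨z, a, h⟩ := Z.exists_eq_d_add_inj_zero (n + 1) _ _ ((congrArg _ e.symm).trans (by
    rw [map_sub, hx, d_apply_d, sub_zero]))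
  refine exists_d_eq r x (y₀ + (Z.inj 1 (n + 2) (n + 3) (by omega)).hom z) a hx ?_ w hw
  rw [map_add, add_assoc]
  exact (sub_eq_iff_eq_add'.1 (e.trans h))

/-- Surjectivity half of the splitting: the class of `u` lifts through the shift because the
obstruction, a class in Hochschild homology, becomes a boundary under `r`. The component in `B` is
then adjusted by a column 0 cycle, which the shift does not see. -/
theorem exists_cycle_of_shift {n : ℕ} (u : Z.cyclicComplex.X n)
    (hu : (Z.cyclicComplex.d n (n - 1)).hom u = 0) (v : B.X (n + 2))
    (hv : (B.d (n + 2) (n + 1)).hom v = 0) :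
    ∃ x : Z.cyclicComplex.X (n + 2), (Z.cyclicComplex.d (n + 2) (n + 1)).hom x = 0 ∧
      (Z.shift n).hom x = u ∧
      ∃ w : B.X (n + 3), (B.d (n + 3) (n + 2)).hom w = (r.f (n + 2)).hom x - v := by
  let u' := (Z.unshift n).hom u
  have hu' : (Z.shift n).hom u' = u := hom_apply_of_eq (Z.unshift_shift n) u
  -- The lift `u'` need not be a cycle, but its boundary shifts to the boundary of `u`, which is
  -- zero, and so lies in columns 0 and 1. For `n = 0` it has total degree 1, where no other columns
  -- exist.
  obtain ⟨x₀, x₁, e⟩ : ∃ (x₀ : Z.X (n + 1)) (x₁ : Z.X n),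
      (Z.cyclicComplex.d (n + 2) (n + 1)).hom u' =
        (Z.inj 0 (n + 1) (n + 1) (by omega)).hom x₀ + (Z.inj 1 n (n + 1) (by omega)).hom x₁ := by
    rcases n with _ | n
    · exact ⟨_, _, hom_apply_of_eq Z.id_cyclicComplex_one _⟩
    · refine ⟨_, _, Z.eq_inj_zero_add_inj_one _ ?_⟩
      refine (hom_apply_of_eq (Z.d_shift n) u').trans ?_
      exact (congrArg _ hu').trans hu
  obtain ⟨z, a, h⟩ := Z.exists_eq_d_add_inj_zero n x₀ x₁ (by rw [← e, d_apply_d])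
  let z' := (Z.inj 1 (n + 1) (n + 2) (by omega)).hom z
  have h' : (Z.cyclicComplex.d (n + 2) (n + 1)).hom (u' - z') =
      (Z.inj 0 (n + 1) (n + 1) (by omega)).hom a := by
    rw [map_sub, e, h, add_sub_cancel_left]
  -- The connecting map vanishes here: `a` is a total boundary, so `r` sends it to a boundary in
  -- `B`, and therefore it already bounds within column 0.
  obtain ⟨a', ha'⟩ := exists_b_eq r a (by rw [← h']; exact d_apply_d _ _ _ _ _)
    ((r.f (n + 2)).hom (u' - z')) (by rw [comm_apply, h'])
  let u'' := u' - z' - (Z.inj 0 (n + 2) (n + 2) (by omega)).hom a'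
  have hd : (Z.cyclicComplex.d (n + 2) (n + 1)).hom u'' = 0 := by
    rw [map_sub, h', ha', sub_self]
  have hz (c : Z.X (n + 2)) :
      (Z.shift n).hom ((Z.inj 0 (n + 2) (n + 2) (by omega)).hom c) = 0 :=
    hom_apply_of_eq (Z.inj_zero_shift (n + 2) n (by omega)) c
  have hs : (Z.shift n).hom u'' = u := by
    rw [map_sub, map_sub, hu', hz, sub_zero, sub_eq_self]
    exact hom_apply_of_eq (Z.inj_one_shift (n + 1) n (by omega)) z
  -- The error between the prescribed class `v` and the image of `u''` is represented, up to a
  -- boundary, by a Hochschild cycle `c`.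
  obtain ⟨c, w, hc, hw⟩ := exists_cycle_of_quasiIso (Z.ofHochschild ≫ r) (n := n + 2)
    (v - (r.f (n + 2)).hom u'') (by
      rw [map_sub]
      erw [comm_apply r (n + 2) (n + 1) u'', hd, hv]
      simp)
  refine ⟨u'' + (Z.inj 0 (n + 2) (n + 2) (by omega)).hom c, ?_, ?_, w, ?_⟩
  · rw [map_add, hd, zero_add]
    refine (comm_apply Z.ofHochschild (n + 2) (n + 1) c).trans ?_
    exact (congrArg _ hc).trans (map_zero _)
  · rw [map_add, hs]
    exact (congrArg (u + ·) (hz c)).trans (add_zero u)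
  · rw [hw, map_add]
    change (r.f (n + 2)).hom ((Z.inj 0 (n + 2) (n + 2) _).hom c) - _ = _
    abel

/-- Cyclic homology splits off the homology of `B`. -/
def homologyEquivProd (n : ℕ) : Z.cyclicComplex.homology (n + 2) ≃ₗ[k]
    Z.cyclicComplex.homology n × B.homology (n + 2) :=
  homologyEquivOfSurjective
    ((homologyClass Z.cyclicComplex n ∘ₗ cyclesShift n).prod
      (homologyClass B (n + 2) ∘ₗ cyclesHom r (n + 2)))
    (fun h ↦ by
      obtain ⟨u, hu⟩ := homologyClass_surjective Z.cyclicComplex n h.1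
      obtain ⟨v, hv⟩ := homologyClass_surjective B (n + 2) h.2
      obtain ⟨x, hx, hs, w, hw⟩ := exists_cycle_of_shift r u.1 u.2 v.1 v.2
      refine ⟨⟨x, hx⟩, Prod.ext ?_ ?_⟩
      · rw [← hu]
        exact congrArg (homologyClass Z.cyclicComplex n)
          (Subtype.ext hs : cyclesShift n ⟨x, hx⟩ = u)
      · rw [← hv]
        refine sub_eq_zero.1 ((map_sub (homologyClass B (n + 2)) _ _).symm.trans ?_)
        rw [homologyClass_eq_zero_iff]
        exact ⟨w, hw⟩)
    fun x ↦ by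
      rw [Prod.ext_iff]
      change homologyClass Z.cyclicComplex n (cyclesShift n x) = 0 ∧
        homologyClass B (n + 2) (cyclesHom r (n + 2) x) = 0 ↔ _
      rw [homologyClass_eq_zero_iff, homologyClass_eq_zero_iff]
      constructor
      · rintro ⟨⟨u, hu⟩, w, hw⟩
        exact exists_d_eq_of_shift r x.1 x.2 u hu w hw
      · rintro ⟨y, hy⟩
        refine ⟨⟨(Z.shift (n + 1)).hom y, ?_⟩, (r.f (n + 3)).hom y, ?_⟩
        · refine (hom_apply_of_eq (Z.d_shift n) y).symm.trans ?_
          exact congrArg (Z.shift n).hom hy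
        · rw [comm_apply, hy]
          rfl

/-- A family indexed by the `i` with `2 * i ≤ n` and `n ≤ 1` has a single member. -/
def piEquivOfLeOne (V : ℕ → ModuleCat.{u} k) {n : ℕ} (hn : n ≤ 1) :
    V n ≃ₗ[k] ∀ i : {i : ℕ // 2 * i ≤ n}, V (n - 2 * i) where
  toFun x := fun
    | ⟨0, _⟩ => x
    | ⟨i + 1, h⟩ => absurd h (by omega)
  map_add' x y := by
    ext ⟨i, h⟩
    obtain rfl : i = 0 := by omega
    rfl
  map_smul' c x := by
    ext ⟨i, h⟩
    obtain rfl : i = 0 := by omega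
    rfl
  invFun f := f ⟨0, n.zero_le⟩
  left_inv x := rfl
  right_inv f := by
    ext ⟨i, h⟩
    obtain rfl : i = 0 := by omega
    rfl

theorem eqToHom_hom_eqToHom_hom {X Y : ModuleCat.{u} k} (h : X = Y) (h' : Y = X) (x : X) :
    (eqToHom h').hom ((eqToHom h).hom x) = x := by
  subst h
  rfl

/-- Splitting off the member with index `0` of a family indexed by the `i` with
`2 * i ≤ n + 2`. -/
def prodPiEquiv (V : ℕ → ModuleCat.{u} k) (n : ℕ) :
    ((∀ i : {i : ℕ // 2 * i ≤ n}, V (n - 2 * i)) × V (n + 2)) ≃ₗ[k]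
      ∀ i : {i : ℕ // 2 * i ≤ n + 2}, V (n + 2 - 2 * i) where
  toFun x := fun
    | ⟨0, _⟩ => x.2
    | ⟨i + 1, h⟩ => (eqToHom (congrArg V
        (by omega : n - 2 * i = n + 2 - 2 * (i + 1)))).hom (x.1 ⟨i, by omega⟩)
  map_add' x y := by
    ext ⟨i, h⟩
    rcases i with _ | i
    · rfl
    · exact map_add (ModuleCat.Hom.hom _) _ _
  map_smul' c x := by
    ext ⟨i, h⟩
    rcases i with _ | i
    · rfl
    · exact map_smul (ModuleCat.Hom.hom _) _ _
  invFun f := (fun i ↦ (eqToHom (congrArg V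
      (by omega : n + 2 - 2 * (i.1 + 1) = n - 2 * i.1))).hom (f ⟨i + 1, by omega⟩),
    f ⟨0, Nat.zero_le _⟩)
  left_inv x := by
    refine Prod.ext ?_ rfl
    ext i
    exact eqToHom_hom_eqToHom_hom _ _ _
  right_inv f := by
    ext ⟨i, h⟩
    rcases i with _ | i
    · rfl
    · exact eqToHom_hom_eqToHom_hom _ _ _

/-- Each step of two peels off one factor of top degree. Both base cases are needed, and in them the
homology of `B` is the whole answer since columns from 2 on do not reach total degree 0 or 1. -/
theorem nonempty_homology_equiv_pi (r : Z.cyclicComplex ⟶ B) [QuasiIso (Z.ofHochschild ≫ r)]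
    (n : ℕ) : Nonempty (Z.cyclicComplex.homology n ≃ₗ[k]
    ∀ i : {i : ℕ // 2 * i ≤ n}, B.homology (n - 2 * i)) := by
  induction n using Nat.twoStepInduction with
  | zero => exact ⟨homologyEquivOfLeOne r zero_le_one ≪≫ₗ piEquivOfLeOne (B.homology ·) zero_le_one⟩
  | one => exact ⟨homologyEquivOfLeOne r le_rfl ≪≫ₗ piEquivOfLeOne (B.homology ·) le_rfl⟩
  | more n ih _ =>
    obtain ⟨e⟩ := ih
    exact ⟨homologyEquivProd r n ≪≫ₗ e.prodCongr (LinearEquiv.refl k _) ≪≫ₗ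
      prodPiEquiv (B.homology ·) n⟩

end CyclicObject

/-! ### Projective resolutions and the comparison theorem -/

section Resolution

variable {C : Type u} [Category.{v} C] [Abelian C]

/-- An exact augmented complex of projective objects as a projective resolution. -/
def resolutionOfExact (K : ChainComplex C ℕ) (hK : ∀ n, Projective (K.X n)) {Y : C}
    (ε : K.X 0 ⟶ Y) [Epi ε] (hε : K.d 1 0 ≫ ε = 0) (hex : (ShortComplex.mk _ _ hε).Exact)
    (hexact : ∀ n, (ShortComplex.mk _ _ (K.d_comp_d (n + 2) (n + 1) n)).Exact) :
    ProjectiveResolution Y where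
  complex := K
  projective := hK
  π := (ChainComplex.toSingle₀Equiv _ _).symm ⟨ε, hε⟩
  quasiIso := ⟨fun n ↦ by
    cases n
    -- In degree 0 the target has no differentials, so being a quasi-isomorphism there amounts to
    -- exactness at `K.X 0` together with `ε` being an epimorphism.
    · rw [ChainComplex.quasiIsoAt₀_iff, ShortComplex.quasiIso_iff_of_zeros']
      · refine (ShortComplex.exact_and_epi_g_iff_of_iso ?_).2 ⟨hex, by dsimp; infer_instance⟩
        exact ShortComplex.isoMk (Iso.refl _) (Iso.refl _) (Iso.refl _)
          (by simp; exact (Category.id_comp _).trans (Category.comp_id _).symm)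
          (by simp; exact (Category.id_comp _).trans (Category.comp_id _).symm)
      · exact K.shape _ _ (by simp)
      all_goals rfl
    · rename_i n
      rw [quasiIsoAt_iff_exactAt', HomologicalComplex.exactAt_iff' _ (n + 2) (n + 1) n (by simp)
        (by simp)]
      · exact hexact n
      · apply ChainComplex.exactAt_succ_single_obj⟩

/-- A morphism in degree `0`, compatible with the augmentation, extends to a morphism from a
complex of projective objects to a resolution. -/
def liftToResolution {Y : C} (R : ProjectiveResolution Y) (T : ChainComplex C ℕ)
    [∀ n, Projective (T.X n)] (f : T.X 0 ⟶ R.complex.X 0) (hf : T.d 1 0 ≫ f ≫ R.π.f 0 = 0) :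
    T ⟶ R.complex :=
  ChainComplex.mkHom _ _ f (R.exact₀.liftFromProjective (T.d 1 0 ≫ f) (by rw [Category.assoc]; exact hf))
    (R.exact₀.liftFromProjective_comp _ _)
    fun n ⟨g, g', w⟩ ↦ ⟨(R.exact_succ n).liftFromProjective (T.d (n + 2) (n + 1) ≫ g')
      (by simp [w]), (R.exact_succ n).liftFromProjective_comp _ _⟩

theorem liftToResolution_f_zero {Y : C} (R : ProjectiveResolution Y) (T : ChainComplex C ℕ)
    [∀ n, Projective (T.X n)] (f : T.X 0 ⟶ R.complex.X 0) (hf : T.d 1 0 ≫ f ≫ R.π.f 0 = 0) :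
    (liftToResolution R T f hf).f 0 = f :=
  ChainComplex.mkHom_f_0 _ _ _ _ _ _

/-- An endomorphism of a resolution that is the identity in degree `0` is homotopic to the
identity. -/
def homotopyIdOfZero {Y : C} (R : ProjectiveResolution Y) (f : R.complex ⟶ R.complex)
    (hf : f.f 0 = 𝟙 _) : Homotopy f (𝟙 R.complex) :=
  -- Both maps lift the identity of `Y`: the augmentation takes values in a complex concentrated in
  -- degree 0, so only the degree 0 component of `f` matters.
  ProjectiveResolution.liftHomotopy (𝟙 Y) _ _ (by
    ext
    rw [HomologicalComplex.comp_f, HomologicalComplex.comp_f, hf]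
    exact (Category.id_comp _).trans ((congrArg (R.π.f 0 ≫ ·) (HomologicalComplex.congr_hom
      (CategoryTheory.Functor.map_id _ Y) 0)).trans (Category.comp_id _)).symm) (by simp)

end Resolution

/-! ### Retraction onto column 0 and its transport along an additive functor -/

namespace CyclicObject

section Retraction

variable {C : Type u} [Category.{v} C] [Preadditive C] (P : CyclicObject C)
  [P.tsygan.HasTotal (ComplexShape.down ℕ)]

/-- A total object is a sum of the entries `P.X q`, so a lift is assembled from lifts on the
summands. Projectivity is what allows a map out of the total complex to be built by the comparison
theorem. -/
instance projective_cyclicComplex_X [∀ n, Projective (P.X n)] (n : ℕ) :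
    Projective (P.cyclicComplex.X n) where
  factors f e _ := ⟨P.desc fun p q h ↦ Projective.factorThru (P.inj p q n h ≫ f) e,
    P.cyclicComplex_hom_ext fun p q h ↦ by simp⟩

/-- Two entries have total degree 1. From column 0 the differential is `b`, killed by `ε`; from
column 1 it is `1 - T`, which is zero in row 0 because the cyclic operator there is the identity. So
the augmentation of column 0 also augments the total complex. -/
theorem d_projZero_comp {Y : C} (ε : P.X 0 ⟶ Y) (hε : P.b 0 ≫ ε = 0) :
    P.cyclicComplex.d 1 0 ≫ P.projZero 0 ≫ ε = 0 := by
  refine P.cyclicComplex_hom_ext fun p q h ↦ ?_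
  rw [Limits.comp_zero]
  rcases p with _ | p
  · obtain rfl : q = 1 := by omega
    rw [P.inj_zero_succ_d_assoc 0 0 h rfl, inj_zero_projZero_assoc, hε]
  · obtain rfl : p = 0 := by omega
    obtain rfl : q = 0 := by omega
    have ht : P.t 0 = 𝟙 _ := by simpa [iter] using P.iter_t 0
    rw [P.inj_succ_zero_d_assoc 0 0 h rfl, hor, T, ht]
    simp

end Retraction

section Transport

variable {C : Type u} [Category.{v} C] [Preadditive C] {k : Type w} [CommRing k]
  {P : CyclicObject C} {Z : CyclicObject (ModuleCat.{w} k)} (F : C ⥤ ModuleCat.{w} k) [F.Additive]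
  (e : ∀ n, F.obj (P.X n) ≅ Z.X n)
  (hδ : ∀ (n : ℕ) (i : Fin (n + 2)), F.map (P.δ i) ≫ (e n).hom = (e (n + 1)).hom ≫ Z.δ i)
  (ht : ∀ n : ℕ, F.map (P.t n) ≫ (e n).hom = (e n).hom ≫ Z.t n)

include hδ in
theorem map_b_comp (n : ℕ) : F.map (P.b n) ≫ (e n).hom = (e (n + 1)).hom ≫ Z.b n := by
  simp [b, F.map_sum, F.map_zsmul, Preadditive.sum_comp, Preadditive.comp_sum, hδ]

include hδ in
theorem map_b'_comp (n : ℕ) : F.map (P.b' n) ≫ (e n).hom = (e (n + 1)).hom ≫ Z.b' n := by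
  simp [b', F.map_sum, F.map_zsmul, Preadditive.sum_comp, Preadditive.comp_sum, hδ]

include ht in
theorem map_T_comp (n : ℕ) : F.map (P.T n) ≫ (e n).hom = (e n).hom ≫ Z.T n := by
  simp [T, F.map_zsmul, ht]

include ht in
theorem map_N_comp (n : ℕ) : F.map (P.N n) ≫ (e n).hom = (e n).hom ≫ Z.N n := by
  have h (i : ℕ) : F.map (iter (P.T n) i) ≫ (e n).hom = (e n).hom ≫ iter (Z.T n) i := by
    induction i with
    | zero => simp [iter]
    | succ i ih =>
      rw [iter, F.map_comp, Category.assoc, map_T_comp F e ht, ← Category.assoc, ih,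
        Category.assoc, iter]
  simp [N, F.map_sum, Preadditive.sum_comp, Preadditive.comp_sum, h]

include hδ in
theorem map_vert_comp : ∀ p n : ℕ, F.map (P.vert p n) ≫ (e n).hom = (e (n + 1)).hom ≫ Z.vert p n
  | 0, n => map_b_comp F e hδ n
  | 1, n => map_b'_comp F e hδ n
  | p + 2, n => map_vert_comp p n

include ht in
theorem map_hor_comp : ∀ p n : ℕ, F.map (P.hor p n) ≫ (e n).hom = (e n).hom ≫ Z.hor p n
  | 0, n => by
    rw [hor, hor, F.map_sub, F.map_id, Preadditive.sub_comp, Preadditive.comp_sub,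
      map_T_comp F e ht, Category.id_comp, Category.comp_id]
  | 1, n => map_N_comp F e ht n
  | p + 2, n => map_hor_comp p n

include hδ in
theorem inv_comp_map_vert (p n : ℕ) :
    (e (n + 1)).inv ≫ F.map (P.vert p n) = Z.vert p n ≫ (e n).inv := by
  rw [Iso.inv_comp_eq, ← Category.assoc, ← map_vert_comp F e hδ, Category.assoc, Iso.hom_inv_id,
    Category.comp_id]

include ht in
theorem inv_comp_map_hor (p n : ℕ) :
    (e n).inv ≫ F.map (P.hor p n) = Z.hor p n ≫ (e n).inv := by
  rw [Iso.inv_comp_eq, ← Category.assoc, ← map_hor_comp F e ht, Category.assoc, Iso.hom_inv_id,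
    Category.comp_id]

variable [P.tsygan.HasTotal (ComplexShape.down ℕ)]

/-- The components of the image under an additive functor of a morphism out of the total Tsygan
complex. -/
def mapComponent {B : ChainComplex C ℕ} (r : P.cyclicComplex ⟶ B) (p q n : ℕ) (h : p + q = n) :
    Z.X q ⟶ F.obj (B.X n) :=
  (e q).inv ≫ F.map (P.inj p q n h ≫ r.f n)

omit [F.Additive] in
theorem mapComponent_comp {B : ChainComplex C ℕ} (r : P.cyclicComplex ⟶ B) (p q n : ℕ)
    (h : p + q = n + 1) : mapComponent F e r p q (n + 1) h ≫ F.map (B.d (n + 1) n) =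
      (e q).inv ≫ F.map (P.inj p q (n + 1) h ≫ P.cyclicComplex.d (n + 1) n ≫ r.f n) := by
  rw [mapComponent, Category.assoc, ← F.map_comp, Category.assoc, r.comm]

include hδ ht in
-- This and the next two lemmas are the compatibilities required by `descHom`. Transporting `r` one
-- summand at a time avoids identifying the image of the total complex under `F` with the total
-- complex of `Z`.
theorem mapComponent_succ_succ {B : ChainComplex C ℕ} (r : P.cyclicComplex ⟶ B) (p q n : ℕ)
    (h : p + 1 + (q + 1) = n + 1) (h₁ : p + (q + 1) = n) (h₂ : p + 1 + q = n) :
    mapComponent F e r (p + 1) (q + 1) (n + 1) h ≫ F.map (B.d (n + 1) n) =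
      Z.hor p (q + 1) ≫ mapComponent F e r p (q + 1) n h₁ +
        (-1 : ℤ) ^ (p + 1) • (Z.vert (p + 1) q ≫ mapComponent F e r (p + 1) q n h₂) := by
  rw [mapComponent_comp, P.inj_succ_succ_d_assoc p q n h h₁ h₂]
  simp only [Preadditive.add_comp, Preadditive.zsmul_comp, Category.assoc, F.map_add,
    F.map_zsmul, Preadditive.comp_add, Preadditive.comp_zsmul]
  rw [F.map_comp (P.hor _ _), F.map_comp (P.vert _ _), ← Category.assoc,
    inv_comp_map_hor F e ht, ← Category.assoc (e _).inv (F.map (P.vert _ _)),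
    inv_comp_map_vert F e hδ, Category.assoc, Category.assoc]
  rfl

include hδ in
theorem mapComponent_zero_succ {B : ChainComplex C ℕ} (r : P.cyclicComplex ⟶ B) (q n : ℕ)
    (h : 0 + (q + 1) = n + 1) (h₁ : 0 + q = n) :
    mapComponent F e r 0 (q + 1) (n + 1) h ≫ F.map (B.d (n + 1) n) =
      Z.b q ≫ mapComponent F e r 0 q n h₁ := by
  rw [mapComponent_comp, P.inj_zero_succ_d_assoc q n h h₁, F.map_comp (P.b q), ← Category.assoc]
  exact (congrArg (· ≫ _) (inv_comp_map_vert F e hδ 0 q)).trans (Category.assoc _ _ _)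

include ht in
theorem mapComponent_succ_zero {B : ChainComplex C ℕ} (r : P.cyclicComplex ⟶ B) (p n : ℕ)
    (h : p + 1 + 0 = n + 1) (h₁ : p + 0 = n) :
    mapComponent F e r (p + 1) 0 (n + 1) h ≫ F.map (B.d (n + 1) n) =
      Z.hor p 0 ≫ mapComponent F e r p 0 n h₁ := by
  rw [mapComponent_comp, P.inj_succ_zero_d_assoc p n h h₁, F.map_comp (P.hor p 0),
    ← Category.assoc, inv_comp_map_hor F e ht, Category.assoc]
  rfl

/-- The image under an additive functor of a morphism out of the total Tsygan complex. -/
def mapRetraction {B : ChainComplex C ℕ} (r : P.cyclicComplex ⟶ B) :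
    Z.cyclicComplex ⟶ (F.mapHomologicalComplex _).obj B :=
  Z.descHom _ (mapComponent F e r) (mapComponent_succ_succ F e hδ ht r)
    (mapComponent_zero_succ F e hδ r) (mapComponent_succ_zero F e ht r)

/-- The Hochschild complexes of cyclic objects corresponding to each other under `F`. -/
def hochschildIso : Z.hochschild ≅ (F.mapHomologicalComplex _).obj P.hochschild :=
  HomologicalComplex.Hom.isoOfComponents (fun n ↦ (e n).symm) (by
    rintro _ n rfl
    rw [hochschild_d, Functor.mapHomologicalComplex_obj_d, hochschild_d]
    exact inv_comp_map_vert F e hδ 0 n)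

/-- An additive functor preserves homotopies but not quasi-isomorphisms in general, so the
hypothesis on `r` has to be a homotopy. Up to the isomorphism of Hochschild complexes the map is the
image of one homotopic to the identity. -/
theorem quasiIso_mapRetraction (r : P.cyclicComplex ⟶ P.hochschild)
    (h : Homotopy (P.ofHochschild ≫ r) (𝟙 P.hochschild)) :
    QuasiIso (Z.ofHochschild ≫ mapRetraction F e hδ ht r) := by
  have h1 : Z.ofHochschild ≫ mapRetraction F e hδ ht r =
      (hochschildIso F e hδ).hom ≫ (F.mapHomologicalComplex _).map (P.ofHochschild ≫ r) := by
    ext1 n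
    exact Z.inj_desc _ 0 n (zero_add n)
  have h2 : QuasiIso ((F.mapHomologicalComplex (ComplexShape.down ℕ)).map (P.ofHochschild ≫ r)) := by
    refine ⟨fun n ↦ ?_⟩
    rw [quasiIsoAt_iff_isIso_homologyMap, (F.mapHomotopy h).homologyMap_eq n,
      CategoryTheory.Functor.map_id, HomologicalComplex.homologyMap_id]
    infer_instance
  rw [h1]
  infer_instance

end Transport

end CyclicObject

/-! ### Tensor powers with the diagonal action are induced modules -/

section Hopf

variable {k H : Type u} [CommRing k] [Ring H] [HopfAlgebra k H]

theorem op_smul_def {n : ℕ} (a : Hᵐᵒᵖ) (x : TPow k H n) : a • x = x * iterComul n a.unop := rfl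

theorem snoc_mul_snoc {n : ℕ} (a b : H) (x y : TPow k H n) :
    snoc a x * snoc b y = snoc (a * b) (x * y) := by
  have h : (LinearMap.mul k (TPow k H (n + 1))).compl₁₂ (snoc a) (snoc b) =
      (LinearMap.mul k (TPow k H n)).compr₂ (snoc (a * b)) := by
    refine ptensor_ext fun x ↦ ptensor_ext fun y ↦ ?_
    simp only [LinearMap.compl₁₂_apply, LinearMap.compr₂_apply, LinearMap.mul_apply', snoc_ptensor,
      ptensor_mul_ptensor]
    congr 1
    ext i
    refine Fin.lastCases ?_ (fun i ↦ ?_) i <;> simp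
  exact LinearMap.congr_fun (LinearMap.congr_fun h x) y

/-- The linear map on `H^{⊗(n+1)}` defined by a bilinear map on `H` and `H^{⊗n}`. -/
def snocLift {n : ℕ} {V : Type*} [AddCommGroup V] [Module k V]
    (g : H →ₗ[k] TPow k H n →ₗ[k] V) : TPow k H (n + 1) →ₗ[k] V :=
  tpowLift (LinearMap.uncurryMid (Fin.last n)
    { toFun := fun a ↦ (g a).compMultilinearMap ptensor
      map_add' := fun a b ↦ by ext; simp
      map_smul' := fun c a ↦ by ext; simp })

theorem snocLift_snoc {n : ℕ} {V : Type*} [AddCommGroup V] [Module k V]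
    (g : H →ₗ[k] TPow k H n →ₗ[k] V) (a : H) (x : TPow k H n) : snocLift g (snoc a x) = g a x := by
  revert x
  refine LinearMap.congr_fun (f := snocLift g ∘ₗ snoc a) (ptensor_ext fun x ↦ ?_)
  simp [snocLift]

/-- `op a ⊗ x ↦ (x, 1) a`. -/
def ofFree (n : ℕ) : Hᵐᵒᵖ ⊗[k] TPow k H n →ₗ[k] TPow k H (n + 1) :=
  TensorProduct.lift (((LinearMap.mul k (TPow k H (n + 1))).flip.compl₂ (snoc 1)) ∘ₗ
    iterComul (n + 1) ∘ₗ (MulOpposite.opLinearEquiv k).symm.toLinearMap)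

theorem ofFree_tmul (n : ℕ) (a : Hᵐᵒᵖ) (x : TPow k H n) :
    ofFree n (a ⊗ₜ x) = snoc 1 x * iterComul (n + 1) a.unop := rfl

/-- `a ⊗ b ↦ (x ↦ op b ⊗ x S(a))`. -/
def antipodeTwist (n : ℕ) : H ⊗[k] H →ₗ[k] TPow k H n →ₗ[k] Hᵐᵒᵖ ⊗[k] TPow k H n :=
  TensorProduct.lift (LinearMap.mk₂ k
    (fun a b ↦ TensorProduct.mk k Hᵐᵒᵖ (TPow k H n) (MulOpposite.op b) ∘ₗ
      LinearMap.mulRight k (iterComul n (HopfAlgebra.antipode k a)))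
    (fun a a' b ↦ by ext; simp [mul_add, TensorProduct.tmul_add])
    (fun c a b ↦ by ext; simp)
    (fun a b b' ↦ by ext; simp)
    (fun c a b ↦ by ext; simp [TensorProduct.smul_tmul']))

/-- `(x, h) ↦ ∑ op h₍₂₎ ⊗ x S(h₍₁₎)`. -/
def toFree (n : ℕ) : TPow k H (n + 1) →ₗ[k] Hᵐᵒᵖ ⊗[k] TPow k H n :=
  snocLift (antipodeTwist n ∘ₗ Coalgebra.comul)

theorem toFree_snoc (n : ℕ) {h : H} (x : TPow k H n) {ι : Type u} (r : Coalgebra.Repr k h ι) :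
    toFree n (snoc h x) = ∑ i ∈ r.index, MulOpposite.op (r.right i) ⊗ₜ
      (x * iterComul n (HopfAlgebra.antipode k (r.left i))) := by
  rw [toFree, snocLift_snoc, LinearMap.comp_apply, ← r.eq, map_sum, LinearMap.sum_apply]
  rfl

theorem snoc_one_mul_iterComul (n : ℕ) {h : H} (x : TPow k H n) {ι : Type u}
    (r : Coalgebra.Repr k h ι) : snoc 1 x * iterComul (n + 1) h =
      ∑ i ∈ r.index, snoc (r.right i) (x * iterComul n (r.left i)) := by
  simp only [iterComul_succ_repr' n r, Finset.mul_sum, snoc_mul_snoc, one_mul]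

/-- In Sweedler notation `(x, h)` goes to `∑ (x S(h₍₁₎) h₍₂₎, h₍₃₎)`, where `H` acts diagonally on
`x`; coassociativity brings `S(h₍₁₎) h₍₂₎` together and the antipode axiom collapses it. -/
theorem ofFree_toFree (n : ℕ) (y : TPow k H (n + 1)) : ofFree n (toFree n y) = y := by
  revert y
  refine LinearMap.congr_fun (f := ofFree n ∘ₗ toFree n) (g := LinearMap.id)
    (snoc_ext fun h x ↦ ?_)
  let r := Coalgebra.Repr.arbitrary k h
  let r₁ (i) := Coalgebra.Repr.arbitrary k (r.left i)
  let r₂ (i) := Coalgebra.Repr.arbitrary k (r.right i)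
  have := coassoc_sum (k := k)
    (fun a b c : H ↦ snoc c (x * iterComul (k := k) n (HopfAlgebra.antipode k a * b)))
    (fun b c ↦ ⟨by simp [mul_add, add_mul], by simp⟩) (fun b c ↦ ⟨by simp [mul_add], by simp⟩)
    (fun b c ↦ ⟨by simp, by simp⟩) r r₁ r₂
  rw [LinearMap.comp_apply, LinearMap.id_apply, toFree_snoc n x r, map_sum]
  calc _ = _ := Finset.sum_congr rfl fun i _ ↦ by
        rw [ofFree_tmul, MulOpposite.unop_op, snoc_one_mul_iterComul n _ (r₂ i)]
        simp only [mul_assoc, ← iterComul_mul]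
    _ = _ := this.symm
    _ = ∑ i ∈ r.index, Coalgebra.counit (R := k) (r.left i) • snoc (r.right i) x :=
      Finset.sum_congr rfl fun i _ ↦ by
        rw [← map_sum, ← Finset.mul_sum, ← map_sum, HopfAlgebra.sum_antipode_mul_eq_smul,
          map_smul, iterComul_one, mul_smul_comm, mul_one, map_smul]
    _ = snoc h x := by
        conv_rhs => rw [← Coalgebra.sum_counit_smul r]
        simp only [map_sum, map_smul, LinearMap.sum_apply, LinearMap.smul_apply]

/-- The other antipode axiom: the composite is `∑ op h₍₃₎ ⊗ x h₍₁₎ S(h₍₂₎)`. -/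
theorem toFree_ofFree (n : ℕ) (w : Hᵐᵒᵖ ⊗[k] TPow k H n) : toFree n (ofFree n w) = w := by
  revert w
  refine LinearMap.congr_fun (f := toFree n ∘ₗ ofFree n) (g := LinearMap.id)
    (TensorProduct.ext' fun h x ↦ ?_)
  let r := Coalgebra.Repr.arbitrary k h.unop
  let r₁ (i) := Coalgebra.Repr.arbitrary k (r.left i)
  let r₂ (i) := Coalgebra.Repr.arbitrary k (r.right i)
  have := coassoc_sum (k := k)
    (fun a b c : H ↦ MulOpposite.op c ⊗ₜ[k]
      (x * iterComul (k := k) n (a * HopfAlgebra.antipode k b)))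
    (fun b c ↦ ⟨by simp [mul_add, add_mul, TensorProduct.tmul_add], by simp⟩)
    (fun b c ↦ ⟨by simp [mul_add, TensorProduct.tmul_add], by simp⟩)
    (fun b c ↦ ⟨by simp [TensorProduct.add_tmul], by simp [TensorProduct.smul_tmul']⟩) r r₁ r₂
  rw [LinearMap.comp_apply, LinearMap.id_apply, ofFree_tmul, snoc_one_mul_iterComul n x r, map_sum]
  calc _ = _ := Finset.sum_congr rfl fun i _ ↦ by
        rw [toFree_snoc n _ (r₂ i)]
        simp only [mul_assoc, ← iterComul_mul]
    _ = _ := this.symm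
    _ = ∑ i ∈ r.index, Coalgebra.counit (R := k) (r.left i) • MulOpposite.op (r.right i) ⊗ₜ[k] x :=
      Finset.sum_congr rfl fun i _ ↦ by
        rw [← TensorProduct.tmul_sum, ← Finset.mul_sum, ← map_sum,
          HopfAlgebra.sum_mul_antipode_eq_smul,
          map_smul, iterComul_one, mul_smul_comm, mul_one, TensorProduct.tmul_smul]
    _ = h ⊗ₜ x := by
        have hr := congrArg (MulOpposite.opLinearEquiv k) (Coalgebra.sum_counit_smul r)
        simp only [map_sum, map_smul, MulOpposite.coe_opLinearEquiv, MulOpposite.op_unop] at hr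
        conv_rhs => rw [← hr]
        simp only [TensorProduct.sum_tmul, TensorProduct.smul_tmul']

/-- Tensor powers with the diagonal action are induced modules. -/
def freeEquiv (n : ℕ) : (Hᵐᵒᵖ ⊗[k] TPow k H n) ≃ₗ[Hᵐᵒᵖ] TPow k H (n + 1) where
  toFun := ofFree n
  map_add' := map_add _
  map_smul' b w := by
    induction w with
    | zero => simp
    | add u v hu hv => simp only [smul_add, map_add, hu, hv]
    | tmul a x =>
      rw [TensorProduct.smul_tmul', ofFree_tmul, ofFree_tmul, RingHom.id_apply, op_smul_def,
        smul_eq_mul, MulOpposite.unop_mul, iterComul_mul, mul_assoc]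
  invFun := toFree n
  left_inv := toFree_ofFree n
  right_inv := ofFree_toFree n

end Hopf

/-- Over a field every vector space is projective, hence so is the module induced from `H^{⊗n}`. At
least one tensor factor is required: the empty power is `k` with `H` acting through the counit. -/
theorem projective_tpow {k H : Type u} [Field k] [Ring H] [HopfAlgebra k H] (n : ℕ) :
    Module.Projective Hᵐᵒᵖ (TPow k H (n + 1)) :=
  Module.Projective.of_equiv (freeEquiv n)

/-! ### The cyclic right `H`-module of tensor powers as a resolution of `k` -/

section RightCyclic

variable (k H : Type u) [CommRing k] [Ring H] [HopfAlgebra k H]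

/-- The face map as a map of right `H`-modules. -/
def faceRight {n : ℕ} (i : Fin (n + 2)) : TPow k H (n + 2) →ₗ[Hᵐᵒᵖ] TPow k H (n + 1) where
  toFun := face i
  map_add' := map_add _
  map_smul' a x := by simp only [op_smul_def, face_mul, face_iterComul, RingHom.id_apply]

/-- The degeneracy map as a map of right `H`-modules. -/
def degenRight {n : ℕ} (i : Fin (n + 1)) : TPow k H (n + 1) →ₗ[Hᵐᵒᵖ] TPow k H (n + 2) where
  toFun := degen i
  map_add' := map_add _
  map_smul' a x := by simp only [op_smul_def, degen_mul, degen_iterComul, RingHom.id_apply]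

variable {k H} in
-- Rotation exchanges the two legs of the first coproduct before the iterated coproduct is applied,
-- and cocommutativity says that this exchange changes nothing. As `rot` is multiplicative, it
-- becomes linear for the diagonal action.
theorem rot_iterComul_of_isCocomm [Coalgebra.IsCocomm k H] (n : ℕ) (h : H) :
    rot (n + 1) (iterComul (k := k) (n + 1) h) = iterComul (n + 1) h := by
  let r := Coalgebra.Repr.arbitrary k h
  have h2 := congrArg (iterAux (k := k) n ∘ₗ (TensorProduct.comm k H H).toLinearMap) r.eq
  rw [rot_iterComul n r, iterComul_succ, ← Coalgebra.comm_comul k h]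
  refine Eq.trans ?_ h2
  simp

variable [Coalgebra.IsCocomm k H]

/-- The cyclic rotation as a map of right `H`-modules. -/
def rotRight (n : ℕ) : TPow k H (n + 1) →ₗ[Hᵐᵒᵖ] TPow k H (n + 1) where
  toFun := rot (n + 1)
  map_add' := map_add _
  map_smul' a x := by
    simp only [op_smul_def, rot_mul, rot_iterComul_of_isCocomm, RingHom.id_apply]

/-- The tensor powers `H^{⊗(*+1)}` as a cyclic object of right `H`-modules. -/
def rightCyclic : CyclicObject (ModuleCat.{u} Hᵐᵒᵖ) where
  X n := ModuleCat.of Hᵐᵒᵖ (TPow k H (n + 1))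
  δ i := ModuleCat.ofHom (faceRight k H i)
  σ i := ModuleCat.ofHom (degenRight k H i)
  t n := ModuleCat.ofHom (rotRight k H n)
  δ_comp_δ h := ModuleCat.hom_ext <|
    LinearMap.ext fun x ↦ LinearMap.congr_fun (face_face (k := k) h) x
  δ_comp_σ_of_le h := ModuleCat.hom_ext <|
    LinearMap.ext fun x ↦ LinearMap.congr_fun (face_degen_of_le (k := k) h) x
  δ_comp_σ_self i := ModuleCat.hom_ext <|
    LinearMap.ext fun x ↦ LinearMap.congr_fun (face_degen_self (k := k) i) x
  δ_comp_σ_succ i := ModuleCat.hom_ext <|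
    LinearMap.ext fun x ↦ LinearMap.congr_fun (face_degen_succ (k := k) i) x
  δ_comp_σ_of_gt h := ModuleCat.hom_ext <|
    LinearMap.ext fun x ↦ LinearMap.congr_fun (face_degen_of_gt (k := k) h) x
  σ_comp_σ h := ModuleCat.hom_ext <|
    LinearMap.ext fun x ↦ LinearMap.congr_fun (degen_degen (k := k) h) x
  t_comp_δ_zero n := ModuleCat.hom_ext <| LinearMap.ext (face_zero_rot (k := k))
  t_comp_δ_succ i := ModuleCat.hom_ext <| LinearMap.ext (face_succ_rot (k := k) i)
  t_comp_σ_zero n := ModuleCat.hom_ext <| LinearMap.ext (degen_zero_rot (k := k))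
  t_comp_σ_succ i := ModuleCat.hom_ext <| LinearMap.ext (degen_succ_rot (k := k) i)
  iter_t n := by
    have h (j : ℕ) (x : TPow k H (n + 1)) :
        (iter (ModuleCat.ofHom (rotRight k H n)) j).hom x = (rot (n + 1))^[j] x := by
      induction j with
      | zero => rfl
      | succ j ih => rw [Function.iterate_succ_apply', ← ih]; rfl
    exact ModuleCat.hom_ext <| LinearMap.ext fun x ↦ (h (n + 1) x).trans (rot_iterate (n + 1) x)

theorem neg_one_pow_zsmul {V : Type*} [AddCommGroup V] [Module k V] (i : ℕ) (v : V) :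
    (-1 : ℤ) ^ i • v = (-1 : k) ^ i • v := by
  rw [← Int.cast_smul_eq_zsmul k, Int.cast_pow, Int.cast_neg, Int.cast_one]

/-- The Hochschild differential `∑ᵢ (-1)ⁱ δᵢ` of the tensor powers. -/
def boundary (n : ℕ) : TPow k H (n + 2) →ₗ[k] TPow k H (n + 1) :=
  ∑ i : Fin (n + 2), (-1 : k) ^ (i : ℕ) • face i

/-- The contraction `cons 1` is provided only as a `k`-linear map, so exactness is checked on
elements with the `k`-linear form of the differential. -/
theorem rightCyclic_d_apply (n : ℕ) (x : TPow k H (n + 2)) :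
    ((rightCyclic k H).hochschild.d (n + 1) n).hom x = boundary k H n x := by
  have h : (show TPow k H (n + 2) →ₗ[Hᵐᵒᵖ] TPow k H (n + 1) from
      ((rightCyclic k H).hochschild.d (n + 1) n).hom) =
        ∑ i : Fin (n + 2), (-1 : ℤ) ^ (i : ℕ) • faceRight k H i := by
    rw [CyclicObject.hochschild_d]
    exact ModuleCat.hom_sum _ _
  refine (LinearMap.congr_fun h x).trans ?_
  rw [boundary, LinearMap.sum_apply, LinearMap.sum_apply]
  exact Finset.sum_congr rfl fun i _ ↦ neg_one_pow_zsmul k _ (face i x)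

omit [Coalgebra.IsCocomm k H] in
theorem boundary_zero_cons (x : TPow k H 1) :
    boundary k H 0 (cons 1 x) = x - cons 1 (face 0 x) := by
  rw [boundary, Fin.sum_univ_two, LinearMap.add_apply, LinearMap.smul_apply, LinearMap.smul_apply,
    face_zero_cons, show (1 : Fin 2) = Fin.succ 0 from rfl, face_succ_cons, sub_eq_add_neg,
    ← neg_one_smul k]
  simp

omit [Coalgebra.IsCocomm k H] in
-- Inserting `1` in front is a contracting homotopy: face 0 removes it again because `ε(1) = 1`, and
-- each later face acts behind it with its index raised by one, hence with the opposite sign.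
theorem boundary_succ_cons (n : ℕ) (x : TPow k H (n + 2)) :
    boundary k H (n + 1) (cons 1 x) = x - cons 1 (boundary k H n x) := by
  have h (v : TPow k H (n + 2)) : x - v = x + (-1 : k) • v := by
    rw [neg_one_smul, sub_eq_add_neg]
  rw [h, boundary, boundary, Fin.sum_univ_succ, LinearMap.add_apply, LinearMap.smul_apply,
    LinearMap.sum_apply, LinearMap.sum_apply, face_zero_cons, map_sum, Finset.smul_sum]
  congr 1
  · simp
  · refine Finset.sum_congr rfl fun i _ ↦ ?_
    rw [LinearMap.smul_apply, LinearMap.smul_apply, face_succ_cons, map_smul, smul_smul,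
      Fin.val_succ, pow_succ']

/-- The counit as a map of right `H`-modules onto the trivial module. -/
def augmentation : (rightCyclic k H).hochschild.X 0 ⟶ trivialRight k H :=
  letI : Module Hᵐᵒᵖ k := Module.compHom k
    ((Bialgebra.counitAlgHom k H).fromOpposite (fun _ _ ↦ Commute.all _ _)).toRingHom
  ModuleCat.ofHom (X := TPow k H 1) (Y := k)
    { toFun := fun x ↦ PiTensorProduct.isEmptyEquiv (Fin 0) (face (k := k) 0 x)
      map_add' := fun x y ↦ by simp only [map_add]
      map_smul' := fun a x ↦ by
        rw [op_smul_def, face_mul, face_iterComul, iterComul_zero, mul_smul_comm, mul_one, map_smul]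
        rfl }

theorem augmentation_apply (x : TPow k H 1) : (augmentation k H).hom x =
    PiTensorProduct.isEmptyEquiv (R := k) (s := fun _ : Fin 0 ↦ H) (Fin 0) (face (k := k) 0 x) := rfl

instance : Epi (augmentation k H) := by
  refine (ModuleCat.epi_iff_surjective _).2 fun c ↦ ?_
  refine ⟨cons 1 ((PiTensorProduct.isEmptyEquiv (R := k) (s := fun _ : Fin 0 ↦ H) (Fin 0)).symm c),
    (augmentation_apply k H _).trans ?_⟩
  rw [face_zero_cons, Bialgebra.counit_one, one_smul]
  exact LinearEquiv.apply_symm_apply _ _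

theorem d_augmentation : (rightCyclic k H).hochschild.d 1 0 ≫ augmentation k H = 0 := by
  refine ModuleCat.hom_ext <| LinearMap.ext fun x ↦
    (congrArg (augmentation k H).hom (rightCyclic_d_apply k H 0 x)).trans
      ((augmentation_apply k H _).trans ?_)
  -- The two faces of `boundary` become equal after applying the counit to the remaining factor, and
  -- they occur with opposite signs.
  have h (x : TPow k H 2) : face 0 (boundary k H 0 x) = 0 := by
    have h1 := LinearMap.congr_fun (face_face (k := k) (H := H) (le_refl (0 : Fin 1))) x
    rw [LinearMap.comp_apply, LinearMap.comp_apply] at h1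
    rw [boundary, Fin.sum_univ_two, LinearMap.add_apply, LinearMap.smul_apply,
      LinearMap.smul_apply, show (1 : Fin 2) = Fin.succ 0 from rfl, map_add, map_smul, map_smul,
      h1, Fin.castSucc_zero, ← add_smul]
    simp
  refine (congrArg _ (h x)).trans (map_zero _)

theorem boundary_zero_cons_of_augmentation (x : TPow k H 1) (hx : (augmentation k H).hom x = 0) :
    boundary k H 0 (cons 1 x) = x := by
  have h : face 0 x = 0 :=
    (LinearEquiv.map_eq_zero_iff _).1 ((augmentation_apply k H x).symm.trans hx)
  rw [boundary_zero_cons, h, map_zero, sub_zero]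

omit [Coalgebra.IsCocomm k H] in
theorem boundary_succ_cons_of_boundary (n : ℕ) (x : TPow k H (n + 2)) (hx : boundary k H n x = 0) :
    boundary k H (n + 1) (cons 1 x) = x := by
  rw [boundary_succ_cons, hx, map_zero, sub_zero]

/-- The resolution of the trivial right `H`-module by tensor powers. -/
def tensorResolution (k H : Type u) [Field k] [Ring H] [HopfAlgebra k H] [Coalgebra.IsCocomm k H] :
    ProjectiveResolution (trivialRight k H) :=
  resolutionOfExact (rightCyclic k H).hochschild
    (fun n ↦ (IsProjective.iff_projective _).1 (projective_tpow (k := k) (H := H) n))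
    (augmentation k H) (d_augmentation k H)
    ((ShortComplex.moduleCat_exact_iff _).2 fun x hx ↦ ⟨cons 1 (show TPow k H 1 from x),
      (rightCyclic_d_apply k H _ _).trans (boundary_zero_cons_of_augmentation k H x hx)⟩)
    (fun n ↦ (ShortComplex.moduleCat_exact_iff _).2 fun x hx ↦
      ⟨cons 1 (show TPow k H (n + 2) from x), (rightCyclic_d_apply k H _ _).trans
        (boundary_succ_cons_of_boundary k H n x ((rightCyclic_d_apply k H n x).symm.trans hx))⟩)

end RightCyclic

/-! ### Comparison of `Z_*(H, M)` with the tensor powers tensored over `H` with `M` -/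

section TensorIso

variable (k A : Type u) [CommRing k] [Ring A] [Algebra k A]
  (N : Type u) [AddCommGroup N] [Module k N] [Module A N]

/-- The value of the tensor functor at a module whose `k`-module structure comes with it. -/
def tensorIso (X : ModuleCat.{u} Aᵐᵒᵖ) {Y : Type u} [AddCommGroup Y] [Module k Y] [Module Aᵐᵒᵖ Y]
    (g : X ≃ₗ[Aᵐᵒᵖ] Y) (h : ∀ (c : k) (y : Y), algebraMap k Aᵐᵒᵖ c • y = c • y) :
    (tensorFunctor k A N).obj X ≅ ModuleCat.of k (BalancedTensor k A Y N) :=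
  let := baseModule k A X
  have hs (c : k) (x : X) : c • x = algebraMap k Aᵐᵒᵖ c • x := rfl
  let φ : X →ₗ[k] Y :=
    { toFun := g, map_add' := g.map_add
      map_smul' := fun c x ↦ by rw [hs, map_smul, h, RingHom.id_apply] }
  let ψ : Y →ₗ[k] X :=
    { toFun := g.symm, map_add' := g.symm.map_add
      map_smul' := fun c x ↦ by rw [hs, ← h, map_smul, RingHom.id_apply] }
  { hom := ModuleCat.ofHom (BalancedTensor.map φ fun a x ↦ g.map_smul _ _)
    inv := ModuleCat.ofHom (BalancedTensor.map ψ fun a x ↦ g.symm.map_smul _ _)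
    hom_inv_id := ModuleCat.hom_ext <| BalancedTensor.ext fun x n ↦
      congrArg (fun z ↦ BalancedTensor.tmul k A z n) (g.symm_apply_apply x)
    inv_hom_id := ModuleCat.hom_ext <| BalancedTensor.ext fun x n ↦
      congrArg (fun z ↦ BalancedTensor.tmul k A z n) (g.apply_symm_apply x) }

end TensorIso

section Comparison

variable {k H : Type u} [CommRing k] [Ring H] [HopfAlgebra k H]

/-- `tensorFunctor` restricts scalars along `k → Hᵐᵒᵖ`, whereas tensor powers have their own
`k`-structure. The two agree because the iterated coproduct preserves `1`. -/
theorem algebraMap_smul_tpow (n : ℕ) (c : k) (x : TPow k H n) :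
    algebraMap k Hᵐᵒᵖ c • x = c • x := by
  rw [op_smul_def, MulOpposite.algebraMap_apply, MulOpposite.unop_op, Algebra.algebraMap_eq_smul_one,
    map_smul, iterComul_one, mul_smul_comm, mul_one]

variable [Coalgebra.IsCocomm k H] {M : Type u} [AddCommGroup M] [Module k M] [Module H M]
  [IsScalarTower k H M] (S : ModularCrossedModule k H M)

/-- The cyclic object of `M` is obtained from the tensor powers degreewise by `- ⊗_H M`. -/
def cyclicObjectIso (n : ℕ) :
    (tensorFunctor k H M).obj ((rightCyclic k H).X n) ≅ S.cyclicObject.X n :=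
  tensorIso k H M ((rightCyclic k H).X n) (Y := TPow k H (n + 1)) (LinearEquiv.refl _ _)
    (algebraMap_smul_tpow (n + 1))

theorem map_δ_comp_cyclicObjectIso (n : ℕ) (i : Fin (n + 2)) :
    (tensorFunctor k H M).map ((rightCyclic k H).δ i) ≫ (cyclicObjectIso S n).hom =
      (cyclicObjectIso S (n + 1)).hom ≫ S.cyclicObject.δ i := by
  let := baseModule k H ((rightCyclic k H).X (n + 1))
  exact ModuleCat.hom_ext <| BalancedTensor.ext fun x m ↦ rfl

/-- Here trivial coaction enters: the factor `m₍₁₎` multiplied into the rotated tensor is `1`, so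
only the rotation is left. -/
theorem map_t_comp_cyclicObjectIso (hS : ∀ m : M, S.coact m = m ⊗ₜ[k] (1 : H)) (n : ℕ) :
    (tensorFunctor k H M).map ((rightCyclic k H).t n) ≫ (cyclicObjectIso S n).hom =
      (cyclicObjectIso S n).hom ≫ S.cyclicObject.t n := by
  let := baseModule k H ((rightCyclic k H).X n)
  have h (x : TPow k H (n + 1)) (m : M) : BalancedTensor.tmul k H (rot (n + 1) x) m =
      S.cyc n (BalancedTensor.tmul k H x m) := by
    rw [S.cyc_tmul, hS, theta_tmul, cons_one_one, mul_one]
  exact ModuleCat.hom_ext <| BalancedTensor.ext fun x m ↦ h x m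

end Comparison

theorem nonempty_HC_equiv_pi_tor {k : Type u} [Field k] {H : Type u} [Ring H] [HopfAlgebra k H]
    [Coalgebra.IsCocomm k H] {M : Type u} [AddCommGroup M] [Module k M] [Module H M]
    [IsScalarTower k H M] (S : ModularCrossedModule k H M)
    (hS : ∀ m : M, S.coact m = m ⊗ₜ[k] (1 : H)) (n : ℕ) :
    Nonempty (S.HC n ≃ₗ[k] ∀ i : {i : ℕ // 2 * i ≤ n},
      tor k H M (n - 2 * i) (trivialRight k H)) := by
  let R := tensorResolution k H
  have hP (m : ℕ) : Projective ((rightCyclic k H).X m) :=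
    (IsProjective.iff_projective _).1 (projective_tpow (k := k) (H := H) m)
  have hb : (rightCyclic k H).b 0 ≫ R.π.f 0 = 0 := by
    rw [← CyclicObject.hochschild_d]
    exact (congrArg (_ ≫ ·) (ChainComplex.toSingle₀Equiv_symm_apply_f_zero _ _)).trans
      (d_augmentation k H)
  -- The comparison map is built over the right `H`-modules, before tensoring with `M`, because
  -- projectivity and exactness are available only there.
  let r : (rightCyclic k H).cyclicComplex ⟶ R.complex :=
    liftToResolution R _ ((rightCyclic k H).projZero 0) ((rightCyclic k H).d_projZero_comp _ hb)
  -- The resolution is the Hochschild complex itself, so the restriction of `r` to column 0 is an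
  -- endomorphism of it, and its degree 0 part determines it up to homotopy.
  have hr : ((rightCyclic k H).ofHochschild ≫ r).f 0 = 𝟙 _ := by
    refine (congrArg (_ ≫ ·) (liftToResolution_f_zero R _ _ _)).trans ?_
    exact (rightCyclic k H).inj_zero_projZero 0 _
  let ρ : S.cyclicObject.cyclicComplex ⟶
      ((tensorFunctor k H M).mapHomologicalComplex _).obj R.complex :=
    CyclicObject.mapRetraction (tensorFunctor k H M) (cyclicObjectIso S)
      (map_δ_comp_cyclicObjectIso S) (map_t_comp_cyclicObjectIso S hS) r
  have : QuasiIso (S.cyclicObject.ofHochschild ≫ ρ) :=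
    CyclicObject.quasiIso_mapRetraction (tensorFunctor k H M) (cyclicObjectIso S)
      (map_δ_comp_cyclicObjectIso S) (map_t_comp_cyclicObjectIso S hS) r (homotopyIdOfZero R _ hr)
  obtain ⟨E⟩ := S.cyclicObject.nonempty_homology_equiv_pi ρ n
  exact ⟨E.trans (LinearEquiv.piCongrRight fun i ↦
    (R.isoLeftDerivedObj (tensorFunctor k H M) (n - 2 * i)).toLinearEquiv.symm)⟩

end
end HopfCyclic

theorem mainTheorem7 {k : Type u} [Field k] {H : Type u} [Ring H] [HopfAlgebra k H]
    [Coalgebra.IsCocomm k H] {M : Type u} [AddCommGroup M] [Module k M] [Module H M]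
    [IsScalarTower k H M] (S : HopfCyclic.ModularCrossedModule k H M)
    (hS : ∀ m : M, S.coact m = m ⊗ₜ[k] (1 : H)) (n : ℕ) :
    Nonempty (S.HC n ≃ₗ[k] DirectSum {i : ℕ // 2 * i ≤ n} fun i ↦
      HopfCyclic.tor k H M (n - 2 * i) (HopfCyclic.trivialRight k H)) := by
  classical
  obtain ⟨E⟩ := HopfCyclic.nonempty_HC_equiv_pi_tor S hS n
  -- The index set embeds into `Fin (n + 1)`, so the product obtained above is also the direct sum.
  have : Finite {i : ℕ // 2 * i ≤ n} := Finite.of_injective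
    (fun i ↦ (⟨i, by have := i.2; omega⟩ : Fin (n + 1))) fun i j h ↦ Subtype.ext (Fin.mk.inj h)
  have := Fintype.ofFinite {i : ℕ // 2 * i ≤ n}
  exact ⟨E.trans (DirectSum.linearEquivFunOnFintype k _ _).symm⟩
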